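/- Let $g>0$, $L>0$, and let $U,H\in C^1([0,L])$ be real functions with $H(x)>0$ and $|U(x)|/\sqrt{gH(x)}<1$ for all $x\in[0,L]$ (subcritical background flow; constant $U,H$ are included). Put $$M=\begin{bmatrix}U&H\\ g&U\end{bmatrix},\qquad W=\begin{bmatrix}g&U\\ U&H\end{bmatrix},\qquad \|q\|_W^2=\int_0^L q^TWq\,dx .$$ Let $\alpha_1,\alpha_2,\beta_1,\beta_2\ge 0$ with $(\alpha_1,\alpha_2)\ne(0,0)$ and $(\beta_1,\beta_2)\ne(0,0)$. For $q=(h,u)^T$ consider the linear vector-invariant shallow water problem $$\frac{\partial q}{\partial t}=-\frac{\partial (Mq)}{\partial x}+G,\qquad q(\cdot,0)=f,\qquad \alpha_1F_1+\alpha_2F_2=0 \text{ at } x=0,\qquad \beta_1F_1-\beta_2F_2=0\text{ at }x=L,$$ with fluxes $F=Mq$, i.e. $F_1=Uh+Hu$ and $F_2=gh+Uu$, where $f\in L^2([0,L];\mathbb R^2)$ and $G:[0,T]\to L^2([0,L];\mathbb R^2)$ is strongly measurable and bounded. A solution on $[0,T]$ is a function $q\in C([0,T];L^2([0,L];\mathbb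 R^2))$ with $q(0)=f$ for which there are flux traces $F|_0,F|_L\in L^2(0,T;\mathbb R^2)$, satisfying the two boundary conditions for almost every time, such that for every $\varphi\in C^\infty(\mathbb R)$, $i\in\{1,2\}$ and $t\in[0,T]$ $$\int_0^L q_i(t)\varphi\,dx=\int_0^L f_i\varphi\,dx+\int_0^t\Big(\int_0^L F_i(\tau)\varphi'\,dx+\int_0^L G_i(\tau)\varphi\,dx+F_i|_0(\tau)\varphi(0)-F_i|_L(\tau)\varphi(L)\Big)d\tau .$$ Then the problem is strongly well-posed: there are constants $K>0$ and $\mu\in\mathbb R$ such that for all $T>0$, $f$ and $G$ as above there is a unique solution $q$ on $[0,T]$, and for all $t\in[0,T]$ $$\|q(t)\|_W\le K e^{\mu t}\Big(\|f\|_W+\sup_{\tau\in[0,t]}\|G(\cdot,\tau)\|_W\Big).$$ Moreover, for every solution, the boundary term $\mathrm{BT}=F_1F_2|_0-F_1F_2|_L$ satisfies $\mathrm{BT}\le 0$ for almost every time, and for every $t\in[0,T]$ this estimate holds with $$K=\max\Big(1,\frac{1-e^{-\mu t}}{\mu}\Big)\qquad(K=\max(1,t)\text{ if }\mu=0)$$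 for every real $\mu$ such that $\mathrm{BT}(\tau)/\|q(\tau)\|_W^2\le\mu$ for almost every $\tau\in[0,t]$ with $q(\tau)\ne 0$; in particular with $\mu=0$, and with $\mu=\max_{\tau\in[0,t]}\mathrm{BT}/\|q\|_W^2\le 0$ where this maximum exists. -/

import Mathlib

open Set MeasureTheory
open scoped Matrix ContDiff

noncomputable section

namespace LinearSWE

/-- The space `L²([0,L]; ℝ²)` of states `q = (h, u)`; `h` is component `0`, `u` is component `1`. -/
abbrev State (L : ℝ) : Type :=
  Lp (EuclideanSpace ℝ (Fin 2)) 2 (volume.restrict (Icc (0 : ℝ) L))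

/-- The coefficient matrix `M(x)` of the linear flux. -/
def fluxMatrix (g : ℝ) (U H : ℝ → ℝ) (x : ℝ) : Matrix (Fin 2) (Fin 2) ℝ :=
  !![U x, H x; g, U x]

/-- The weight matrix `W(x)`. -/
def weightMatrix (g : ℝ) (U H : ℝ → ℝ) (x : ℝ) : Matrix (Fin 2) (Fin 2) ℝ :=
  !![g, U x; U x, H x]

/-- The linear flux `F = M q`, that is `F₁ = U h + H u` (component `0`) and
`F₂ = g h + U u` (component `1`), as a function of `x`. -/
def flux (g : ℝ) (U H : ℝ → ℝ) {L : ℝ} (q : State L) (x : ℝ) : Fin 2 → ℝ :=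
  fluxMatrix g U H x *ᵥ (q x).ofLp

/-- The weighted inner product `(p, q)_W = ∫₀ᴸ pᵀ W q dx`. -/
def wInner (g : ℝ) (U H : ℝ → ℝ) {L : ℝ} (p q : State L) : ℝ :=
  ∫ x in Icc (0 : ℝ) L, (p x).ofLp ⬝ᵥ (weightMatrix g U H x *ᵥ (q x).ofLp)

/-- The weighted norm `‖q‖_W`. -/
def wNorm (g : ℝ) (U H : ℝ → ℝ) {L : ℝ} (q : State L) : ℝ :=
  √(wInner g U H q q)

/-- Admissible forcing on `[0,T]`: a strongly measurable and bounded function of time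
with values in `L²([0,L]; ℝ²)`. -/
structure IsForcing (g : ℝ) (U H : ℝ → ℝ) {L : ℝ} (T : ℝ) (G : ℝ → State L) : Prop where
  aestronglyMeasurable : AEStronglyMeasurable G (volume.restrict (Icc 0 T))
  bddAbove : BddAbove ((fun τ => wNorm g U H (G τ)) '' Icc 0 T)

/-- The supremum of `‖G(·,τ)‖_W` over `τ ∈ [0,t]` (the maximum, if it is attained). -/
def forcingSup (g : ℝ) (U H : ℝ → ℝ) {L : ℝ} (G : ℝ → State L) (t : ℝ) : ℝ :=
  sSup ((fun τ => wNorm g U H (G τ)) '' Icc 0 t)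

/-- `q` is a weak solution on `[0,L] × [0,T]` of `∂q/∂t = -∂(M q)/∂x + G`, `q(·,0) = f`,
with `α₁ F₁ + α₂ F₂ = 0` at `x = 0` and `β₁ F₁ - β₂ F₂ = 0` at `x = L`.
Here `q` is continuous in time with values in `L²`; the functions `F0` and `FL` of time are
the traces of the flux `F = M q` at `x = 0` and at `x = L`. They are pinned down by the weak
form, in which the test functions do not have to vanish at the end points. -/
structure IsWeakSolution (g L : ℝ) (U H : ℝ → ℝ) (α₁ α₂ β₁ β₂ T : ℝ)
    (f : State L) (G : ℝ → State L) (q : ℝ → State L) (F0 FL : ℝ → Fin 2 → ℝ) : Prop where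
  continuousOn : ContinuousOn q (Icc 0 T)
  initial : q 0 = f
  trace_zero : ∀ i, MemLp (fun τ => F0 τ i) 2 (volume.restrict (Icc 0 T))
  trace_L : ∀ i, MemLp (fun τ => FL τ i) 2 (volume.restrict (Icc 0 T))
  weak_form : ∀ φ : ℝ → ℝ, ContDiff ℝ ∞ φ → ∀ i : Fin 2, ∀ t ∈ Icc 0 T,
    ∫ x in Icc (0 : ℝ) L, q t x i * φ x =
      (∫ x in Icc (0 : ℝ) L, f x i * φ x) +
      ∫ τ in (0 : ℝ)..t,
        ((∫ x in Icc (0 : ℝ) L, flux g U H (q τ) x i * deriv φ x) +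
          (∫ x in Icc (0 : ℝ) L, G τ x i * φ x) +
          F0 τ i * φ 0 - FL τ i * φ L)
  bc_zero : ∀ᵐ τ ∂(volume.restrict (Icc 0 T)), α₁ * F0 τ 0 + α₂ * F0 τ 1 = 0
  bc_L : ∀ᵐ τ ∂(volume.restrict (Icc 0 T)), β₁ * FL τ 0 - β₂ * FL τ 1 = 0

/-- `q` is a weak solution on `[0,T]` (for some, then almost everywhere unique, flux traces). -/
def IsSolution (g L : ℝ) (U H : ℝ → ℝ) (α₁ α₂ β₁ β₂ T : ℝ)
    (f : State L) (G : ℝ → State L) (q : ℝ → State L) : Prop :=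
  ∃ F0 FL : ℝ → Fin 2 → ℝ, IsWeakSolution g L U H α₁ α₂ β₁ β₂ T f G q F0 FL

/-- The boundary term `BT = F₁ F₂ |₀ - F₁ F₂ |_L` as a function of time. -/
def boundaryTerm (F0 FL : ℝ → Fin 2 → ℝ) (τ : ℝ) : ℝ :=
  F0 τ 0 * F0 τ 1 - FL τ 0 * FL τ 1

/-- The factor `K = max(1, (1 - e^{-μt})/μ)`, which for `μ = 0` is `max(1, t)`. -/
def growthFactor (μ t : ℝ) : ℝ :=
  if μ = 0 then max 1 t else max 1 ((1 - Real.exp (-μ * t)) / μ)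

/-- Strong well-posedness: for all initial data and forcing there is one and only one solution,
and it satisfies the energy estimate, with constants independent of the data (and of the final
time). -/
def StronglyWellPosed (g L : ℝ) (U H : ℝ → ℝ) (α₁ α₂ β₁ β₂ : ℝ) : Prop :=
  ∃ K > (0 : ℝ), ∃ μ : ℝ, ∀ T > (0 : ℝ), ∀ (f : State L) (G : ℝ → State L),
    IsForcing g U H T G →
    ∃ q : ℝ → State L, IsSolution g L U H α₁ α₂ β₁ β₂ T f G q ∧
      (∀ p : ℝ → State L, IsSolution g L U H α₁ α₂ β₁ β₂ T f G p → EqOn p q (Icc 0 T)) ∧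
      ∀ t ∈ Icc 0 T, wNorm g U H (q t) ≤
        K * Real.exp (μ * t) * (wNorm g U H f + forcingSup g U H G t)

end LinearSWE

end

noncomputable section

namespace LinearSWE

/-! Let J exchange the two components. Then W = J M, so W q = (F₂, F₁), and the W-product of ∂F/∂x
with q is the x-derivative of F₁F₂ (`HasFlux.wInner_eq`). Sufficiently regular solutions therefore
satisfy d/dt ‖q‖_W² = 2 BT + 2 (G, q)_W (`IsRegular.energy_eq`). Subcriticality makes W positive
definite (`IsSubcritical.exists_coercive`) and M invertible. The boundary conditions force F₁F₂ ≤ 0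
at x = 0 and F₁F₂ ≥ 0 at x = L (`mul_nonpos_of_boundaryCond`), so BT ≤ 0. Grönwall's inequality for
the square root of the energy (`sqrt_le_gronwallBound`) then gives the estimate with the stated K.

A solution is only continuous in time with values in L², so its flux has traces only in an L² sense
in time. A second multiplier, (2x/L - 1) diag(g, H), produces a positive quadratic form in the
traces at both ends and bounds them in L²(0,T) by the state and the forcing
(`exists_regular_trace_bound`). Hence on regular solutions the map from data to state and traces is
bounded. By this bound the closure of its graph projects onto a closed space of data
(`isClosed_solvableData`). The weak form, the boundary conditions and the energy identity are all
continuous in data, state and traces, so they hold on the closure.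

That every datum is reached is a duality argument. A forcing orthogonal to the solvable ones solves
an adjoint problem weakly. The adjoint operator is dissipative for the form of W⁻¹
(`adjoint_dissipative`), so this forcing is zero (`eq_zero_of_adjoint`). Initial data are reached
because the domain of the spatial operator is dense (`eq_zero_of_orthogonal_domain`).

For uniqueness, the time integral of the difference of two weak solutions is a regular solution with
zero data, hence zero (`IsWeakSolution.unique`). Every weak solution thus coincides with the
constructed one, traces included, and inherits its energy identity. -/

/-! ### Absolutely continuous functions and weak derivatives. -/

/-- The product rule for two absolutely continuous functions. The energy, multiplier and adjoint
computations all reduce to it. -/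
theorem integral_mul_primitive_add_primitive_mul {u v : ℝ → ℝ} {c L : ℝ} (a b : ℝ)
    (hu : IntervalIntegrable u volume c L) (hv : IntervalIntegrable v volume c L) :
    ∫ x in c..L, (u x * (b + ∫ y in c..x, v y) + (a + ∫ y in c..x, u y) * v x) =
      (a + ∫ y in c..L, u y) * (b + ∫ y in c..L, v y) - a * b := by
  have hU := hu.absolutelyContinuousOnInterval_intervalIntegral (c := c) (by simp)
  have hV := hv.absolutelyContinuousOnInterval_intervalIntegral (c := c) (by simp)
  have key := hU.integral_deriv_mul_eq_sub hV
  have key2 : ∫ x in c..L, (u x * (∫ y in c..x, v y) + (∫ y in c..x, u y) * v x) =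
      (∫ y in c..L, u y) * (∫ y in c..L, v y) := by
    rw [intervalIntegral.integral_same, zero_mul, sub_zero] at key
    rw [← key]
    apply intervalIntegral.integral_congr_ae
    filter_upwards [hu.ae_hasDerivAt_integral, hv.ae_hasDerivAt_integral] with x h1 h2 hx
    have hx' := uIoc_subset_uIcc hx
    rw [(h1 hx' c (by simp)).deriv, (h2 hx' c (by simp)).deriv]
  have i1 := hu.mul_continuousOn hV.continuousOn
  have i2 := hv.continuousOn_mul hU.continuousOn
  have : ∀ x, u x * (b + ∫ y in c..x, v y) + (a + ∫ y in c..x, u y) * v x =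
      (u x * (∫ y in c..x, v y) + (∫ y in c..x, u y) * v x) + (b * u x + a * v x) :=
    fun x => by ring
  simp only [this]
  rw [intervalIntegral.integral_add (i1.add i2) ((hu.const_mul b).add (hv.const_mul a)),
    intervalIntegral.integral_add (hu.const_mul b) (hv.const_mul a),
    intervalIntegral.integral_const_mul, intervalIntegral.integral_const_mul, key2]
  ring

theorem exists_contDiff_primitive {ψ : ℝ → ℝ} (hψ : ContDiff ℝ ∞ ψ) :
    ∃ φ : ℝ → ℝ, ContDiff ℝ ∞ φ ∧ deriv φ = ψ := by
  refine ⟨fun x => ∫ y in (0 : ℝ)..x, ψ y, ?_, ?_⟩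
  · rw [contDiff_infty_iff_deriv]
    have hd : ∀ x, HasDerivAt (fun x => ∫ y in (0 : ℝ)..x, ψ y) (ψ x) x := fun x =>
      (hψ.continuous.integral_hasStrictDerivAt 0 x).hasDerivAt
    refine ⟨fun x => (hd x).differentiableAt, ?_⟩
    rwa [show deriv (fun x => ∫ y in (0 : ℝ)..x, ψ y) = ψ from funext fun x => (hd x).deriv]
  · exact funext fun x => (hψ.continuous.integral_hasStrictDerivAt 0 x).hasDerivAt.deriv

theorem primitive_eq_of_deriv {φ : ℝ → ℝ} (hφ : ContDiff ℝ ∞ φ) (x : ℝ) :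
    φ x = φ 0 + ∫ y in (0 : ℝ)..x, deriv φ y := by
  rw [intervalIntegral.integral_deriv_eq_sub]
  · ring
  · intro x _
    exact (hφ.differentiable (by simp)).differentiableAt
  · exact ((hφ.continuous_deriv (by simp)).intervalIntegrable _ _)

/-- Integration by parts of an absolutely continuous function against a smooth one. -/
theorem integral_primitive_mul_deriv {v φ : ℝ → ℝ} {L : ℝ} (a : ℝ)
    (hv : IntervalIntegrable v volume 0 L) (hφ : ContDiff ℝ ∞ φ) :
    (∫ x in (0 : ℝ)..L, (a + ∫ y in (0 : ℝ)..x, v y) * deriv φ x) + ∫ x in (0 : ℝ)..L, v x * φ x =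
      (a + ∫ y in (0 : ℝ)..L, v y) * φ L - a * φ 0 := by
  have hd : IntervalIntegrable (deriv φ) volume 0 L :=
    (hφ.continuous_deriv (by simp)).intervalIntegrable _ _
  have key := integral_mul_primitive_add_primitive_mul a (φ 0) hv hd
  simp only [← primitive_eq_of_deriv hφ] at key
  rw [← key, intervalIntegral.integral_add, add_comm]
  · exact hv.mul_continuousOn hφ.continuous.continuousOn
  · have hV := hv.absolutelyContinuousOnInterval_intervalIntegral (c := 0) (by simp)
    exact hd.continuousOn_mul (continuousOn_const.add hV.continuousOn)

/-- A function whose distributional derivative, tested up to the boundary, is `v`, is a primitive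
of `v`. -/
theorem eq_primitive_of_weak {F v : ℝ → ℝ} {L a b : ℝ} (hL : 0 < L)
    (hF : IntervalIntegrable F volume 0 L) (hv : IntervalIntegrable v volume 0 L)
    (h : ∀ φ : ℝ → ℝ, ContDiff ℝ ∞ φ →
      (∫ x in (0 : ℝ)..L, F x * deriv φ x) + a * φ 0 - b * φ L = - ∫ x in (0 : ℝ)..L, v x * φ x) :
    (∀ᵐ x ∂(volume.restrict (Icc 0 L)), F x = a + ∫ y in (0 : ℝ)..x, v y) ∧
      b = a + ∫ y in (0 : ℝ)..L, v y := by
  have hb : b = a + ∫ y in (0 : ℝ)..L, v y := by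
    have := h (fun _ => 1) contDiff_const
    simp at this
    linarith
  refine ⟨?_, hb⟩
  have hV := hv.absolutelyContinuousOnInterval_intervalIntegral (c := 0) (by simp)
  have hE : IntervalIntegrable (fun x => a + ∫ y in (0 : ℝ)..x, v y) volume 0 L :=
    (continuousOn_const.add hV.continuousOn).intervalIntegrable
  have toIcc : ∀ {f : ℝ → ℝ}, IntervalIntegrable f volume 0 L → IntegrableOn f (Icc 0 L) := by
    intro f hf
    rwa [integrableOn_Icc_iff_integrableOn_Ioc, ← intervalIntegrable_iff_integrableOn_Ioc_of_le hL.le]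
  refine ae_eq_of_integral_contDiff_smul_eq (Integrable.locallyIntegrable (toIcc hF))
    (Integrable.locallyIntegrable (toIcc hE)) ?_
  intro ψ hψ _
  -- Test functions need not vanish at the end points, so every smooth function is the derivative of
  -- an admissible one. This determines F exactly, with no free constant.
  obtain ⟨φ, hφ, rfl⟩ := exists_contDiff_primitive hψ
  have e1 := h φ hφ
  have e2 := integral_primitive_mul_deriv a hv hφ
  rw [integral_Icc_eq_integral_Ioc, integral_Icc_eq_integral_Ioc,
    ← intervalIntegral.integral_of_le hL.le, ← intervalIntegral.integral_of_le hL.le]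
  simp only [smul_eq_mul, mul_comm (deriv φ _)]
  rw [← hb] at e2
  linarith

/-! ### Grönwall's inequality for the square root of an energy. -/

theorem gronwallBound_continuous_pair (K x : ℝ) (δ S : ℝ) :
    Continuous fun ε => gronwallBound (δ + ε) K (S + ε) x := by
  by_cases hK : K = 0
  · simp only [gronwallBound_K0, hK]
    fun_prop
  · simp only [gronwallBound_of_K_ne_0 hK]
    fun_prop

theorem gronwallBound_pos {δ K ε x : ℝ} (hδ : 0 < δ) (hε : 0 ≤ ε) (hx : 0 ≤ x) :
    0 < gronwallBound δ K ε x := by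
  unfold gronwallBound
  split_ifs with hK
  · positivity
  · have : 0 ≤ ε / K * (Real.exp (K * x) - 1) := by
      rcases lt_or_gt_of_ne hK with hK | hK
      · have : Real.exp (K * x) ≤ 1 := Real.exp_le_one_iff.2 (by nlinarith)
        exact mul_nonneg_of_nonpos_of_nonpos (div_nonpos_of_nonneg_of_nonpos hε hK.le) (by linarith)
      · have : 1 ≤ Real.exp (K * x) := Real.one_le_exp (by positivity)
        exact mul_nonneg (by positivity) (by linarith)
    have := mul_pos hδ (Real.exp_pos (K * x))
    linarith

/-- Grönwall's inequality for the square root of an energy. -/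
theorem sqrt_le_gronwallBound {y : ℝ → ℝ} {t μ S : ℝ} (ht : 0 ≤ t) (hS : 0 ≤ S)
    (hy : ContinuousOn y (Icc 0 t)) (hy0 : ∀ s ∈ Icc 0 t, 0 ≤ y s)
    (h : ∀ s ∈ Icc 0 t, ∀ s' ∈ Icc s t,
      y s' - y s ≤ ∫ τ in s..s', (2 * μ * y τ + 2 * S * √(y τ))) :
    √(y t) ≤ gronwallBound (√(y 0)) μ S t := by
  have hφ : ContinuousOn (fun τ => 2 * μ * y τ + 2 * S * √(y τ)) (Icc 0 t) := by fun_prop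
  -- Compare y with B², where B' = μB + S + ε. Where y = B², the slope of y is at most 2μB² + 2SB,
  -- strictly below (B²)'. The shift ε gives this strictness and keeps B positive, so that √y causes
  -- no trouble at zero.
  have key : ∀ ε > 0, √(y t) ≤ gronwallBound (√(y 0) + ε) μ (S + ε) t := by
    intro ε hε
    set B : ℝ → ℝ := gronwallBound (√(y 0) + ε) μ (S + ε) with hB
    have hBpos : ∀ x, 0 ≤ x → 0 < B x := fun x hx =>
      gronwallBound_pos (by positivity) (by positivity) hx
    have hBd := hasDerivAt_gronwallBound (√(y 0) + ε) μ (S + ε)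
    have := image_le_of_liminf_slope_right_lt_deriv_boundary (f := y)
      (f' := fun τ => 2 * μ * y τ + 2 * S * √(y τ)) (a := 0) (b := t)
      (B := fun x => B x ^ 2) (B' := fun x => 2 * B x * (μ * B x + (S + ε))) hy ?_ ?_ ?_ ?_
      (right_mem_Icc.2 ht)
    · exact (Real.sqrt_le_left (hBpos t ht).le).2 this
    · intro x hx r hr
      have hd : HasDerivWithinAt (fun z => ∫ τ in x..z, (2 * μ * y τ + 2 * S * √(y τ)))
          (2 * μ * y x + 2 * S * √(y x)) (Ici x) x := by
        have hsub : Icc x t ∈ nhdsWithin x (Ioi x) := Icc_mem_nhdsGT hx.2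
        have hc : ContinuousOn (fun τ => 2 * μ * y τ + 2 * S * √(y τ)) (Icc x t) :=
          hφ.mono (Icc_subset_Icc_left hx.1)
        refine intervalIntegral.integral_hasDerivWithinAt_right (by simp) (t := Ioi x) ?_ ?_
        · exact ⟨Icc x t, hsub, hc.aestronglyMeasurable measurableSet_Icc⟩
        · exact (hc x (left_mem_Icc.2 hx.2.le)).mono_of_mem_nhdsWithin hsub
      have hs := (hasDerivWithinAt_iff_tendsto_slope' (lt_irrefl x)).1 hd.Ioi_of_Ici
      have h1 := hs.eventually (Iio_mem_nhds hr)
      have h2 : ∀ᶠ z in nhdsWithin x (Ioi x), z ∈ Ioc x t := Ioc_mem_nhdsGT hx.2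
      have h3 : ∀ᶠ z in nhdsWithin x (Ioi x),
          slope (fun z => ∫ τ in x..z, (2 * μ * y τ + 2 * S * √(y τ))) x z < r ∧ z ∈ Ioc x t :=
        h1.and h2
      refine h3.frequently.mono ?_
      rintro z ⟨hz1, hz2⟩
      refine lt_of_le_of_lt ?_ hz1
      simp only [slope_def_field, intervalIntegral.integral_same, sub_zero]
      have := h x ⟨hx.1, hx.2.le⟩ z ⟨hz2.1.le, hz2.2⟩
      have hzx : 0 < z - x := sub_pos.2 hz2.1
      gcongr
    · have : B 0 = √(y 0) + ε := gronwallBound_x0 _ _ _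
      simp only [this]
      have h0 := Real.sq_sqrt (hy0 0 (left_mem_Icc.2 ht))
      nlinarith [Real.sqrt_nonneg (y 0)]
    · intro x
      have := (hBd x).pow 2
      convert! this using 1
      simp [hB]
    · intro x hx hyx
      have hp := hBpos x hx.1
      simp only [hyx, Real.sqrt_sq hp.le]
      nlinarith
  have hlim : Filter.Tendsto (fun ε => gronwallBound (√(y 0) + ε) μ (S + ε) t)
      (nhdsWithin 0 (Ioi 0)) (nhds (gronwallBound (√(y 0)) μ S t)) := by
    have := (gronwallBound_continuous_pair μ t (√(y 0)) S).tendsto 0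
    simp only [add_zero] at this
    exact this.mono_left nhdsWithin_le_nhds
  exact ge_of_tendsto hlim (eventually_nhdsWithin_of_forall key)

/-- For μ ≠ 0 the Grönwall bound equals e^{μt}(δ + S(1 - e^{-μt})/μ). Both coefficients in the
bracket are at most K. -/
theorem gronwallBound_le_growthFactor {δ μ S t : ℝ} (hδ : 0 ≤ δ) (hS : 0 ≤ S) :
    gronwallBound δ μ S t ≤ growthFactor μ t * Real.exp (μ * t) * (δ + S) := by
  unfold gronwallBound growthFactor
  split_ifs with hμ
  · simp only [hμ, zero_mul, Real.exp_zero, mul_one]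
    have h1 : 1 ≤ max 1 t := le_max_left _ _
    have h2 : t ≤ max 1 t := le_max_right _ _
    nlinarith
  · have h1 : 1 ≤ max 1 ((1 - Real.exp (-μ * t)) / μ) := le_max_left _ _
    have h2 : (1 - Real.exp (-μ * t)) / μ ≤ max 1 ((1 - Real.exp (-μ * t)) / μ) :=
      le_max_right _ _
    have h3 : S / μ * (Real.exp (μ * t) - 1) =
        Real.exp (μ * t) * (S * ((1 - Real.exp (-μ * t)) / μ)) := by
      have : Real.exp (μ * t) * Real.exp (-μ * t) = 1 := by
        rw [← Real.exp_add]; simp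
      rw [neg_mul] at this ⊢
      field_simp
      linear_combination S * this
    rw [h3]
    have he := (Real.exp_pos (μ * t)).le
    have h4 : δ + S * ((1 - Real.exp (-μ * t)) / μ) ≤
        max 1 ((1 - Real.exp (-μ * t)) / μ) * (δ + S) := by nlinarith
    nlinarith [mul_le_mul_of_nonneg_left h4 he]

/-! ### The state space and multiplication by matrix functions. -/

section

theorem memLp_apply {L : ℝ} (q : State L) (i : Fin 2) :
    MemLp (fun x => q x i) 2 (volume.restrict (Icc (0 : ℝ) L)) :=
  (EuclideanSpace.proj (𝕜 := ℝ) i).comp_memLp' (Lp.memLp q)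

theorem integrable_apply {L : ℝ} (q : State L) (i : Fin 2) :
    Integrable (fun x => q x i) (volume.restrict (Icc (0 : ℝ) L)) :=
  (memLp_apply q i).integrable (by norm_num)

theorem intervalIntegrable_of_Icc {E : Type*} [NormedAddCommGroup E] {f : ℝ → E} {L x : ℝ}
    (hx : x ∈ Icc 0 L)
    (hf : IntegrableOn f (Icc 0 L)) : IntervalIntegrable f volume 0 x := by
  rw [intervalIntegrable_iff_integrableOn_Ioc_of_le hx.1]
  exact hf.mono_set (Ioc_subset_Icc_self.trans (Icc_subset_Icc_right hx.2))

theorem intervalIntegrable_apply {L : ℝ} (q : State L) (i : Fin 2) {x : ℝ} (hx : x ∈ Icc 0 L) :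
    IntervalIntegrable (fun x => q x i) volume 0 x :=
  intervalIntegrable_of_Icc hx (integrable_apply q i)

theorem integral_Icc_eq {E : Type*} [NormedAddCommGroup E] [NormedSpace ℝ E] {L : ℝ}
    (hL : 0 ≤ L) (f : ℝ → E) :
    ∫ x in Icc 0 L, f x = ∫ x in (0 : ℝ)..L, f x := by
  rw [integral_Icc_eq_integral_Ioc, intervalIntegral.integral_of_le hL]

theorem intervalIntegral_congr_Icc {f h : ℝ → ℝ} {L x : ℝ} (hx : x ∈ Icc 0 L)
    (hf : ∀ᵐ y ∂(volume.restrict (Icc 0 L)), f y = h y) :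
    ∫ y in (0 : ℝ)..x, f y = ∫ y in (0 : ℝ)..x, h y := by
  apply intervalIntegral.integral_congr_ae
  rw [ae_restrict_iff' measurableSet_Icc] at hf
  filter_upwards [hf] with y hy hy'
  rw [uIoc_of_le hx.1] at hy'
  exact hy ⟨hy'.1.le, hy'.2.trans hx.2⟩

theorem primitive_add {L : ℝ} (v w : State L) (i : Fin 2) {x : ℝ} (hx : x ∈ Icc 0 L) :
    ∫ y in (0 : ℝ)..x, (v + w) y i = (∫ y in (0 : ℝ)..x, v y i) + ∫ y in (0 : ℝ)..x, w y i := by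
  rw [← intervalIntegral.integral_add (intervalIntegrable_apply v i hx)
    (intervalIntegrable_apply w i hx)]
  apply intervalIntegral_congr_Icc hx
  filter_upwards [Lp.coeFn_add v w] with y hy
  rw [hy, Pi.add_apply, PiLp.add_apply]

theorem primitive_smul {L : ℝ} (c : ℝ) (v : State L) (i : Fin 2) {x : ℝ} (hx : x ∈ Icc 0 L) :
    ∫ y in (0 : ℝ)..x, (c • v) y i = c * ∫ y in (0 : ℝ)..x, v y i := by
  rw [← intervalIntegral.integral_const_mul]
  apply intervalIntegral_congr_Icc hx
  filter_upwards [Lp.coeFn_smul c v] with y hy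
  rw [hy, Pi.smul_apply, PiLp.smul_apply, smul_eq_mul]

theorem continuousOn_primitive_apply {L : ℝ} (hL : 0 ≤ L) (v : State L) (i : Fin 2) :
    ContinuousOn (fun x => ∫ y in (0 : ℝ)..x, v y i) (Icc 0 L) := by
  have := (intervalIntegrable_apply v i (right_mem_Icc.2
    hL)).absolutelyContinuousOnInterval_intervalIntegral (c := 0) (by simp)
  simpa [uIcc_of_le hL] using this.continuousOn

theorem memLp_of_continuousOn {L : ℝ} {f : ℝ → ℝ} (hf : ContinuousOn f (Icc 0 L)) :
    MemLp f 2 (volume.restrict (Icc (0 : ℝ) L)) := by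
  obtain ⟨C, hC⟩ := isCompact_Icc.exists_bound_of_continuousOn hf
  exact MemLp.of_bound (hf.aestronglyMeasurable measurableSet_Icc) C
    ((ae_restrict_iff' measurableSet_Icc).2 (.of_forall hC))

/-- The state with given square integrable components. -/
def toState {L : ℝ} (F : ℝ → Fin 2 → ℝ)
    (hF : ∀ i, MemLp (fun x => F x i) 2 (volume.restrict (Icc (0 : ℝ) L))) : State L :=
  MemLp.toLp (fun x => WithLp.toLp 2 (F x)) (MemLp.of_eval_piLp hF)

theorem toState_apply {L : ℝ} {F : ℝ → Fin 2 → ℝ}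
    (hF : ∀ i, MemLp (fun x => F x i) 2 (volume.restrict (Icc (0 : ℝ) L))) :
    ∀ᵐ x ∂(volume.restrict (Icc (0 : ℝ) L)), ∀ i, toState F hF x i = F x i := by
  filter_upwards [MemLp.coeFn_toLp (MemLp.of_eval_piLp (f := fun x => WithLp.toLp 2 (F x)) hF)]
    with x hx i
  rw [toState, hx]

theorem inner_state {L : ℝ} (p q : State L) :
    inner ℝ p q = ∫ x in Icc (0 : ℝ) L, (p x).ofLp ⬝ᵥ (q x).ofLp := by
  rw [L2.inner_def]
  refine integral_congr_ae (.of_forall fun x => ?_)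
  simp [PiLp.inner_apply, dotProduct, mul_comm]

theorem state_ext {L : ℝ} {p q : State L}
    (h : ∀ᵐ x ∂(volume.restrict (Icc (0 : ℝ) L)), ∀ i, p x i = q x i) : p = q := by
  apply Lp.ext
  filter_upwards [h] with x hx
  ext i
  exact hx i

theorem memLp_toEuclideanCLM {L : ℝ} {A : ℝ → Matrix (Fin 2) (Fin 2) ℝ}
    (hA : ContinuousOn A (Icc 0 L)) :
    MemLp (fun x => Matrix.toEuclideanCLM (𝕜 := ℝ) (n := Fin 2) (A x)) ⊤
      (volume.restrict (Icc (0 : ℝ) L)) := by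
  have hc : ContinuousOn (fun x => Matrix.toEuclideanCLM (𝕜 := ℝ) (n := Fin 2) (A x))
      (Icc 0 L) :=
    ((LinearMap.continuous_of_finiteDimensional
      (Matrix.toEuclideanCLM (𝕜 := ℝ) (n := Fin 2)).toAlgEquiv.toLinearMap).comp_continuousOn hA)
  obtain ⟨C, hC⟩ := isCompact_Icc.exists_bound_of_continuousOn hc
  exact memLp_top_of_bound (hc.aestronglyMeasurable measurableSet_Icc) C
    ((ae_restrict_iff' measurableSet_Icc).2 (.of_forall hC))

/-- Multiplication of a state by a continuous matrix function. -/
def matOp {L : ℝ} (A : ℝ → Matrix (Fin 2) (Fin 2) ℝ) (hA : ContinuousOn A (Icc 0 L)) :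
    State L →L[ℝ] State L :=
  (ContinuousLinearMap.id ℝ (EuclideanSpace ℝ (Fin 2) →L[ℝ] EuclideanSpace ℝ (Fin 2))).holderL
    (volume.restrict (Icc (0 : ℝ) L)) ⊤ 2 2 ((memLp_toEuclideanCLM hA).toLp _)

theorem matOp_apply {L : ℝ} {A : ℝ → Matrix (Fin 2) (Fin 2) ℝ} (hA : ContinuousOn A (Icc 0 L))
    (q : State L) :
    ∀ᵐ x ∂(volume.restrict (Icc (0 : ℝ) L)), (matOp A hA q x).ofLp = A x *ᵥ (q x).ofLp := by
  simp only [matOp, ContinuousLinearMap.holderL_apply_apply]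
  filter_upwards [ContinuousLinearMap.coeFn_holder (p := ⊤) (q := 2) (r := 2) (ContinuousLinearMap.id ℝ
    (EuclideanSpace ℝ (Fin 2) →L[ℝ] EuclideanSpace ℝ (Fin 2))) ((memLp_toEuclideanCLM hA).toLp _) q,
    MemLp.coeFn_toLp (memLp_toEuclideanCLM hA)] with x h1 h2
  rw [h1, h2]
  simp

/-- The bilinear form `∫₀ᴸ pᵀ A q dx`. -/
def matForm {L : ℝ} (A : ℝ → Matrix (Fin 2) (Fin 2) ℝ) (hA : ContinuousOn A (Icc 0 L))
    (p q : State L) : ℝ :=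
  inner ℝ p (matOp A hA q)

theorem matForm_eq {L : ℝ} {A : ℝ → Matrix (Fin 2) (Fin 2) ℝ} (hA : ContinuousOn A (Icc 0 L))
    (p q : State L) :
    matForm A hA p q = ∫ x in Icc (0 : ℝ) L, (p x).ofLp ⬝ᵥ (A x *ᵥ (q x).ofLp) := by
  rw [matForm, inner_state]
  refine integral_congr_ae ?_
  filter_upwards [matOp_apply hA q] with x hx
  rw [hx]

theorem integrable_matForm {L : ℝ} {A : ℝ → Matrix (Fin 2) (Fin 2) ℝ}
    (hA : ContinuousOn A (Icc 0 L)) (p q : State L) :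
    Integrable (fun x => (p x).ofLp ⬝ᵥ (A x *ᵥ (q x).ofLp)) (volume.restrict (Icc (0 : ℝ) L)) := by
  refine (L2.integrable_inner (𝕜 := ℝ) p (matOp A hA q)).congr ?_
  filter_upwards [matOp_apply hA q] with x hx
  rw [← hx]
  simp [PiLp.inner_apply, dotProduct, mul_comm]

theorem matForm_comm {L : ℝ} {A : ℝ → Matrix (Fin 2) (Fin 2) ℝ} (hA : ContinuousOn A (Icc 0 L))
    (hs : ∀ x, A x 0 1 = A x 1 0) (p q : State L) : matForm A hA p q = matForm A hA q p := by
  rw [matForm_eq, matForm_eq]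
  refine integral_congr_ae (.of_forall fun x => ?_)
  simp only [dotProduct, Matrix.mulVec, Fin.sum_univ_two, hs]
  ring

theorem abs_matForm_le {L : ℝ} {A : ℝ → Matrix (Fin 2) (Fin 2) ℝ} (hA : ContinuousOn A (Icc 0 L))
    (p q : State L) : |matForm A hA p q| ≤ ‖matOp A hA‖ * ‖p‖ * ‖q‖ := by
  refine (abs_real_inner_le_norm _ _).trans ?_
  have := (matOp A hA).le_opNorm q
  nlinarith [norm_nonneg p]

/-- Regularity, positivity and subcriticality of the background flow. -/
structure IsSubcritical (g L : ℝ) (U H : ℝ → ℝ) : Prop where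
  g_pos : 0 < g
  L_pos : 0 < L
  continuousOn_U : ContinuousOn U (Icc 0 L)
  contDiffOn_H : ContDiffOn ℝ 1 H (Icc 0 L)
  H_pos : ∀ x ∈ Icc 0 L, 0 < H x
  det_pos : ∀ x ∈ Icc 0 L, 0 < g * H x - U x ^ 2

/-! ### Consequences of subcriticality for M and W. -/

section

variable {g L : ℝ} {U H : ℝ → ℝ}

theorem IsSubcritical.continuousOn_H (hs : IsSubcritical g L U H) : ContinuousOn H (Icc 0 L) :=
  hs.contDiffOn_H.continuousOn

theorem IsSubcritical.zero_mem (hs : IsSubcritical g L U H) : (0 : ℝ) ∈ Icc 0 L :=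
  left_mem_Icc.2 hs.L_pos.le

theorem IsSubcritical.L_mem (hs : IsSubcritical g L U H) : L ∈ Icc 0 L :=
  right_mem_Icc.2 hs.L_pos.le

theorem continuousOn_matrix_two {s : Set ℝ} {a b c d : ℝ → ℝ} (ha : ContinuousOn a s)
    (hb : ContinuousOn b s) (hc : ContinuousOn c s) (hd : ContinuousOn d s) :
    ContinuousOn (fun x => !![a x, b x; c x, d x]) s := by
  refine continuousOn_pi.2 fun i => continuousOn_pi.2 fun j => ?_
  fin_cases i <;> fin_cases j <;> simpa

theorem IsSubcritical.continuousOn_fluxMatrix (hs : IsSubcritical g L U H) :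
    ContinuousOn (fluxMatrix g U H) (Icc 0 L) :=
  continuousOn_matrix_two hs.continuousOn_U hs.continuousOn_H continuousOn_const hs.continuousOn_U

theorem IsSubcritical.continuousOn_weightMatrix (hs : IsSubcritical g L U H) :
    ContinuousOn (weightMatrix g U H) (Icc 0 L) :=
  continuousOn_matrix_two continuousOn_const hs.continuousOn_U hs.continuousOn_U hs.continuousOn_H

/-- The inverse of the flux matrix. -/
def invFluxMatrix (g : ℝ) (U H : ℝ → ℝ) (x : ℝ) : Matrix (Fin 2) (Fin 2) ℝ :=
  !![-U x / (g * H x - U x ^ 2), H x / (g * H x - U x ^ 2);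
    g / (g * H x - U x ^ 2), -U x / (g * H x - U x ^ 2)]

/-- The transposed inverse of the flux matrix. -/
def invFluxMatrixT (g : ℝ) (U H : ℝ → ℝ) (x : ℝ) : Matrix (Fin 2) (Fin 2) ℝ :=
  !![-U x / (g * H x - U x ^ 2), g / (g * H x - U x ^ 2);
    H x / (g * H x - U x ^ 2), -U x / (g * H x - U x ^ 2)]

/-- The inverse of the weight matrix. -/
def invWeightMatrix (g : ℝ) (U H : ℝ → ℝ) (x : ℝ) : Matrix (Fin 2) (Fin 2) ℝ :=
  !![H x / (g * H x - U x ^ 2), -U x / (g * H x - U x ^ 2);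
    -U x / (g * H x - U x ^ 2), g / (g * H x - U x ^ 2)]

theorem IsSubcritical.continuousOn_det (hs : IsSubcritical g L U H) :
    ContinuousOn (fun x => g * H x - U x ^ 2) (Icc 0 L) :=
  (continuousOn_const.mul hs.continuousOn_H).sub (hs.continuousOn_U.pow 2)

theorem IsSubcritical.continuousOn_div_det (hs : IsSubcritical g L U H) {f : ℝ → ℝ}
    (hf : ContinuousOn f (Icc 0 L)) :
    ContinuousOn (fun x => f x / (g * H x - U x ^ 2)) (Icc 0 L) :=
  hf.div hs.continuousOn_det fun x hx => (hs.det_pos x hx).ne'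

theorem IsSubcritical.continuousOn_invFluxMatrix (hs : IsSubcritical g L U H) :
    ContinuousOn (invFluxMatrix g U H) (Icc 0 L) :=
  continuousOn_matrix_two (hs.continuousOn_div_det hs.continuousOn_U.neg)
    (hs.continuousOn_div_det hs.continuousOn_H) (hs.continuousOn_div_det continuousOn_const)
    (hs.continuousOn_div_det hs.continuousOn_U.neg)

theorem IsSubcritical.continuousOn_invFluxMatrixT (hs : IsSubcritical g L U H) :
    ContinuousOn (invFluxMatrixT g U H) (Icc 0 L) :=
  continuousOn_matrix_two (hs.continuousOn_div_det hs.continuousOn_U.neg)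
    (hs.continuousOn_div_det continuousOn_const) (hs.continuousOn_div_det hs.continuousOn_H)
    (hs.continuousOn_div_det hs.continuousOn_U.neg)

theorem IsSubcritical.continuousOn_invWeightMatrix (hs : IsSubcritical g L U H) :
    ContinuousOn (invWeightMatrix g U H) (Icc 0 L) :=
  continuousOn_matrix_two (hs.continuousOn_div_det hs.continuousOn_H)
    (hs.continuousOn_div_det hs.continuousOn_U.neg) (hs.continuousOn_div_det hs.continuousOn_U.neg)
    (hs.continuousOn_div_det continuousOn_const)

theorem flux_zero (q : State L) (x : ℝ) : flux g U H q x 0 = U x * q x 0 + H x * q x 1 := by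
  simp [flux, fluxMatrix, Matrix.mulVec, dotProduct, Fin.sum_univ_two]

theorem flux_one (q : State L) (x : ℝ) : flux g U H q x 1 = g * q x 0 + U x * q x 1 := by
  simp [flux, fluxMatrix, Matrix.mulVec, dotProduct, Fin.sum_univ_two]

theorem IsSubcritical.wInner_eq (hs : IsSubcritical g L U H) (p q : State L) :
    wInner g U H p q = matForm (weightMatrix g U H) hs.continuousOn_weightMatrix p q :=
  (matForm_eq _ _ _).symm

theorem ae_mem_Icc (L : ℝ) : ∀ᵐ x ∂(volume.restrict (Icc (0 : ℝ) L)), x ∈ Icc 0 L :=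
  ae_restrict_mem measurableSet_Icc

/-- The weighted norm controls the `L²` norm. -/
theorem IsSubcritical.exists_coercive (hs : IsSubcritical g L U H) :
    ∃ c > 0, ∀ q : State L, c * ‖q‖ ^ 2 ≤ wInner g U H q q := by
  -- The ratio det W / tr W bounds the smallest eigenvalue of W from below. Pointwise this is the
  -- Cayley-Hamilton identity (tr W) qᵀWq = |Wq|² + (det W)|q|².
  have hc : ContinuousOn (fun x => (g * H x - U x ^ 2) / (g + H x)) (Icc 0 L) :=
    hs.continuousOn_det.div (continuousOn_const.add hs.continuousOn_H)
      fun x hx => (add_pos hs.g_pos (hs.H_pos x hx)).ne'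
  obtain ⟨x₀, hx₀, hmin⟩ := isCompact_Icc.exists_isMinOn ⟨0, hs.zero_mem⟩ hc
  refine ⟨_, div_pos (hs.det_pos x₀ hx₀) (add_pos hs.g_pos (hs.H_pos x₀ hx₀)), fun q => ?_⟩
  set c := (g * H x₀ - U x₀ ^ 2) / (g + H x₀)
  rw [← real_inner_self_eq_norm_sq, L2.inner_def, hs.wInner_eq, matForm_eq, ← integral_const_mul]
  refine integral_mono_ae ((L2.integrable_inner (𝕜 := ℝ) q q).const_mul c)
    (integrable_matForm hs.continuousOn_weightMatrix q q) ?_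
  filter_upwards [ae_mem_Icc L] with x hx
  have hcx : c ≤ (g * H x - U x ^ 2) / (g + H x) := hmin hx
  have hg := hs.g_pos
  have hH := hs.H_pos x hx
  rw [le_div_iff₀ (add_pos hg hH)] at hcx
  simp only [PiLp.inner_apply, RCLike.inner_apply, conj_trivial, Fin.sum_univ_two, weightMatrix,
    Matrix.mulVec, dotProduct, Matrix.of_apply, Matrix.cons_val', Matrix.cons_val_zero,
    Matrix.cons_val_one, Matrix.cons_val_fin_one]
  have hgH := add_pos hg hH
  set a := q x 0
  set b := q x 1
  rw [← sub_nonneg]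
  refine nonneg_of_mul_nonneg_right (a := g + H x) ?_ hgH
  nlinarith [sq_nonneg (g * a + U x * b), sq_nonneg (U x * a + H x * b),
    mul_nonneg (sub_nonneg.2 hcx) (add_nonneg (sq_nonneg a) (sq_nonneg b))]

theorem IsSubcritical.wInner_nonneg (hs : IsSubcritical g L U H) (q : State L) :
    0 ≤ wInner g U H q q := by
  obtain ⟨c, hc, h⟩ := hs.exists_coercive
  exact (by positivity : 0 ≤ c * ‖q‖ ^ 2).trans (h q)

theorem IsSubcritical.wNorm_sq (hs : IsSubcritical g L U H) (q : State L) :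
    wNorm g U H q ^ 2 = wInner g U H q q :=
  Real.sq_sqrt (hs.wInner_nonneg q)

theorem IsSubcritical.invWeight_pos (hs : IsSubcritical g L U H) {q : State L}
    (hq : matForm (invWeightMatrix g U H) hs.continuousOn_invWeightMatrix q q ≤ 0) : q = 0 := by
  have hpos : ∀ x ∈ Icc 0 L, ∀ a b : ℝ, (a ≠ 0 ∨ b ≠ 0) →
      0 < (H x * a ^ 2 - 2 * U x * a * b + g * b ^ 2) / (g * H x - U x ^ 2) := by
    intro x hx a b hab
    have hd := hs.det_pos x hx
    have hg := hs.g_pos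
    refine div_pos ?_ hd
    refine pos_of_mul_pos_right (a := g) ?_ hg.le
    rcases eq_or_ne a 0 with rfl | ha
    · have hb : b ≠ 0 := by simpa using hab
      have := mul_pos (mul_pos hg hg) (pow_pos (abs_pos.2 hb) 2)
      rw [sq_abs] at this
      nlinarith
    -- Completing the square: g(Ha² - 2Uab + gb²) = (gb - Ua)² + (gH - U²)a².
    · have := mul_pos hd (pow_pos (abs_pos.2 ha) 2)
      rw [sq_abs] at this
      nlinarith [sq_nonneg (g * b - U x * a)]
  rw [matForm_eq] at hq
  have hform : ∀ x, (q x).ofLp ⬝ᵥ (invWeightMatrix g U H x *ᵥ (q x).ofLp) =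
      (H x * q x 0 ^ 2 - 2 * U x * q x 0 * q x 1 + g * q x 1 ^ 2) / (g * H x - U x ^ 2) := by
    intro x
    simp only [invWeightMatrix, Matrix.mulVec, dotProduct, Fin.sum_univ_two, Matrix.of_apply,
      Matrix.cons_val', Matrix.cons_val_zero, Matrix.cons_val_one, Matrix.cons_val_fin_one]
    ring
  have hnn : 0 ≤ᵐ[volume.restrict (Icc 0 L)]
      fun x => (q x).ofLp ⬝ᵥ (invWeightMatrix g U H x *ᵥ (q x).ofLp) := by
    filter_upwards [ae_mem_Icc L] with x hx
    rw [hform]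
    by_cases h : q x 0 ≠ 0 ∨ q x 1 ≠ 0
    · exact (hpos x hx _ _ h).le
    · push Not at h
      simp [h]
  have h0 := (integral_eq_zero_iff_of_nonneg_ae hnn
    (integrable_matForm hs.continuousOn_invWeightMatrix q q)).1
      (le_antisymm hq (integral_nonneg_of_ae hnn))
  apply state_ext
  filter_upwards [h0, ae_mem_Icc L, Lp.coeFn_zero (EuclideanSpace ℝ (Fin 2)) 2
    (volume.restrict (Icc 0 L))] with x hx hxm hz i
  rw [hform] at hx
  have h : ¬ (q x 0 ≠ 0 ∨ q x 1 ≠ 0) := fun h => (hpos x hxm _ _ h).ne' hx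
  push Not at h
  rw [hz]
  fin_cases i
  · simpa using h.1
  · simpa using h.2

end

end

/-! ### The domain of the spatial operator. -/

section

/-- By Lebesgue differentiation: at almost every interior point the integrand is the derivative of
its primitive. -/
theorem ae_eq_zero_of_primitive_eq_zero {E : Type*} [NormedAddCommGroup E] [NormedSpace ℝ E]
    [CompleteSpace E] {u : ℝ → E} {L : ℝ} (hL : 0 ≤ L) (hu : IntervalIntegrable u volume 0 L)
    (h : ∀ x ∈ Icc 0 L, ∫ y in (0 : ℝ)..x, u y = 0) :
    ∀ᵐ x ∂(volume.restrict (Icc 0 L)), u x = 0 := by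
  rw [ae_restrict_iff' measurableSet_Icc]
  have h0 : ∀ᵐ x : ℝ, x ≠ 0 := by simp [ae_iff]
  have h1 : ∀ᵐ x : ℝ, x ≠ L := by simp [ae_iff]
  filter_upwards [hu.ae_hasDerivAt_integral, h0, h1] with x hx hx0 hxL hxm
  have hd := hx (by rwa [uIcc_of_le hL]) 0 (by simp)
  have hIoo : Ioo 0 L ∈ nhds x :=
    Ioo_mem_nhds (lt_of_le_of_ne hxm.1 (Ne.symm hx0)) (lt_of_le_of_ne hxm.2 hxL)
  have hz : HasDerivAt (fun x => ∫ y in (0 : ℝ)..x, u y) 0 x := by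
    refine (hasDerivAt_const x (0 : E)).congr_of_eventuallyEq ?_
    filter_upwards [hIoo] with z hz
    exact h z (Ioo_subset_Icc_self hz)
  exact hd.unique hz

/-- `M q` has the weak derivative `v` and the boundary values `a` at `0` and `b` at `L`. -/
structure HasFlux (g : ℝ) (U H : ℝ → ℝ) {L : ℝ} (q v : State L) (a b : Fin 2 → ℝ) : Prop where
  flux_eq : ∀ i, ∀ᵐ x ∂(volume.restrict (Icc (0 : ℝ) L)),
    flux g U H q x i = a i + ∫ y in (0 : ℝ)..x, v y i
  trace_eq : ∀ i, b i = a i + ∫ y in (0 : ℝ)..L, v y i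

variable {g L : ℝ} {U H : ℝ → ℝ}

theorem flux_add (p q : State L) : ∀ᵐ x ∂(volume.restrict (Icc (0 : ℝ) L)),
    ∀ i, flux g U H (p + q) x i = flux g U H p x i + flux g U H q x i := by
  filter_upwards [Lp.coeFn_add p q] with x hx i
  rw [flux, hx, Pi.add_apply, WithLp.ofLp_add, Matrix.mulVec_add]
  rfl

theorem flux_smul (c : ℝ) (q : State L) : ∀ᵐ x ∂(volume.restrict (Icc (0 : ℝ) L)),
    ∀ i, flux g U H (c • q) x i = c * flux g U H q x i := by
  filter_upwards [Lp.coeFn_smul c q] with x hx i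
  rw [flux, hx, Pi.smul_apply, WithLp.ofLp_smul, Matrix.mulVec_smul]
  rfl

theorem HasFlux.add (hL : 0 ≤ L) {q q' v v' : State L} {a a' b b' : Fin 2 → ℝ}
    (h : HasFlux g U H q v a b) (h' : HasFlux g U H q' v' a' b') :
    HasFlux g U H (q + q') (v + v') (a + a') (b + b') where
  flux_eq i := by
    filter_upwards [h.flux_eq i, h'.flux_eq i, flux_add q q', ae_mem_Icc L] with x h1 h2 h3 hx
    rw [h3, h1, h2, primitive_add v v' i hx, Pi.add_apply]
    ring
  trace_eq i := by
    rw [primitive_add v v' i (right_mem_Icc.2 hL), Pi.add_apply, Pi.add_apply, h.trace_eq,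
      h'.trace_eq]
    ring

theorem HasFlux.smul (hL : 0 ≤ L) (c : ℝ) {q v : State L} {a b : Fin 2 → ℝ}
    (h : HasFlux g U H q v a b) : HasFlux g U H (c • q) (c • v) (c • a) (c • b) where
  flux_eq i := by
    filter_upwards [h.flux_eq i, flux_smul c q, ae_mem_Icc L] with x h1 h3 hx
    rw [h3, h1, primitive_smul c v i hx, Pi.smul_apply, smul_eq_mul]
    ring
  trace_eq i := by
    rw [primitive_smul c v i (right_mem_Icc.2 hL), Pi.smul_apply, Pi.smul_apply, h.trace_eq,
      smul_eq_mul, smul_eq_mul]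
    ring

theorem HasFlux.zero (hL : 0 ≤ L) : HasFlux g U H (0 : State L) 0 0 0 := by
  have h0 := Lp.coeFn_zero (EuclideanSpace ℝ (Fin 2)) 2 (volume.restrict (Icc (0 : ℝ) L))
  have h0' : ∀ i, ∀ᵐ y ∂(volume.restrict (Icc (0 : ℝ) L)),
      (0 : State L) y i = (fun _ => (0 : ℝ)) y := by
    intro i
    filter_upwards [h0] with y hy
    rw [hy]
    rfl
  constructor
  · intro i
    filter_upwards [h0, ae_mem_Icc L] with x hx hxm
    rw [flux, hx, intervalIntegral_congr_Icc hxm (h0' i)]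
    simp
  · intro i
    rw [intervalIntegral_congr_Icc (right_mem_Icc.2 hL) (h0' i)]
    simp

theorem HasFlux.weak (hL : 0 ≤ L) {q v : State L} {a b : Fin 2 → ℝ} (h : HasFlux g U H q v a b)
    {φ : ℝ → ℝ} (hφ : ContDiff ℝ ∞ φ) (i : Fin 2) :
    (∫ x in Icc (0 : ℝ) L, flux g U H q x i * deriv φ x) + a i * φ 0 - b i * φ L =
      -∫ x in Icc (0 : ℝ) L, v x i * φ x := by
  have key := integral_primitive_mul_deriv (a i)
    (intervalIntegrable_apply v i (right_mem_Icc.2 hL)) hφ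
  have e : ∫ x in Icc (0 : ℝ) L, flux g U H q x i * deriv φ x =
      ∫ x in Icc (0 : ℝ) L, (a i + ∫ y in (0 : ℝ)..x, v y i) * deriv φ x := by
    refine integral_congr_ae ?_
    filter_upwards [h.flux_eq i] with x hx
    rw [hx]
  rw [e, integral_Icc_eq hL, integral_Icc_eq hL, h.trace_eq]
  linarith

/-- Since W q is the flux with its components exchanged, the integrand vᵀWq is F₁'F₂ + F₂'F₁ with F'
= v. This is where the choice of W produces the boundary term F₁F₂. -/
theorem HasFlux.wInner_eq (hL : 0 ≤ L) {q v : State L} {a b : Fin 2 → ℝ}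
    (h : HasFlux g U H q v a b) : wInner g U H v q = b 0 * b 1 - a 0 * a 1 := by
  have hm := right_mem_Icc.2 hL
  have key := integral_mul_primitive_add_primitive_mul (a 0) (a 1)
    (intervalIntegrable_apply v 0 hm) (intervalIntegrable_apply v 1 hm)
  rw [h.trace_eq 0, h.trace_eq 1, ← key, ← integral_Icc_eq hL, wInner]
  refine integral_congr_ae ?_
  filter_upwards [h.flux_eq 0, h.flux_eq 1] with x h0 h1
  rw [← h0, ← h1, flux_zero, flux_one]
  simp only [weightMatrix, Matrix.mulVec, dotProduct, Fin.sum_univ_two, Matrix.of_apply,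
    Matrix.cons_val', Matrix.cons_val_zero, Matrix.cons_val_one, Matrix.cons_val_fin_one]
  ring

/-- M is invertible for subcritical flow, so the flux a + ∫v can be prescribed freely and w
recovered from it. -/
theorem IsSubcritical.exists_hasFlux (hs : IsSubcritical g L U H) (v : State L) (a : Fin 2 → ℝ) :
    ∃ w : State L, HasFlux g U H w v a (fun i => a i + ∫ y in (0 : ℝ)..L, v y i) := by
  have hF : ∀ i, MemLp (fun x => (fun i => a i + ∫ y in (0 : ℝ)..x, v y i : Fin 2 → ℝ) i) 2
      (volume.restrict (Icc (0 : ℝ) L)) := fun i =>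
    memLp_of_continuousOn (continuousOn_const.add (continuousOn_primitive_apply hs.L_pos.le v i))
  refine ⟨matOp (invFluxMatrix g U H) hs.continuousOn_invFluxMatrix (toState _ hF),
    fun i => ?_, fun i => rfl⟩
  filter_upwards [matOp_apply hs.continuousOn_invFluxMatrix (toState _ hF), toState_apply hF,
    ae_mem_Icc L] with x h1 h2 hx
  have hd := (hs.det_pos x hx).ne'
  rw [← h2 i]
  have e0 := congrFun h1 0
  have e1 := congrFun h1 1
  simp only [invFluxMatrix, Matrix.mulVec, dotProduct, Fin.sum_univ_two, Matrix.of_apply,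
    Matrix.cons_val', Matrix.cons_val_zero, Matrix.cons_val_one, Matrix.cons_val_fin_one] at e0 e1
  fin_cases i
  · simp only [Fin.zero_eta, Fin.isValue, flux_zero, e0, e1]
    field_simp
    ring
  · simp only [Fin.mk_one, Fin.isValue, flux_one, e0, e1]
    field_simp
    ring

/-! ### The multiplier identity for the flux traces. -/

/-- A weighted energy identity for a primitive. -/
theorem integral_weight_sq_primitive {v c c' : ℝ → ℝ} (hL : 0 ≤ L) (a : ℝ)
    (hv : IntegrableOn v (Icc 0 L)) (hc : ContinuousOn c (Icc 0 L))
    (hcd : ∀ x ∈ Ioo 0 L, HasDerivAt c (c' x) x) (hc' : ContinuousOn c' (Icc 0 L)) :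
    ∫ x in Icc 0 L, (2 * c x * v x * (a + ∫ y in (0 : ℝ)..x, v y) +
        c' x * (a + ∫ y in (0 : ℝ)..x, v y) ^ 2) =
      c L * (a + ∫ y in (0 : ℝ)..L, v y) ^ 2 - c 0 * a ^ 2 := by
  have hm := right_mem_Icc.2 hL
  have hvi : ∀ x ∈ Icc 0 L, IntervalIntegrable v volume 0 x := fun x hx =>
    intervalIntegrable_of_Icc hx hv
  have hV : ContinuousOn (fun x => ∫ y in (0 : ℝ)..x, v y) (Icc 0 L) := by
    have := ((hvi L hm).absolutelyContinuousOnInterval_intervalIntegral (c := 0)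
      (by simp)).continuousOn
    rwa [uIcc_of_le hL] at this
  have hc'i : IntervalIntegrable c' volume 0 L :=
    intervalIntegrable_of_Icc hm hc'.integrableOn_Icc
  have hci : ∀ x ∈ Icc 0 L, c x = c 0 + ∫ y in (0 : ℝ)..x, c' y := by
    intro x hx
    rw [intervalIntegral.integral_eq_sub_of_hasDerivAt_of_le hx.1
      (hc.mono (Icc_subset_Icc_right hx.2)) (fun y hy => hcd y ⟨hy.1, hy.2.trans_le hx.2⟩)
      (intervalIntegrable_of_Icc hx hc'.integrableOn_Icc)]
    ring
  have hw : IntervalIntegrable (fun x => 2 * v x * (a + ∫ y in (0 : ℝ)..x, v y)) volume 0 L := by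
    refine ((hvi L hm).const_mul 2).mul_continuousOn ?_
    rw [uIcc_of_le hL]
    exact continuousOn_const.add hV
  have hsq : ∀ x ∈ Icc 0 L, (a + ∫ y in (0 : ℝ)..x, v y) ^ 2 =
      a ^ 2 + ∫ y in (0 : ℝ)..x, 2 * v y * (a + ∫ z in (0 : ℝ)..y, v z) := by
    intro x hx
    have := integral_mul_primitive_add_primitive_mul a a (hvi x hx) (hvi x hx)
    have e : ∫ y in (0 : ℝ)..x, 2 * v y * (a + ∫ z in (0 : ℝ)..y, v z) =
        ∫ y in (0 : ℝ)..x, (v y * (a + ∫ z in (0 : ℝ)..y, v z) +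
          (a + ∫ z in (0 : ℝ)..y, v z) * v y) :=
      intervalIntegral.integral_congr fun y _ => by ring
    rw [e, this]
    ring
  have key := integral_mul_primitive_add_primitive_mul (c 0) (a ^ 2) hc'i hw
  rw [← hci L hm, ← hsq L hm] at key
  rw [← key, ← integral_Icc_eq hL]
  refine setIntegral_congr_fun measurableSet_Icc fun x hx => ?_
  rw [← hsq x hx, ← hci x hx]
  ring

/-- The matrix of the multiplier form that controls the traces of the flux. -/
def traceMultiplier (g L : ℝ) (U H : ℝ → ℝ) (x : ℝ) : Matrix (Fin 2) (Fin 2) ℝ :=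
  !![(2 * x / L - 1) * g * U x, (2 * x / L - 1) * g * H x;
    (2 * x / L - 1) * g * H x, (2 * x / L - 1) * H x * U x]

/-- The derivative of the second coefficient of the multiplier. -/
def multiplierDeriv (L : ℝ) (H : ℝ → ℝ) (x : ℝ) : ℝ :=
  2 / L * H x + (2 * x / L - 1) * derivWithin H (Icc 0 L) x

/-- The matrix of the remainder in the multiplier identity. -/
def traceRemainder (g L : ℝ) (U H : ℝ → ℝ) (x : ℝ) : Matrix (Fin 2) (Fin 2) ℝ :=
  !![2 / L * g * U x ^ 2 + multiplierDeriv L H x * g ^ 2,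
      2 / L * g * U x * H x + multiplierDeriv L H x * g * U x;
    2 / L * g * U x * H x + multiplierDeriv L H x * g * U x,
      2 / L * g * H x ^ 2 + multiplierDeriv L H x * U x ^ 2]

theorem IsSubcritical.continuousOn_multiplierDeriv (hs : IsSubcritical g L U H) :
    ContinuousOn (multiplierDeriv L H) (Icc 0 L) := by
  have h1 := hs.continuousOn_H
  have h2 := hs.contDiffOn_H.continuousOn_derivWithin (uniqueDiffOn_Icc hs.L_pos) le_rfl
  unfold multiplierDeriv
  fun_prop

theorem IsSubcritical.continuousOn_traceMultiplier (hs : IsSubcritical g L U H) :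
    ContinuousOn (traceMultiplier g L U H) (Icc 0 L) := by
  have h1 := hs.continuousOn_H
  have h2 := hs.continuousOn_U
  apply continuousOn_matrix_two <;> fun_prop

theorem IsSubcritical.continuousOn_traceRemainder (hs : IsSubcritical g L U H) :
    ContinuousOn (traceRemainder g L U H) (Icc 0 L) := by
  have h1 := hs.continuousOn_H
  have h2 := hs.continuousOn_U
  have h3 := hs.continuousOn_multiplierDeriv
  apply continuousOn_matrix_two <;> fun_prop

/-- Integrate the derivative of m(gF₁² + HF₂²) with m = 2x/L - 1. As m is -1 at x = 0 and 1 at x =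
L, both ends contribute with a positive sign. The weights g and H are chosen because diag(g, H) M is
symmetric: when v contains -∂q/∂t, the first form then yields an exact time derivative. -/
theorem HasFlux.multiplier_eq (hs : IsSubcritical g L U H) {q v : State L} {a b : Fin 2 → ℝ}
    (h : HasFlux g U H q v a b) :
    2 * matForm (traceMultiplier g L U H) hs.continuousOn_traceMultiplier v q +
        matForm (traceRemainder g L U H) hs.continuousOn_traceRemainder q q =
      g * (a 0 ^ 2 + b 0 ^ 2) + H 0 * a 1 ^ 2 + H L * b 1 ^ 2 := by
  have hLp := hs.L_pos
  have hL := hLp.le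
  have hcH := hs.continuousOn_H
  have k0 := integral_weight_sq_primitive hL (a 0) (integrable_apply v 0)
    (c := fun x => (2 * x / L - 1) * g) (c' := fun _ => 2 / L * g) (by fun_prop)
    (fun x _ => by
      have := ((((hasDerivAt_id x).const_mul 2).div_const L).sub_const 1).mul_const g
      simpa using this) (by fun_prop)
  have k1 := integral_weight_sq_primitive hL (a 1) (integrable_apply v 1)
    (c := fun x => (2 * x / L - 1) * H x) (c' := multiplierDeriv L H) (by fun_prop)
    (fun x hx => by
      have h1 := (((hasDerivAt_id x).const_mul 2).div_const L).sub_const 1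
      have h2 : HasDerivAt H (derivWithin H (Icc 0 L) x) x :=
        ((hs.contDiffOn_H.differentiableOn (by simp)) x
          (Ioo_subset_Icc_self hx)).hasDerivWithinAt.hasDerivAt (Icc_mem_nhds hx.1 hx.2)
      have := h1.fun_mul h2
      simpa [multiplierDeriv] using this) hs.continuousOn_multiplierDeriv
  rw [← h.trace_eq 0] at k0
  rw [← h.trace_eq 1] at k1
  have e0 : 2 * L / L - 1 = 1 := by field_simp; norm_num
  have e1 : 2 * 0 / L - 1 = -1 := by simp
  rw [e0, e1] at k0 k1
  have hI := (integrable_matForm hs.continuousOn_traceMultiplier v q).const_mul 2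
  have hJ := integrable_matForm hs.continuousOn_traceRemainder q q
  have i1 : ∀ (i : Fin 2) (c c' : ℝ → ℝ), ContinuousOn c (Icc 0 L) → ContinuousOn c' (Icc 0 L) →
      Integrable (fun x => 2 * c x * v x i * (a i + ∫ y in (0 : ℝ)..x, v y i) +
        c' x * (a i + ∫ y in (0 : ℝ)..x, v y i) ^ 2) (volume.restrict (Icc 0 L)) := by
    intro i c c' hc hc'
    have hV := continuousOn_primitive_apply hL v i
    refine Integrable.add ?_ (ContinuousOn.integrableOn_Icc (by fun_prop))
    have : IntegrableOn (fun x => v x i * (2 * c x * (a i + ∫ y in (0 : ℝ)..x, v y i)))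
        (Icc 0 L) :=
      IntegrableOn.mul_continuousOn (integrable_apply v i) (by fun_prop) isCompact_Icc
    refine this.congr (.of_forall fun x => by ring)
  have key : 2 * matForm (traceMultiplier g L U H) hs.continuousOn_traceMultiplier v q +
        matForm (traceRemainder g L U H) hs.continuousOn_traceRemainder q q =
      (g * b 0 ^ 2 + g * a 0 ^ 2) + (H L * b 1 ^ 2 + H 0 * a 1 ^ 2) := by
    have k0' : g * b 0 ^ 2 + g * a 0 ^ 2 = 1 * g * b 0 ^ 2 - -1 * g * a 0 ^ 2 := by ring
    have k1' : H L * b 1 ^ 2 + H 0 * a 1 ^ 2 = 1 * H L * b 1 ^ 2 - -1 * H 0 * a 1 ^ 2 := by ring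
    rw [k0', k1', ← k0, ← k1, matForm_eq, matForm_eq, ← integral_const_mul,
      ← integral_add hI hJ, ← integral_add (i1 0 _ _ (by fun_prop) (by fun_prop))
        (i1 1 _ _ (by fun_prop) hs.continuousOn_multiplierDeriv)]
    refine integral_congr_ae ?_
    filter_upwards [h.flux_eq 0, h.flux_eq 1] with x h0 h1
    rw [← h0, ← h1, flux_zero, flux_one]
    simp only [traceMultiplier, traceRemainder, Matrix.mulVec, dotProduct, Fin.sum_univ_two,
      Matrix.of_apply, Matrix.cons_val', Matrix.cons_val_zero, Matrix.cons_val_one,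
      Matrix.cons_val_fin_one]
    ring
  rw [key]
  ring

end

/-! ### Boundary conditions and the adjoint of the spatial operator. -/

section

variable {g L : ℝ} {U H : ℝ → ℝ}

/-- The boundary conditions for the traces `a` at `0` and `b` at `L`. -/
def BoundaryCond (α₁ α₂ β₁ β₂ : ℝ) (a b : Fin 2 → ℝ) : Prop :=
  α₁ * a 0 + α₂ * a 1 = 0 ∧ β₁ * b 0 - β₂ * b 1 = 0

/-- Multiplying the condition by x + y gives (α₁ + α₂)xy = -(α₁x² + α₂y²). -/
theorem mul_nonpos_of_boundaryCond {α₁ α₂ : ℝ} (h₁ : 0 ≤ α₁) (h₂ : 0 ≤ α₂)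
    (hα : (α₁, α₂) ≠ (0, 0)) {x y : ℝ} (h : α₁ * x + α₂ * y = 0) : x * y ≤ 0 := by
  have hpos : 0 < α₁ + α₂ := by
    refine lt_of_le_of_ne (by positivity) fun h0 => hα ?_
    have e1 : α₁ = 0 := by linarith
    have e2 : α₂ = 0 := by linarith
    rw [e1, e2]
  by_contra hxy
  push Not at hxy
  have : (α₁ + α₂) * (x * y) = -(α₁ * x ^ 2 + α₂ * y ^ 2) := by linear_combination (x + y) * h
  have := mul_pos hpos hxy
  nlinarith [mul_nonneg h₁ (sq_nonneg x), mul_nonneg h₂ (sq_nonneg y)]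

theorem BoundaryCond.product_nonpos {α₁ α₂ β₁ β₂ : ℝ} (hα₁ : 0 ≤ α₁) (hα₂ : 0 ≤ α₂) (hβ₁ : 0 ≤ β₁)
    (hβ₂ : 0 ≤ β₂) (hα : (α₁, α₂) ≠ (0, 0)) (hβ : (β₁, β₂) ≠ (0, 0)) {a b : Fin 2 → ℝ}
    (h : BoundaryCond α₁ α₂ β₁ β₂ a b) : a 0 * a 1 - b 0 * b 1 ≤ 0 := by
  have h1 := mul_nonpos_of_boundaryCond hα₁ hα₂ hα h.1
  have h2 := mul_nonpos_of_boundaryCond (x := b 0) (y := -b 1) hβ₁ hβ₂ hβ (by linarith [h.2])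
  nlinarith

theorem inner_toState {F : ℝ → Fin 2 → ℝ}
    (hF : ∀ i, MemLp (fun x => F x i) 2 (volume.restrict (Icc (0 : ℝ) L))) (q : State L) :
    inner ℝ (toState F hF) q = ∫ x in Icc 0 L, F x ⬝ᵥ (q x).ofLp := by
  rw [inner_state]
  refine integral_congr_ae ?_
  filter_upwards [toState_apply hF] with x hx
  rw [show (toState F hF x).ofLp = F x from funext hx]

theorem memLp_const_apply (c : Fin 2 → ℝ) (i : Fin 2) :
    MemLp (fun x => (fun _ : ℝ => c) x i) 2 (volume.restrict (Icc (0 : ℝ) L)) :=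
  memLp_of_continuousOn continuousOn_const

theorem inner_const_toState (hL : 0 ≤ L) (c : Fin 2 → ℝ) (q : State L) :
    inner ℝ (toState (fun _ => c) (memLp_const_apply c)) q =
      c 0 * (∫ x in (0 : ℝ)..L, q x 0) + c 1 * ∫ x in (0 : ℝ)..L, q x 1 := by
  rw [inner_toState]
  simp only [dotProduct, Fin.sum_univ_two]
  rw [integral_add ((integrable_apply q 0).const_mul _) ((integrable_apply q 1).const_mul _),
    integral_const_mul, integral_const_mul, integral_Icc_eq hL, integral_Icc_eq hL]

theorem memLp_primitive (hL : 0 ≤ L) (q : State L) (i : Fin 2) :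
    MemLp (fun x => (fun x i => ∫ y in (0 : ℝ)..x, q y i : ℝ → Fin 2 → ℝ) x i) 2
      (volume.restrict (Icc (0 : ℝ) L)) :=
  memLp_of_continuousOn (continuousOn_primitive_apply hL q i)

/-- Green's formula for the pairing of a state in the domain with an arbitrary one. -/
theorem HasFlux.inner_eq (hs : IsSubcritical g L U H) {w v : State L} {a b : Fin 2 → ℝ}
    (h : HasFlux g U H w v a b) (P : State L) :
    inner ℝ P w =
      (∫ x in (0 : ℝ)..L, matOp (invFluxMatrixT g U H) hs.continuousOn_invFluxMatrixT P x 0) * b 0 +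
      (∫ x in (0 : ℝ)..L, matOp (invFluxMatrixT g U H) hs.continuousOn_invFluxMatrixT P x 1) * b 1 -
      inner ℝ (toState _ (memLp_primitive hs.L_pos.le
        (matOp (invFluxMatrixT g U H) hs.continuousOn_invFluxMatrixT P))) v := by
  have hL := hs.L_pos.le
  have hm := hs.L_mem
  -- With R = M⁻ᵀP the pairing of P with w = M⁻¹F becomes that of R with F. Integration by parts
  -- then moves the derivative from the primitive of R to F.
  set R := matOp (invFluxMatrixT g U H) hs.continuousOn_invFluxMatrixT P with hR
  have key : ∀ i, ∫ x in Icc 0 L, (R x i * (a i + ∫ y in (0 : ℝ)..x, v y i) +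
      (∫ y in (0 : ℝ)..x, R y i) * v x i) = (∫ x in (0 : ℝ)..L, R x i) * b i := by
    intro i
    have := integral_mul_primitive_add_primitive_mul 0 (a i) (intervalIntegrable_apply R i hm)
      (intervalIntegrable_apply v i hm)
    simp only [zero_add, zero_mul, sub_zero] at this
    rw [integral_Icc_eq hL, this, h.trace_eq]
  have hint : ∀ i, Integrable (fun x => R x i * (a i + ∫ y in (0 : ℝ)..x, v y i) +
      (∫ y in (0 : ℝ)..x, R y i) * v x i) (volume.restrict (Icc 0 L)) := by
    intro i
    have hV := continuousOn_primitive_apply hL v i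
    have hK := continuousOn_primitive_apply hL R i
    exact (IntegrableOn.mul_continuousOn (integrable_apply R i) (by fun_prop) isCompact_Icc).add
      (IntegrableOn.continuousOn_mul hK (integrable_apply v i) isCompact_Icc)
  have hK := L2.integrable_inner (𝕜 := ℝ) (toState _ (memLp_primitive hL R)) v
  have hsum : Integrable (fun x => (R x 0 * (a 0 + ∫ y in (0 : ℝ)..x, v y 0) +
      (∫ y in (0 : ℝ)..x, R y 0) * v x 0) + (R x 1 * (a 1 + ∫ y in (0 : ℝ)..x, v y 1) +
      (∫ y in (0 : ℝ)..x, R y 1) * v x 1)) (volume.restrict (Icc 0 L)) := (hint 0).add (hint 1)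
  rw [← key 0, ← key 1, ← integral_add (hint 0) (hint 1), L2.inner_def, L2.inner_def,
    ← integral_sub hsum hK]
  refine integral_congr_ae ?_
  filter_upwards [h.flux_eq 0, h.flux_eq 1, toState_apply (memLp_primitive hL R),
    matOp_apply hs.continuousOn_invFluxMatrixT P, ae_mem_Icc L] with x h0 h1 h2 h3 hx
  have hd := (hs.det_pos x hx).ne'
  have e0 := congrFun h3 0
  have e1 := congrFun h3 1
  rw [← hR] at e0 e1
  simp only [invFluxMatrixT, Matrix.mulVec, dotProduct, Fin.sum_univ_two, Matrix.of_apply,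
    Matrix.cons_val', Matrix.cons_val_zero, Matrix.cons_val_one, Matrix.cons_val_fin_one] at e0 e1
  simp only [PiLp.inner_apply, RCLike.inner_apply, conj_trivial, Fin.sum_univ_two, h2]
  rw [← h0, ← h1, flux_zero, flux_one, e0, e1]
  field_simp
  ring

variable {α₁ α₂ β₁ β₂ : ℝ}

/-- The pairs `(P, Q)` with `P = A* Q`, where `A*` is the adjoint of the spatial operator. -/
theorem adjoint_eq_primitive (hs : IsSubcritical g L U H) {P Q : State L}
    (h : ∀ (w v : State L) (a b : Fin 2 → ℝ), HasFlux g U H w v a b →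
      BoundaryCond α₁ α₂ β₁ β₂ a b → inner ℝ P w = -inner ℝ Q v) :
    ∃ c d : Fin 2 → ℝ,
      (∀ᵐ x ∂(volume.restrict (Icc (0 : ℝ) L)), ∀ i, Q x i = c i + ∫ y in (0 : ℝ)..x,
        matOp (invFluxMatrixT g U H) hs.continuousOn_invFluxMatrixT P y i) ∧
      (∀ i, d i = c i + ∫ y in (0 : ℝ)..L,
        matOp (invFluxMatrixT g U H) hs.continuousOn_invFluxMatrixT P y i) ∧
      α₂ * c 0 - α₁ * c 1 = 0 ∧ β₂ * d 0 + β₁ * d 1 = 0 := by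
  have hL := hs.L_pos.le
  set R := matOp (invFluxMatrixT g U H) hs.continuousOn_invFluxMatrixT P with hR
  set Kst := toState _ (memLp_primitive hL R) with hKst
  set D := Q - Kst with hD
  have hDv : ∀ (v : State L) (a : Fin 2 → ℝ),
      BoundaryCond α₁ α₂ β₁ β₂ a (fun i => a i + ∫ y in (0 : ℝ)..L, v y i) →
      inner ℝ D v = -((∫ x in (0 : ℝ)..L, R x 0) * (a 0 + ∫ y in (0 : ℝ)..L, v y 0) +
        (∫ x in (0 : ℝ)..L, R x 1) * (a 1 + ∫ y in (0 : ℝ)..L, v y 1)) := by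
    intro v a hbc
    obtain ⟨w, hw⟩ := hs.exists_hasFlux v a
    have h1 := h w v _ _ hw hbc
    have h2 := hw.inner_eq hs P
    rw [← hR, ← hKst] at h2
    rw [hD, inner_sub_left]
    linarith
  -- The du Bois-Reymond argument: with zero traces at both ends, D is orthogonal to every v of mean
  -- zero. Testing with D minus its mean shows that D is constant.
  set c : Fin 2 → ℝ := fun i => (∫ y in (0 : ℝ)..L, D y i) / L with hc
  set C := toState (fun _ => c) (memLp_const_apply (L := L) c) with hC
  have hCapp : ∀ i, ∫ y in (0 : ℝ)..L, C y i = L * c i := by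
    intro i
    have : ∀ᵐ x ∂(volume.restrict (Icc (0 : ℝ) L)), C x i = (fun _ => c i) x := by
      filter_upwards [toState_apply (memLp_const_apply (L := L) c)] with x hx
      exact hx i
    rw [intervalIntegral_congr_Icc hs.L_mem this]
    simp
  have hz : ∀ i, ∫ y in (0 : ℝ)..L, (D - C) y i = 0 := by
    intro i
    have e : D - C = D + (-1 : ℝ) • C := by rw [neg_one_smul, sub_eq_add_neg]
    rw [e, primitive_add _ _ _ hs.L_mem, primitive_smul _ _ _ hs.L_mem, hCapp, hc]
    have := hs.L_pos.ne'
    field_simp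
    ring
  have hDC : D = C := by
    have h1 := hDv (D - C) 0 (by simp only [BoundaryCond, hz]; simp)
    have h2 := inner_const_toState hL c (D - C)
    rw [hz, hz] at h1 h2
    simp only [Pi.zero_apply, add_zero, mul_zero, neg_zero] at h1 h2
    rw [← hC] at h2
    have h3 : inner ℝ (D - C) (D - C) = 0 := by rw [inner_sub_left, h1, h2, sub_zero]
    exact sub_eq_zero.1 (inner_self_eq_zero.1 h3)
  have hab : ∀ a b : Fin 2 → ℝ, BoundaryCond α₁ α₂ β₁ β₂ a b →
      (c 0 + ∫ x in (0 : ℝ)..L, R x 0) * b 0 + (c 1 + ∫ x in (0 : ℝ)..L, R x 1) * b 1 =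
        c 0 * a 0 + c 1 * a 1 := by
    intro a b hbc
    -- Every admissible pair of boundary values is joined by an affine flux, whose derivative is the
    -- constant (b - a)/L.
    set e : Fin 2 → ℝ := fun i => (b i - a i) / L with he
    set E := toState (fun _ => e) (memLp_const_apply (L := L) e) with hE
    have hEi : ∀ i, a i + ∫ y in (0 : ℝ)..L, E y i = b i := by
      intro i
      have : ∀ᵐ x ∂(volume.restrict (Icc (0 : ℝ) L)), E x i = (fun _ => e i) x := by
        filter_upwards [toState_apply (memLp_const_apply (L := L) e)] with x hx
        exact hx i
      rw [intervalIntegral_congr_Icc hs.L_mem this]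
      have := hs.L_pos.ne'
      simp only [he, intervalIntegral.integral_const, sub_zero, smul_eq_mul]
      field_simp
      ring
    have h1 := hDv E a (by simpa only [hEi] using hbc)
    rw [hDC, inner_const_toState hL, hEi, hEi] at h1
    have e0 := hEi 0
    have e1 := hEi 1
    linear_combination h1 - c 0 * e0 - c 1 * e1
  refine ⟨c, fun i => c i + ∫ y in (0 : ℝ)..L, R y i, ?_, fun i => rfl, ?_, ?_⟩
  · have hQ : Q = C + Kst := by rw [← hDC, hD]; abel
    rw [hQ]
    filter_upwards [Lp.coeFn_add C Kst, toState_apply (memLp_primitive hL R),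
      toState_apply (memLp_const_apply (L := L) c)] with x h1 h2 h3 i
    rw [h1, Pi.add_apply, PiLp.add_apply, h2, h3]
  -- The vectors (α₂, -α₁) at 0 and (β₂, β₁) at L solve the boundary conditions. Each is tested with
  -- zero values at the other end, giving one adjoint condition each.
  · have := hab ![α₂, -α₁] 0 (by simp [BoundaryCond]; ring)
    simp at this
    linarith
  · have := hab 0 ![β₂, β₁] (by simp [BoundaryCond]; ring)
    simp at this
    linarith

/-- The adjoint of the spatial operator is dissipative. -/
theorem adjoint_dissipative (hs : IsSubcritical g L U H) (hα₁ : 0 ≤ α₁) (hα₂ : 0 ≤ α₂)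
    (hβ₁ : 0 ≤ β₁) (hβ₂ : 0 ≤ β₂) (hα : (α₁, α₂) ≠ (0, 0)) (hβ : (β₁, β₂) ≠ (0, 0))
    {P Q : State L}
    (h : ∀ (w v : State L) (a b : Fin 2 → ℝ), HasFlux g U H w v a b →
      BoundaryCond α₁ α₂ β₁ β₂ a b → inner ℝ P w = -inner ℝ Q v) :
    matForm (invWeightMatrix g U H) hs.continuousOn_invWeightMatrix P Q ≤ 0 := by
  obtain ⟨c, d, hQ, hd, hc, hdb⟩ := adjoint_eq_primitive hs h
  set R := matOp (invFluxMatrixT g U H) hs.continuousOn_invFluxMatrixT P with hR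
  have key := integral_mul_primitive_add_primitive_mul (c 0) (c 1)
    (intervalIntegrable_apply R 0 hs.L_mem) (intervalIntegrable_apply R 1 hs.L_mem)
  rw [← hd, ← hd, ← integral_Icc_eq hs.L_pos.le] at key
  -- Here P = MᵀQ' and M W⁻¹ = J, so PᵀW⁻¹Q is the derivative of Q₁Q₂, just as for the original
  -- operator.
  have e : matForm (invWeightMatrix g U H) hs.continuousOn_invWeightMatrix P Q =
      d 0 * d 1 - c 0 * c 1 := by
    rw [← key, matForm_eq]
    refine integral_congr_ae ?_
    filter_upwards [hQ, matOp_apply hs.continuousOn_invFluxMatrixT P, ae_mem_Icc L]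
      with x h2 h3 hx
    have hdet := (hs.det_pos x hx).ne'
    have e0 := congrFun h3 0
    have e1 := congrFun h3 1
    rw [← hR] at e0 e1
    rw [← h2, ← h2]
    simp only [invFluxMatrixT, Matrix.mulVec, dotProduct, Fin.sum_univ_two, Matrix.of_apply,
      Matrix.cons_val', Matrix.cons_val_zero, Matrix.cons_val_one,
      Matrix.cons_val_fin_one] at e0 e1
    simp only [invWeightMatrix, Matrix.mulVec, dotProduct, Fin.sum_univ_two, Matrix.of_apply,
      Matrix.cons_val', Matrix.cons_val_zero, Matrix.cons_val_one, Matrix.cons_val_fin_one]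
    rw [e0, e1]
    field_simp
    ring
  rw [e]
  -- The adjoint conditions have the same shape with coefficients exchanged and the sign at the two
  -- ends reversed: the product is nonnegative at 0 and nonpositive at L.
  have hα' : (α₂, α₁) ≠ (0, 0) := fun h => hα (by simp_all)
  have hβ' : (β₂, β₁) ≠ (0, 0) := fun h => hβ (by simp_all)
  have h1 := mul_nonpos_of_boundaryCond (x := c 0) (y := -c 1) hα₂ hα₁ hα' (by linarith)
  have h2 := mul_nonpos_of_boundaryCond (x := d 0) (y := d 1) hβ₂ hβ₁ hβ' (by linarith)
  linarith

/-- The spatial operator is densely defined. -/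
theorem eq_zero_of_orthogonal_domain (hs : IsSubcritical g L U H) {P : State L}
    (h : ∀ (w v : State L) (a b : Fin 2 → ℝ), HasFlux g U H w v a b →
      BoundaryCond α₁ α₂ β₁ β₂ a b → inner ℝ P w = 0) : P = 0 := by
  -- Orthogonality to the domain is the adjoint relation with Q = 0. The primitive of M⁻ᵀP is then
  -- constant, so P vanishes.
  obtain ⟨c, d, hQ, -, -, -⟩ := adjoint_eq_primitive (α₁ := α₁) (α₂ := α₂) (β₁ := β₁) (β₂ := β₂)
    hs (P := P) (Q := 0)
    (fun w v a b hw hbc => by rw [inner_zero_left, neg_zero, h w v a b hw hbc])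
  have hL := hs.L_pos.le
  set R := matOp (invFluxMatrixT g U H) hs.continuousOn_invFluxMatrixT P with hR
  have hR0 : ∀ i, ∀ᵐ x ∂(volume.restrict (Icc 0 L)), R x i = 0 := by
    intro i
    refine ae_eq_zero_of_primitive_eq_zero hL (intervalIntegrable_apply R i hs.L_mem) ?_
    have hz : (fun x => c i + ∫ y in (0 : ℝ)..x, R y i) =ᵐ[volume.restrict (Icc 0 L)]
        fun _ => 0 := by
      filter_upwards [hQ, Lp.coeFn_zero (EuclideanSpace ℝ (Fin 2)) 2
        (volume.restrict (Icc (0 : ℝ) L))] with x hx h0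
      rw [← hx, h0]
      rfl
    have heq := Measure.eqOn_Icc_of_ae_eq volume hs.L_pos.ne hz
      (continuousOn_const.add (continuousOn_primitive_apply hL R i)) continuousOn_const
    have hci : c i = 0 := by simpa using heq hs.zero_mem
    intro x hx
    simpa [hci] using heq hx
  apply state_ext
  filter_upwards [hR0 0, hR0 1, matOp_apply hs.continuousOn_invFluxMatrixT P, ae_mem_Icc L,
    Lp.coeFn_zero (EuclideanSpace ℝ (Fin 2)) 2 (volume.restrict (Icc (0 : ℝ) L))]
    with x h0 h1 h3 hx hz
  have hdet := (hs.det_pos x hx).ne'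
  have e0 := congrFun h3 0
  have e1 := congrFun h3 1
  rw [← hR] at e0 e1
  simp only [invFluxMatrixT, Matrix.mulVec, dotProduct, Fin.sum_univ_two, Matrix.of_apply,
    Matrix.cons_val', Matrix.cons_val_zero, Matrix.cons_val_one,
    Matrix.cons_val_fin_one] at e0 e1
  rw [h0] at e0
  rw [h1] at e1
  field_simp at e0 e1
  have p0 : (g * H x - U x ^ 2) * P x 0 = 0 := by linear_combination -g * e1 - U x * e0
  have p1 : (g * H x - U x ^ 2) * P x 1 = 0 := by linear_combination -H x * e0 - U x * e1
  intro i
  rw [hz]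
  fin_cases i
  · simpa [hdet] using p0
  · simpa [hdet] using p1

end

/-! ### Regular solutions and a priori estimates. -/

section

variable {g L T : ℝ} {U H : ℝ → ℝ} {α₁ α₂ β₁ β₂ : ℝ}

/-- A solution on `[0,T]` of the problem with forcing `G`, with time derivative `r` and with
continuous flux traces `a` at `0` and `b` at `L`. -/
structure IsRegular (g L : ℝ) (U H : ℝ → ℝ) (α₁ α₂ β₁ β₂ T : ℝ) (G q r : ℝ → State L)
    (a b : ℝ → Fin 2 → ℝ) : Prop where
  continuousOn : ContinuousOn q (Icc 0 T)
  hasDerivAt : ∃ S : Set ℝ, S.Countable ∧ ∀ t ∈ Ioo 0 T \ S, HasDerivAt q (r t) t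
  integrable_deriv : IntegrableOn r (Icc 0 T)
  memLp_forcing : MemLp G 2 (volume.restrict (Icc 0 T))
  continuousOn_left : ContinuousOn a (Icc 0 T)
  continuousOn_right : ContinuousOn b (Icc 0 T)
  hasFlux : ∀ t ∈ Icc 0 T, HasFlux g U H (q t) (G t - r t) (a t) (b t)
  boundary : ∀ t ∈ Icc 0 T, BoundaryCond α₁ α₂ β₁ β₂ (a t) (b t)

theorem BoundaryCond.add {a a' b b' : Fin 2 → ℝ} (h : BoundaryCond α₁ α₂ β₁ β₂ a b)
    (h' : BoundaryCond α₁ α₂ β₁ β₂ a' b') : BoundaryCond α₁ α₂ β₁ β₂ (a + a') (b + b') := by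
  constructor
  · simp only [Pi.add_apply]
    linear_combination h.1 + h'.1
  · simp only [Pi.add_apply]
    linear_combination h.2 + h'.2

theorem BoundaryCond.smul (c : ℝ) {a b : Fin 2 → ℝ} (h : BoundaryCond α₁ α₂ β₁ β₂ a b) :
    BoundaryCond α₁ α₂ β₁ β₂ (c • a) (c • b) := by
  constructor
  · simp only [Pi.smul_apply, smul_eq_mul]
    linear_combination c * h.1
  · simp only [Pi.smul_apply, smul_eq_mul]
    linear_combination c * h.2

theorem IsRegular.add (hL : 0 ≤ L) {G q r G' q' r' : ℝ → State L} {a b a' b' : ℝ → Fin 2 → ℝ}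
    (h : IsRegular g L U H α₁ α₂ β₁ β₂ T G q r a b)
    (h' : IsRegular g L U H α₁ α₂ β₁ β₂ T G' q' r' a' b') :
    IsRegular g L U H α₁ α₂ β₁ β₂ T (G + G') (q + q') (r + r') (a + a') (b + b') where
  continuousOn := h.continuousOn.add h'.continuousOn
  hasDerivAt := by
    obtain ⟨S, hS, hd⟩ := h.hasDerivAt
    obtain ⟨S', hS', hd'⟩ := h'.hasDerivAt
    refine ⟨S ∪ S', hS.union hS', fun t ht => ?_⟩
    exact (hd t ⟨ht.1, fun hh => ht.2 (.inl hh)⟩).add (hd' t ⟨ht.1, fun hh => ht.2 (.inr hh)⟩)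
  integrable_deriv := h.integrable_deriv.add h'.integrable_deriv
  memLp_forcing := h.memLp_forcing.add h'.memLp_forcing
  continuousOn_left := h.continuousOn_left.add h'.continuousOn_left
  continuousOn_right := h.continuousOn_right.add h'.continuousOn_right
  hasFlux t ht := by
    have := (h.hasFlux t ht).add hL (h'.hasFlux t ht)
    rwa [show G t - r t + (G' t - r' t) = (G + G') t - (r + r') t by
      simp only [Pi.add_apply]; abel] at this
  boundary t ht := (h.boundary t ht).add (h'.boundary t ht)

theorem IsRegular.smul (hL : 0 ≤ L) (c : ℝ) {G q r : ℝ → State L} {a b : ℝ → Fin 2 → ℝ}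
    (h : IsRegular g L U H α₁ α₂ β₁ β₂ T G q r a b) :
    IsRegular g L U H α₁ α₂ β₁ β₂ T (c • G) (c • q) (c • r) (c • a) (c • b) where
  continuousOn := h.continuousOn.const_smul c
  hasDerivAt := by
    obtain ⟨S, hS, hd⟩ := h.hasDerivAt
    exact ⟨S, hS, fun t ht => (hd t ht).const_smul c⟩
  integrable_deriv := h.integrable_deriv.smul c
  memLp_forcing := h.memLp_forcing.const_smul c
  continuousOn_left := h.continuousOn_left.const_smul c
  continuousOn_right := h.continuousOn_right.const_smul c
  hasFlux t ht := by
    have := (h.hasFlux t ht).smul hL c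
    rwa [smul_sub] at this
  boundary t ht := (h.boundary t ht).smul c

/-- Solutions of product form `η(t) w`. -/
theorem IsRegular.of_separated (hL : 0 ≤ L) {w v : State L} {a b : Fin 2 → ℝ} {η ρ : ℝ → ℝ}
    (hw : HasFlux g U H w v a b) (hbc : BoundaryCond α₁ α₂ β₁ β₂ a b)
    (hη : Continuous η) (hρ : MemLp ρ 2 (volume.restrict (Icc 0 T)))
    (hd : ∃ S : Set ℝ, S.Countable ∧ ∀ t ∈ Ioo 0 T \ S, HasDerivAt η (ρ t) t) :
    IsRegular g L U H α₁ α₂ β₁ β₂ T (fun t => ρ t • w + η t • v) (fun t => η t • w)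
      (fun t => ρ t • w) (fun t => η t • a) (fun t => η t • b) where
  continuousOn := (hη.smul continuous_const).continuousOn
  hasDerivAt := by
    obtain ⟨S, hS, hd⟩ := hd
    exact ⟨S, hS, fun t ht => (hd t ht).smul_const w⟩
  integrable_deriv := (hρ.integrable (by norm_num)).smul_const w
  memLp_forcing := by
    have h2 : MemLp η 2 (volume.restrict (Icc 0 T)) := memLp_of_continuousOn hη.continuousOn
    have key : ∀ {f : ℝ → ℝ} (z : State L), MemLp f 2 (volume.restrict (Icc 0 T)) →
        MemLp (fun t => f t • z) 2 (volume.restrict (Icc 0 T)) := fun z hf =>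
      ((ContinuousLinearMap.id ℝ ℝ).smulRight z).comp_memLp' hf
    exact (key w hρ).add (key v h2)
  continuousOn_left := (hη.smul continuous_const).continuousOn
  continuousOn_right := (hη.smul continuous_const).continuousOn
  hasFlux t _ := by
    have := hw.smul hL (η t)
    rwa [add_sub_cancel_left]
  boundary t _ := hbc.smul _

section

variable {G q r : ℝ → State L} {a b : ℝ → Fin 2 → ℝ}

theorem integrableOn_inner_clm {E : Type*} [NormedAddCommGroup E] [InnerProductSpace ℝ E]
    {u p : ℝ → E} (B : E →L[ℝ] E)
    (hu : IntegrableOn u (Icc 0 T)) (hp : ContinuousOn p (Icc 0 T)) :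
    IntegrableOn (fun t => inner ℝ (u t) (B (p t))) (Icc 0 T) := by
  have hBp : ContinuousOn (fun t => B (p t)) (Icc 0 T) := B.continuous.comp_continuousOn hp
  obtain ⟨C, hC⟩ := isCompact_Icc.exists_bound_of_continuousOn hBp
  refine Integrable.mono' (hu.norm.mul_const C)
    (hu.aestronglyMeasurable.inner (hBp.aestronglyMeasurable measurableSet_Icc)) ?_
  filter_upwards [ae_restrict_mem measurableSet_Icc] with t ht
  refine (norm_inner_le_norm _ _).trans ?_
  gcongr
  exact hC t ht

theorem integrableOn_matForm {A : ℝ → Matrix (Fin 2) (Fin 2) ℝ} (hA : ContinuousOn A (Icc 0 L))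
    {u p : ℝ → State L} (hu : IntegrableOn u (Icc 0 T)) (hp : ContinuousOn p (Icc 0 T)) :
    IntegrableOn (fun t => matForm A hA (u t) (p t)) (Icc 0 T) :=
  integrableOn_inner_clm (matOp A hA) hu hp

/-- Symmetry of A merges the two halves of the derivative. It serves the energy, with the weight W,
and the trace estimate, with the multiplier. The fundamental theorem of calculus used here tolerates
a countable exceptional set, which admits solutions with kinks in time. -/
theorem IsRegular.form_eq (h : IsRegular g L U H α₁ α₂ β₁ β₂ T G q r a b)
    {A : ℝ → Matrix (Fin 2) (Fin 2) ℝ} (hA : ContinuousOn A (Icc 0 L))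
    (hsym : ∀ x, A x 0 1 = A x 1 0) {t : ℝ} (ht : t ∈ Icc 0 T) :
    matForm A hA (q t) (q t) - matForm A hA (q 0) (q 0) =
      ∫ τ in (0 : ℝ)..t, 2 * matForm A hA (r τ) (q τ) := by
  obtain ⟨S, hS, hd⟩ := h.hasDerivAt
  have hsub : Icc 0 t ⊆ Icc 0 T := Icc_subset_Icc_right ht.2
  have hc := h.continuousOn.mono hsub
  refine (integral_eq_of_hasDerivAt_off_countable_of_le
    (fun τ => matForm A hA (q τ) (q τ)) _ ht.1 hS ?_ ?_ ?_).symm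
  · exact hc.inner ((matOp A hA).continuous.comp_continuousOn hc)
  · intro τ hτ
    have h1 := hd τ ⟨⟨hτ.1.1, hτ.1.2.trans_le ht.2⟩, hτ.2⟩
    have h2 := h1.inner ℝ ((matOp A hA).hasFDerivAt.comp_hasDerivAt τ h1)
    convert! h2 using 1
    rw [two_mul]
    congr 1
    rw [matForm_comm hA hsym, matForm]
  · exact intervalIntegrable_of_Icc ht
      ((integrableOn_inner_clm (matOp A hA) h.integrable_deriv h.continuousOn).const_mul 2)

theorem IsRegular.integrableOn_forcing (h : IsRegular g L U H α₁ α₂ β₁ β₂ T G q r a b) :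
    IntegrableOn G (Icc 0 T) :=
  h.memLp_forcing.integrable (by norm_num)

/-- The energy identity. -/
theorem IsRegular.energy_eq (hs : IsSubcritical g L U H)
    (h : IsRegular g L U H α₁ α₂ β₁ β₂ T G q r a b) {t : ℝ} (ht : t ∈ Icc 0 T) :
    wInner g U H (q t) (q t) - wInner g U H (q 0) (q 0) =
      ∫ τ in (0 : ℝ)..t, 2 * (boundaryTerm a b τ + wInner g U H (G τ) (q τ)) := by
  rw [hs.wInner_eq, hs.wInner_eq, h.form_eq hs.continuousOn_weightMatrix (fun x => rfl) ht]
  refine intervalIntegral.integral_congr fun τ hτ => ?_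
  rw [uIcc_of_le ht.1] at hτ
  have key := (h.hasFlux τ ⟨hτ.1, hτ.2.trans ht.2⟩).wInner_eq hs.L_pos.le
  rw [hs.wInner_eq, matForm, inner_sub_left] at key
  simp only [boundaryTerm, hs.wInner_eq]
  simp only [matForm]
  linarith

/-- The quadratic form of the traces controlled by the multiplier identity. -/
def traceForm (g L : ℝ) (H : ℝ → ℝ) (a b : Fin 2 → ℝ) : ℝ :=
  g * (a 0 ^ 2 + b 0 ^ 2) + H 0 * a 1 ^ 2 + H L * b 1 ^ 2

theorem IsRegular.multiplier_eq (hs : IsSubcritical g L U H) (hT : 0 ≤ T)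
    (h : IsRegular g L U H α₁ α₂ β₁ β₂ T G q r a b) :
    ∫ τ in Icc 0 T, traceForm g L H (a τ) (b τ) =
      (∫ τ in Icc 0 T,
        (2 * matForm (traceMultiplier g L U H) hs.continuousOn_traceMultiplier (G τ) (q τ) +
          matForm (traceRemainder g L U H) hs.continuousOn_traceRemainder (q τ) (q τ))) -
      (matForm (traceMultiplier g L U H) hs.continuousOn_traceMultiplier (q T) (q T) -
        matForm (traceMultiplier g L U H) hs.continuousOn_traceMultiplier (q 0) (q 0)) := by
  have hmT := right_mem_Icc.2 hT
  rw [h.form_eq hs.continuousOn_traceMultiplier (fun x => rfl) hmT, ← integral_Icc_eq hT,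
    ← integral_sub]
  · refine setIntegral_congr_fun measurableSet_Icc fun τ hτ => ?_
    have key := (h.hasFlux τ hτ).multiplier_eq hs
    rw [traceForm, ← key, matForm, inner_sub_left]
    simp only [matForm]
    ring
  · refine Integrable.add ?_ ?_
    · exact (integrableOn_inner_clm _ h.integrableOn_forcing h.continuousOn).const_mul 2
    · exact integrableOn_inner_clm _ h.continuousOn.integrableOn_Icc h.continuousOn
  · exact (integrableOn_inner_clm _ h.integrable_deriv h.continuousOn).const_mul 2

theorem integrable_traceForm {a b : ℝ → Fin 2 → ℝ} (ha : ContinuousOn a (Icc 0 T))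
    (hb : ContinuousOn b (Icc 0 T)) :
    IntegrableOn (fun τ => traceForm g L H (a τ) (b τ)) (Icc 0 T) := by
  have ha' := continuousOn_pi.1 ha
  have hb' := continuousOn_pi.1 hb
  unfold traceForm
  have h1 := ha' 0
  have h2 := ha' 1
  have h3 := hb' 0
  have h4 := hb' 1
  exact ContinuousOn.integrableOn_Icc (by fun_prop)

theorem integral_abs_le_of_bound {f : ℝ → ℝ} {G : ℝ → State L} {C σ : ℝ} (hσ : 0 ≤ C * σ)
    (hG : IntegrableOn G (Icc 0 T)) (hf : ∀ τ ∈ Icc 0 T, |f τ| ≤ C * ‖G τ‖ * σ) {t : ℝ}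
    (ht : t ∈ Icc 0 T) : |∫ τ in (0 : ℝ)..t, f τ| ≤ C * σ * ∫ τ in Icc 0 T, ‖G τ‖ := by
  have h1 := intervalIntegral.norm_integral_le_of_norm_le (f := f)
    (g := fun τ => C * σ * ‖G τ‖) ht.1 (μ := volume)
    (.of_forall fun τ hτ => by
      have := hf τ ⟨hτ.1.le, hτ.2.trans ht.2⟩
      rw [Real.norm_eq_abs]
      linarith) (intervalIntegrable_of_Icc ht (hG.norm.const_mul _))
  rw [Real.norm_eq_abs] at h1
  refine h1.trans ?_
  rw [← integral_Icc_eq ht.1, ← integral_const_mul]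
  refine setIntegral_mono_set (hG.norm.const_mul _) (.of_forall fun τ => ?_)
    (Icc_subset_Icc_right ht.2).eventuallyLE
  positivity

theorem exists_matForm_bound {A : ℝ → Matrix (Fin 2) (Fin 2) ℝ} (hA : ContinuousOn A (Icc 0 L)) :
    ∃ C, 0 ≤ C ∧ ∀ p q : State L, |matForm A hA p q| ≤ C * ‖p‖ * ‖q‖ :=
  ⟨‖matOp A hA‖, norm_nonneg _, abs_matForm_le hA⟩

theorem IsRegular.integrableOn_boundaryTerm (h : IsRegular g L U H α₁ α₂ β₁ β₂ T G q r a b) :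
    IntegrableOn (boundaryTerm a b) (Icc 0 T) := by
  have ha' := continuousOn_pi.1 h.continuousOn_left
  have hb' := continuousOn_pi.1 h.continuousOn_right
  have h1 := ha' 0
  have h2 := ha' 1
  have h3 := hb' 0
  have h4 := hb' 1
  unfold boundaryTerm
  exact ContinuousOn.integrableOn_Icc (by fun_prop)

theorem exists_regular_state_bound (hs : IsSubcritical g L U H) (hα₁ : 0 ≤ α₁) (hα₂ : 0 ≤ α₂)
    (hβ₁ : 0 ≤ β₁) (hβ₂ : 0 ≤ β₂) (hα : (α₁, α₂) ≠ (0, 0)) (hβ : (β₁, β₂) ≠ (0, 0)) (hT : 0 ≤ T) :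
    ∃ C, 0 ≤ C ∧ ∀ (G q r : ℝ → State L) (a b : ℝ → Fin 2 → ℝ),
      IsRegular g L U H α₁ α₂ β₁ β₂ T G q r a b →
      ∀ t ∈ Icc 0 T, ‖q t‖ ≤ C * (‖q 0‖ + ∫ τ in Icc 0 T, ‖G τ‖) := by
  obtain ⟨c, hc, hcoer⟩ := hs.exists_coercive
  obtain ⟨C, hC0, hC⟩ := exists_matForm_bound hs.continuousOn_weightMatrix
  refine ⟨2 * C / c, by positivity, ?_⟩
  intro G q r a b h
  obtain ⟨N, hN⟩ : ∃ N, N = ∫ τ in Icc 0 T, ‖G τ‖ := ⟨_, rfl⟩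
  have hN0 : 0 ≤ N := hN ▸ integral_nonneg fun _ => norm_nonneg _
  have h0 : (0 : ℝ) ∈ Icc 0 T := left_mem_Icc.2 hT
  -- Evaluate the energy identity at the time where ‖q‖ attains its maximum σ and drop the
  -- nonpositive boundary term. Every remaining term on the right carries one factor σ, which
  -- cancels against σ² on the left.
  obtain ⟨t₀, ht₀, hmax⟩ := isCompact_Icc.exists_isMaxOn ⟨0, h0⟩ h.continuousOn.norm
  obtain ⟨σ, hσ⟩ : ∃ σ, σ = ‖q t₀‖ := ⟨_, rfl⟩
  have hσ0 : 0 ≤ σ := hσ ▸ norm_nonneg _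
  have hle : ∀ t ∈ Icc 0 T, ‖q t‖ ≤ σ := fun t ht => hσ ▸ hmax ht
  have e := h.energy_eq hs ht₀
  have hGi : IntegrableOn (fun τ => wInner g U H (G τ) (q τ)) (Icc 0 T) := by
    simp only [hs.wInner_eq]
    exact integrableOn_inner_clm _ h.integrableOn_forcing h.continuousOn
  have i1 : ∫ τ in (0 : ℝ)..t₀, 2 * (boundaryTerm a b τ + wInner g U H (G τ) (q τ)) ≤
      ∫ τ in (0 : ℝ)..t₀, 2 * wInner g U H (G τ) (q τ) := by
    refine intervalIntegral.integral_mono_on ht₀.1 ?_ ?_ ?_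
    · exact intervalIntegrable_of_Icc ht₀ ((h.integrableOn_boundaryTerm.add hGi).const_mul 2)
    · exact intervalIntegrable_of_Icc ht₀ (hGi.const_mul 2)
    · intro τ hτ
      have := (h.boundary τ ⟨hτ.1, hτ.2.trans ht₀.2⟩).product_nonpos hα₁ hα₂ hβ₁ hβ₂ hα hβ
      simp only [boundaryTerm]
      linarith
  have i2 : |∫ τ in (0 : ℝ)..t₀, 2 * wInner g U H (G τ) (q τ)| ≤ 2 * C * σ * N := by
    rw [hN]
    refine integral_abs_le_of_bound (by positivity) h.integrableOn_forcing ?_ ht₀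
    intro τ hτ
    rw [abs_mul, abs_two, hs.wInner_eq]
    have h1 := hC (G τ) (q τ)
    have h2 : C * ‖G τ‖ * ‖q τ‖ ≤ C * ‖G τ‖ * σ :=
      mul_le_mul_of_nonneg_left (hle τ hτ) (by positivity)
    linarith
  have h1 := hcoer (q t₀)
  have h2 := (le_abs_self _).trans (hC (q 0) (q 0))
  rw [← hs.wInner_eq] at h2
  rw [← hσ] at h1
  have h3 := hle 0 h0
  have h4 : C * ‖q 0‖ * ‖q 0‖ ≤ C * ‖q 0‖ * σ := mul_le_mul_of_nonneg_left h3 (by positivity)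
  have h5 := (le_abs_self _).trans i2
  have h6 : c * σ ^ 2 ≤ 2 * C * (‖q 0‖ + N) * σ := by
    have : 0 ≤ C * ‖q 0‖ * σ := by positivity
    linarith
  intro t ht
  refine (hle t ht).trans ?_
  rw [← hN]
  rcases hσ0.eq_or_lt with hz | hp
  · rw [← hz]; positivity
  · have : c * σ ≤ 2 * C * (‖q 0‖ + N) := by
      refine le_of_mul_le_mul_right ?_ hp
      linarith
    rw [div_mul_eq_mul_div, le_div_iff₀ hc]
    linarith

/-- The trace form has coefficients g, H(0) and H(L), all positive. In the time-integrated
multiplier identity it is balanced by terms containing only the state and the forcing. -/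
theorem exists_regular_trace_bound (hs : IsSubcritical g L U H) (hT : 0 ≤ T) :
    ∃ C, 0 ≤ C ∧ ∀ (G q r : ℝ → State L) (a b : ℝ → Fin 2 → ℝ),
      IsRegular g L U H α₁ α₂ β₁ β₂ T G q r a b →
      ∀ σ, (∀ t ∈ Icc 0 T, ‖q t‖ ≤ σ) →
      ∫ τ in Icc 0 T, (a τ 0 ^ 2 + a τ 1 ^ 2 + b τ 0 ^ 2 + b τ 1 ^ 2) ≤
        C * (σ * (σ + ∫ τ in Icc 0 T, ‖G τ‖)) := by
  obtain ⟨Cm, hCm0, hCm⟩ := exists_matForm_bound hs.continuousOn_traceMultiplier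
  obtain ⟨Cr, hCr0, hCr⟩ := exists_matForm_bound hs.continuousOn_traceRemainder
  obtain ⟨κ, hκ⟩ : ∃ κ, κ = min g (min (H 0) (H L)) := ⟨_, rfl⟩
  have hκ0 : 0 < κ := hκ ▸ lt_min hs.g_pos (lt_min (hs.H_pos 0 hs.zero_mem) (hs.H_pos L hs.L_mem))
  refine ⟨(2 * Cm + Cr * T) / κ, by positivity, ?_⟩
  intro G q r a b h σ hle
  obtain ⟨N, hN⟩ : ∃ N, N = ∫ τ in Icc 0 T, ‖G τ‖ := ⟨_, rfl⟩
  have hN0 : 0 ≤ N := hN ▸ integral_nonneg fun _ => norm_nonneg _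
  have h0 : (0 : ℝ) ∈ Icc 0 T := left_mem_Icc.2 hT
  have hσ0 : 0 ≤ σ := (norm_nonneg _).trans (hle 0 h0)
  have e := h.multiplier_eq hs hT
  have j1 : |∫ τ in (0 : ℝ)..T,
      2 * matForm (traceMultiplier g L U H) hs.continuousOn_traceMultiplier (G τ) (q τ)| ≤
      2 * Cm * σ * N := by
    rw [hN]
    refine integral_abs_le_of_bound (by positivity) h.integrableOn_forcing ?_ (right_mem_Icc.2 hT)
    intro τ hτ
    rw [abs_mul, abs_two]
    have h1 := hCm (G τ) (q τ)
    have h2 : Cm * ‖G τ‖ * ‖q τ‖ ≤ Cm * ‖G τ‖ * σ :=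
      mul_le_mul_of_nonneg_left (hle τ hτ) (by positivity)
    linarith
  have hq2 : ∀ {C x : ℝ} {p : State L}, 0 ≤ C → ‖p‖ ≤ σ → |x| ≤ C * ‖p‖ * ‖p‖ →
      |x| ≤ C * σ ^ 2 := by
    intro C x p hC hp hx
    refine hx.trans ?_
    rw [mul_assoc, ← sq]
    gcongr
  have j2 : |∫ τ in (0 : ℝ)..T,
      matForm (traceRemainder g L U H) hs.continuousOn_traceRemainder (q τ) (q τ)| ≤
      Cr * σ ^ 2 * T := by
    have := intervalIntegral.norm_integral_le_of_norm_le_const (a := 0) (b := T)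
      (f := fun τ => matForm (traceRemainder g L U H) hs.continuousOn_traceRemainder (q τ) (q τ))
      (C := Cr * σ ^ 2) fun τ hτ => by
        rw [uIoc_of_le hT] at hτ
        exact hq2 hCr0 (hle τ ⟨hτ.1.le, hτ.2⟩) (hCr _ _)
    rwa [Real.norm_eq_abs, sub_zero, abs_of_nonneg hT] at this
  rw [integral_add ((integrableOn_matForm _ h.integrableOn_forcing h.continuousOn).const_mul 2)
    (integrableOn_matForm _ h.continuousOn.integrableOn_Icc h.continuousOn),
    integral_Icc_eq hT (fun τ => 2 * _), integral_Icc_eq hT (fun τ => matForm _ _ _ _)] at e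
  have j3 := abs_le.1 (hq2 hCm0 (hle T (right_mem_Icc.2 hT)) (hCm (q T) (q T)))
  have j4 := abs_le.1 (hq2 hCm0 (hle 0 h0) (hCm (q 0) (q 0)))
  have j5 : κ * ∫ τ in Icc 0 T, (a τ 0 ^ 2 + a τ 1 ^ 2 + b τ 0 ^ 2 + b τ 1 ^ 2) ≤
      ∫ τ in Icc 0 T, traceForm g L H (a τ) (b τ) := by
    rw [← integral_const_mul]
    refine setIntegral_mono_on ?_ (integrable_traceForm h.continuousOn_left h.continuousOn_right)
      measurableSet_Icc ?_
    · have ha' := continuousOn_pi.1 h.continuousOn_left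
      have hb' := continuousOn_pi.1 h.continuousOn_right
      have h1 := ha' 0
      have h2 := ha' 1
      have h3 := hb' 0
      have h4 := hb' 1
      exact ContinuousOn.integrableOn_Icc (by fun_prop)
    · intro τ _
      have k1 : κ ≤ g := hκ ▸ min_le_left _ _
      have k2 : κ ≤ H 0 := hκ ▸ (min_le_right _ _).trans (min_le_left _ _)
      have k3 : κ ≤ H L := hκ ▸ (min_le_right _ _).trans (min_le_right _ _)
      rw [traceForm]
      linarith [mul_le_mul_of_nonneg_right k1 (sq_nonneg (a τ 0)),
        mul_le_mul_of_nonneg_right k1 (sq_nonneg (b τ 0)),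
        mul_le_mul_of_nonneg_right k2 (sq_nonneg (a τ 1)),
        mul_le_mul_of_nonneg_right k3 (sq_nonneg (b τ 1))]
  have j6 := (abs_le.1 j1).2
  have j7 := (abs_le.1 j2).2
  rw [← hN, div_mul_eq_mul_div, le_div_iff₀ hκ0, mul_comm]
  refine j5.trans ?_
  have : 0 ≤ Cr * T * (σ * N) := by positivity
  rw [e]
  linarith

/-- A priori estimate for regular solutions and their traces. -/
theorem exists_regular_bound (hs : IsSubcritical g L U H) (hα₁ : 0 ≤ α₁) (hα₂ : 0 ≤ α₂)
    (hβ₁ : 0 ≤ β₁) (hβ₂ : 0 ≤ β₂) (hα : (α₁, α₂) ≠ (0, 0)) (hβ : (β₁, β₂) ≠ (0, 0)) (hT : 0 ≤ T) :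
    ∃ C, 0 ≤ C ∧ ∀ (G q r : ℝ → State L) (a b : ℝ → Fin 2 → ℝ),
      IsRegular g L U H α₁ α₂ β₁ β₂ T G q r a b →
      (∀ t ∈ Icc 0 T, ‖q t‖ ≤ C * (‖q 0‖ + ∫ τ in Icc 0 T, ‖G τ‖)) ∧
      ∫ τ in Icc 0 T, (a τ 0 ^ 2 + a τ 1 ^ 2 + b τ 0 ^ 2 + b τ 1 ^ 2) ≤
        (C * (‖q 0‖ + ∫ τ in Icc 0 T, ‖G τ‖)) ^ 2 := by
  obtain ⟨C, hC0, hC⟩ := exists_regular_state_bound hs hα₁ hα₂ hβ₁ hβ₂ hα hβ hT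
  obtain ⟨D, hD0, hD⟩ := exists_regular_trace_bound (α₁ := α₁) (α₂ := α₂) (β₁ := β₁) (β₂ := β₂)
    hs hT
  -- One constant for both estimates: it exceeds C, and its square exceeds the D·C·(C + 1) that
  -- arises when the state bound is inserted into the trace bound.
  refine ⟨C + 1 + D * (C + 1), by positivity, fun G q r a b h => ?_⟩
  obtain ⟨N, hN⟩ : ∃ N, N = ∫ τ in Icc 0 T, ‖G τ‖ := ⟨_, rfl⟩
  have hN0 : 0 ≤ N := hN ▸ integral_nonneg fun _ => norm_nonneg _
  have h1 := hC G q r a b h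
  have h2 := hD G q r a b h _ h1
  rw [← hN] at h1 h2 ⊢
  obtain ⟨M, hM⟩ : ∃ M, M = ‖q 0‖ + N := ⟨_, rfl⟩
  have hM0 : 0 ≤ M := hM ▸ by positivity
  have hNM : N ≤ M := by rw [hM]; linarith [norm_nonneg (q 0)]
  rw [← hM] at h1 h2 ⊢
  constructor
  · intro t ht
    refine (h1 t ht).trans ?_
    gcongr
    have : 0 ≤ D * (C + 1) := by positivity
    linarith
  · refine h2.trans ?_
    have s1 : C * M * (C * M + N) ≤ C * M * (C * M + M) := by gcongr
    have s2 := mul_le_mul_of_nonneg_left s1 hD0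
    have s3 : D * (C * M * (C * M + M)) = D * (C * (C + 1)) * M ^ 2 := by ring
    have s4 : D * (C * (C + 1)) ≤ (C + 1 + D * (C + 1)) ^ 2 := by
      have : (C + 1 + D * (C + 1)) ^ 2 = D * (C * (C + 1)) +
        (D * (C + 1) * (C + 2) + (C + 1) ^ 2 + (D * (C + 1)) ^ 2) := by ring
      rw [this]
      exact le_add_of_nonneg_right (by positivity)
    have := mul_le_mul_of_nonneg_right s4 (sq_nonneg M)
    linarith

end

end

/-! ### Uniqueness of weak solutions and of their traces. -/

section

variable {g L T : ℝ} {U H : ℝ → ℝ} {α₁ α₂ β₁ β₂ : ℝ}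

/-- The state whose `i`-th component is `φ` and whose other component vanishes. -/
def testState (L : ℝ) (i : Fin 2) {φ : ℝ → ℝ} (hφ : Continuous φ) : State L :=
  toState (fun x => Pi.single i (φ x)) fun j => by
    refine memLp_of_continuousOn (Continuous.continuousOn ?_)
    rcases eq_or_ne j i with rfl | h
    · simpa using hφ
    · simpa [h] using continuous_const

theorem inner_testState (i : Fin 2) {φ : ℝ → ℝ} (hφ : Continuous φ) (q : State L) :
    inner ℝ (testState L i hφ) q = ∫ x in Icc 0 L, q x i * φ x := by
  rw [testState, inner_toState]
  refine integral_congr_ae (.of_forall fun x => ?_)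
  simp [mul_comm]

theorem flux_eq_matOp (hs : IsSubcritical g L U H) (q : State L) :
    ∀ᵐ x ∂(volume.restrict (Icc (0 : ℝ) L)), ∀ i,
      flux g U H q x i = matOp (fluxMatrix g U H) hs.continuousOn_fluxMatrix q x i := by
  filter_upwards [matOp_apply hs.continuousOn_fluxMatrix q] with x hx i
  rw [flux, hx]

theorem integral_flux_mul (hs : IsSubcritical g L U H) (i : Fin 2) {φ : ℝ → ℝ} (hφ : Continuous φ)
    (q : State L) :
    ∫ x in Icc 0 L, flux g U H q x i * φ x =
      inner ℝ (testState L i hφ) (matOp (fluxMatrix g U H) hs.continuousOn_fluxMatrix q) := by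
  rw [inner_testState]
  refine integral_congr_ae ?_
  filter_upwards [flux_eq_matOp hs q] with x hx
  rw [hx]

section

variable {f : State L} {G q r : ℝ → State L} {a b F0 FL : ℝ → Fin 2 → ℝ}

theorem IsRegular.weak_eq (hs : IsSubcritical g L U H)
    (h : IsRegular g L U H α₁ α₂ β₁ β₂ T G q r a b) {φ : ℝ → ℝ} (hφ : ContDiff ℝ ∞ φ) (i : Fin 2)
    {t : ℝ} (ht : t ∈ Icc 0 T) :
    inner ℝ (testState L i hφ.continuous) (q t) =
      inner ℝ (testState L i hφ.continuous) (q 0) + ∫ τ in (0 : ℝ)..t,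
        (inner ℝ (testState L i (hφ.continuous_deriv (by simp)))
          (matOp (fluxMatrix g U H) hs.continuousOn_fluxMatrix (q τ)) +
          inner ℝ (testState L i hφ.continuous) (G τ) + a τ i * φ 0 - b τ i * φ L) := by
  obtain ⟨S, hS, hd⟩ := h.hasDerivAt
  have hc := h.continuousOn.mono (Icc_subset_Icc_right ht.2)
  have key := integral_eq_of_hasDerivAt_off_countable_of_le
    (fun τ => inner ℝ (testState L i hφ.continuous) (q τ))
    (fun τ => inner ℝ (testState L i hφ.continuous) (r τ)) ht.1 hS
    (continuousOn_const.inner hc) (fun τ hτ => by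
      have h1 := hd τ ⟨⟨hτ.1.1, hτ.1.2.trans_le ht.2⟩, hτ.2⟩
      exact (innerSL ℝ (testState L i hφ.continuous)).hasFDerivAt.comp_hasDerivAt τ h1)
    (intervalIntegrable_of_Icc ht (h.integrable_deriv.const_inner _))
  rw [← sub_eq_iff_eq_add', ← key]
  refine intervalIntegral.integral_congr fun τ hτ => ?_
  rw [uIcc_of_le ht.1] at hτ
  have hw := (h.hasFlux τ ⟨hτ.1, hτ.2.trans ht.2⟩).weak hs.L_pos.le hφ i
  rw [integral_flux_mul hs i (hφ.continuous_deriv (by simp)), ← inner_testState i hφ.continuous,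
    inner_sub_right] at hw
  linarith

theorem IsWeakSolution.weak_eq (hs : IsSubcritical g L U H)
    (h : IsWeakSolution g L U H α₁ α₂ β₁ β₂ T f G q F0 FL) {φ : ℝ → ℝ} (hφ : ContDiff ℝ ∞ φ)
    (i : Fin 2) {t : ℝ} (ht : t ∈ Icc 0 T) :
    inner ℝ (testState L i hφ.continuous) (q t) =
      inner ℝ (testState L i hφ.continuous) f + ∫ τ in (0 : ℝ)..t,
        (inner ℝ (testState L i (hφ.continuous_deriv (by simp)))
          (matOp (fluxMatrix g U H) hs.continuousOn_fluxMatrix (q τ)) +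
          inner ℝ (testState L i hφ.continuous) (G τ) + F0 τ i * φ 0 - FL τ i * φ L) := by
  simpa only [inner_testState, integral_flux_mul hs i (hφ.continuous_deriv (by simp))]
    using h.weak_form φ hφ i t ht

/-- The weak form with all time integrals separated. -/
theorem IsWeakSolution.integrated_eq (hs : IsSubcritical g L U H)
    (h : IsWeakSolution g L U H α₁ α₂ β₁ β₂ T f G q F0 FL) (hG : IntegrableOn G (Icc 0 T))
    {φ : ℝ → ℝ} (hφ : ContDiff ℝ ∞ φ) (i : Fin 2) {t : ℝ} (ht : t ∈ Icc 0 T) :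
    inner ℝ (testState L i hφ.continuous) (q t) =
      inner ℝ (testState L i hφ.continuous) (f + ∫ τ in (0 : ℝ)..t, G τ) +
      inner ℝ (testState L i (hφ.continuous_deriv (by simp)))
          (matOp (fluxMatrix g U H) hs.continuousOn_fluxMatrix (∫ τ in (0 : ℝ)..t, q τ)) +
      (∫ τ in (0 : ℝ)..t, F0 τ i) * φ 0 - (∫ τ in (0 : ℝ)..t, FL τ i) * φ L := by
  have hq : IntervalIntegrable q volume 0 t :=
    intervalIntegrable_of_Icc ht h.continuousOn.integrableOn_Icc
  have hGt : IntervalIntegrable G volume 0 t := intervalIntegrable_of_Icc ht hG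
  have hF0 : IntervalIntegrable (fun τ => F0 τ i) volume 0 t :=
    intervalIntegrable_of_Icc ht ((h.trace_zero i).integrable (by norm_num))
  have hFL : IntervalIntegrable (fun τ => FL τ i) volume 0 t :=
    intervalIntegrable_of_Icc ht ((h.trace_L i).integrable (by norm_num))
  set e := testState L i hφ.continuous
  set e' := testState L i (hφ.continuous_deriv (n := ∞) (by simp))
  set M := matOp (fluxMatrix g U H) hs.continuousOn_fluxMatrix
  have c1 := ((innerSL ℝ e').comp M).intervalIntegral_comp_comm hq
  have c2 := (innerSL ℝ e).intervalIntegral_comp_comm hGt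
  have i1 : IntervalIntegrable (fun τ => inner ℝ e' (M (q τ))) volume 0 t :=
    ⟨((innerSL ℝ e').comp M).integrable_comp hq.1, ((innerSL ℝ e').comp M).integrable_comp hq.2⟩
  have i2 : IntervalIntegrable (fun τ => inner ℝ e (G τ)) volume 0 t :=
    ⟨(innerSL ℝ e).integrable_comp hGt.1, (innerSL ℝ e).integrable_comp hGt.2⟩
  simp only [ContinuousLinearMap.comp_apply, innerSL_apply_apply] at c1 c2
  rw [h.weak_eq hs hφ i ht, intervalIntegral.integral_sub ((i1.add i2).add (hF0.mul_const _))
    (hFL.mul_const _), intervalIntegral.integral_add (i1.add i2) (hF0.mul_const _),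
    intervalIntegral.integral_add i1 i2, c1, c2, intervalIntegral.integral_mul_const,
    intervalIntegral.integral_mul_const, inner_add_right]
  ring

theorem continuousOn_primitive_Icc {E : Type*} [NormedAddCommGroup E] [NormedSpace ℝ E]
    {u : ℝ → E} (hT : 0 ≤ T) (hu : IntegrableOn u (Icc 0 T)) :
    ContinuousOn (fun t => ∫ τ in (0 : ℝ)..t, u τ) (Icc 0 T) := by
  have := intervalIntegral.continuousOn_primitive_interval (f := u) (μ := volume) (a := 0) (b := T)
    (by rwa [uIcc_of_le hT])
  rwa [uIcc_of_le hT] at this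

theorem intervalIntegral_eq_zero_of_ae {u : ℝ → ℝ} {t : ℝ} (ht : t ∈ Icc 0 T)
    (hu : ∀ᵐ τ ∂(volume.restrict (Icc 0 T)), u τ = 0) : ∫ τ in (0 : ℝ)..t, u τ = 0 := by
  rw [intervalIntegral_congr_Icc ht (h := fun _ => 0) hu]
  simp

/-- The time integral of the difference of two weak solutions is a regular solution. -/
theorem IsWeakSolution.isRegular_primitive_sub (hs : IsSubcritical g L U H) (hT : 0 ≤ T)
    (hG : IntegrableOn G (Icc 0 T)) {q' : ℝ → State L} {F0' FL' : ℝ → Fin 2 → ℝ}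
    (h : IsWeakSolution g L U H α₁ α₂ β₁ β₂ T f G q F0 FL)
    (h' : IsWeakSolution g L U H α₁ α₂ β₁ β₂ T f G q' F0' FL') :
    IsRegular g L U H α₁ α₂ β₁ β₂ T 0 (fun t => ∫ τ in (0 : ℝ)..t, (q τ - q' τ))
      (fun t => q t - q' t) (fun t i => ∫ τ in (0 : ℝ)..t, (F0 τ i - F0' τ i))
      (fun t i => ∫ τ in (0 : ℝ)..t, (FL τ i - FL' τ i)) := by
  have hδ : ContinuousOn (fun t => q t - q' t) (Icc 0 T) := h.continuousOn.sub h'.continuousOn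
  have hF0 : ∀ i, IntegrableOn (fun τ => F0 τ i) (Icc 0 T) := fun i =>
    (h.trace_zero i).integrable (by norm_num)
  have hF0' : ∀ i, IntegrableOn (fun τ => F0' τ i) (Icc 0 T) := fun i =>
    (h'.trace_zero i).integrable (by norm_num)
  have hFL : ∀ i, IntegrableOn (fun τ => FL τ i) (Icc 0 T) := fun i =>
    (h.trace_L i).integrable (by norm_num)
  have hFL' : ∀ i, IntegrableOn (fun τ => FL' τ i) (Icc 0 T) := fun i =>
    (h'.trace_L i).integrable (by norm_num)
  refine ⟨continuousOn_primitive_Icc hT hδ.integrableOn_Icc, ⟨∅, countable_empty, ?_⟩,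
    hδ.integrableOn_Icc, MemLp.zero,
    continuousOn_pi.2 fun i => continuousOn_primitive_Icc hT ((hF0 i).sub (hF0' i)),
    continuousOn_pi.2 fun i => continuousOn_primitive_Icc hT ((hFL i).sub (hFL' i)), ?_, ?_⟩
  · intro t ht
    have hIcc : Icc 0 T ∈ nhds t := Icc_mem_nhds ht.1.1 ht.1.2
    exact intervalIntegral.integral_hasDerivAt_right
      (intervalIntegrable_of_Icc (Ioo_subset_Icc_self ht.1) hδ.integrableOn_Icc)
      ⟨Icc 0 T, hIcc, hδ.aestronglyMeasurable measurableSet_Icc⟩ (hδ.continuousAt hIcc)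
  · intro t ht
    have hqt : IntervalIntegrable q volume 0 t :=
      intervalIntegrable_of_Icc ht h.continuousOn.integrableOn_Icc
    have hqt' : IntervalIntegrable q' volume 0 t :=
      intervalIntegrable_of_Icc ht h'.continuousOn.integrableOn_Icc
    -- For fixed t the difference of the integrated weak forms identifies q(t) - q'(t) as minus the
    -- distributional derivative, up to the boundary, of the flux of the time integral. Integration
    -- in time has thus gained one space derivative.
    have hw : ∀ i, (∀ᵐ x ∂(volume.restrict (Icc 0 L)),
        flux g U H (∫ τ in (0 : ℝ)..t, (q τ - q' τ)) x i =
          (∫ τ in (0 : ℝ)..t, (F0 τ i - F0' τ i)) +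
            ∫ y in (0 : ℝ)..x, ((0 : ℝ → State L) t - (q t - q' t)) y i) ∧
        (∫ τ in (0 : ℝ)..t, (FL τ i - FL' τ i)) = (∫ τ in (0 : ℝ)..t, (F0 τ i - F0' τ i)) +
            ∫ y in (0 : ℝ)..L, ((0 : ℝ → State L) t - (q t - q' t)) y i := by
      intro i
      refine eq_primitive_of_weak hs.L_pos ?_ (intervalIntegrable_apply _ i hs.L_mem) ?_
      · refine intervalIntegrable_of_Icc hs.L_mem ((integrable_apply (matOp (fluxMatrix g U H)
          hs.continuousOn_fluxMatrix (∫ τ in (0 : ℝ)..t, (q τ - q' τ))) i).congr ?_)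
        filter_upwards [flux_eq_matOp hs (∫ τ in (0 : ℝ)..t, (q τ - q' τ))] with x hx
        rw [hx]
      · intro φ hφ
        have e1 := h.integrated_eq hs hG hφ i ht
        have e2 := h'.integrated_eq hs hG hφ i ht
        rw [← integral_Icc_eq hs.L_pos.le, ← integral_Icc_eq hs.L_pos.le,
          integral_flux_mul hs i (hφ.continuous_deriv (by simp)), ← inner_testState i hφ.continuous,
          intervalIntegral.integral_sub hqt hqt',
          intervalIntegral.integral_sub (intervalIntegrable_of_Icc ht (hF0 i))
            (intervalIntegrable_of_Icc ht (hF0' i)),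
          intervalIntegral.integral_sub (intervalIntegrable_of_Icc ht (hFL i))
            (intervalIntegrable_of_Icc ht (hFL' i)),
          Pi.zero_apply, zero_sub, inner_neg_right, inner_sub_right, map_sub, inner_sub_right]
        linarith
    exact ⟨fun i => (hw i).1, fun i => (hw i).2⟩
  · intro t ht
    have ii : ∀ {u u' : ℝ → ℝ} (c : ℝ), IntegrableOn u (Icc 0 T) → IntegrableOn u' (Icc 0 T) →
        IntervalIntegrable (fun τ => c * (u τ - u' τ)) volume 0 t :=
      fun c hu hu' => intervalIntegrable_of_Icc ht ((hu.sub hu').const_mul c)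
    constructor
    · rw [← intervalIntegral.integral_const_mul, ← intervalIntegral.integral_const_mul,
        ← intervalIntegral.integral_add (ii _ (hF0 0) (hF0' 0))
          (ii _ (hF0 1) (hF0' 1))]
      refine intervalIntegral_eq_zero_of_ae ht ?_
      filter_upwards [h.bc_zero, h'.bc_zero] with τ h1 h2
      linear_combination h1 - h2
    · rw [← intervalIntegral.integral_const_mul, ← intervalIntegral.integral_const_mul,
        ← intervalIntegral.integral_sub (ii _ (hFL 0) (hFL' 0))
          (ii _ (hFL 1) (hFL' 1))]
      refine intervalIntegral_eq_zero_of_ae ht ?_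
      filter_upwards [h.bc_L, h'.bc_L] with τ h1 h2
      linear_combination h1 - h2

/-- Weak solutions and their flux traces are unique. -/
theorem IsWeakSolution.unique (hs : IsSubcritical g L U H) (hα₁ : 0 ≤ α₁) (hα₂ : 0 ≤ α₂)
    (hβ₁ : 0 ≤ β₁) (hβ₂ : 0 ≤ β₂) (hα : (α₁, α₂) ≠ (0, 0)) (hβ : (β₁, β₂) ≠ (0, 0)) (hT : 0 < T)
    (hG : IntegrableOn G (Icc 0 T)) {q' : ℝ → State L} {F0' FL' : ℝ → Fin 2 → ℝ}
    (h : IsWeakSolution g L U H α₁ α₂ β₁ β₂ T f G q F0 FL)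
    (h' : IsWeakSolution g L U H α₁ α₂ β₁ β₂ T f G q' F0' FL') :
    EqOn q q' (Icc 0 T) ∧ (∀ᵐ τ ∂(volume.restrict (Icc 0 T)), ∀ i, F0 τ i = F0' τ i) ∧
      ∀ᵐ τ ∂(volume.restrict (Icc 0 T)), ∀ i, FL τ i = FL' τ i := by
  have hreg := h.isRegular_primitive_sub hs hT.le hG h'
  have hmT := right_mem_Icc.2 hT.le
  have hδ : ContinuousOn (fun t => q t - q' t) (Icc 0 T) := h.continuousOn.sub h'.continuousOn
  have hQ : ∀ t ∈ Icc 0 T, ∫ τ in (0 : ℝ)..t, (q τ - q' τ) = 0 := by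
    obtain ⟨C, hC0, hC⟩ := exists_regular_state_bound hs hα₁ hα₂ hβ₁ hβ₂ hα hβ hT.le
    intro t ht
    have := hC _ _ _ _ _ hreg t ht
    simpa using this
  have hz : ∀ᵐ t ∂(volume.restrict (Icc 0 T)), q t - q' t = 0 :=
    ae_eq_zero_of_primitive_eq_zero hT.le
      (intervalIntegrable_of_Icc hmT hδ.integrableOn_Icc) hQ
  have hq : EqOn (fun t => q t - q' t) (fun _ => 0) (Icc 0 T) :=
    Measure.eqOn_Icc_of_ae_eq volume hT.ne hz hδ continuousOn_const
  have hne : (ae (volume.restrict (Icc 0 L))).NeBot := by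
    rw [ae_neBot, Ne, Measure.restrict_eq_zero]
    simp [hs.L_pos]
  have hprim : ∀ t ∈ Icc 0 T, ∀ i, ∀ x ∈ Icc 0 L,
      ∫ y in (0 : ℝ)..x, ((0 : ℝ → State L) t - (q t - q' t)) y i = 0 := by
    intro t ht i x hx
    have hq0 : q t - q' t = 0 := hq ht
    rw [hq0, Pi.zero_apply, sub_zero]
    refine intervalIntegral_eq_zero_of_ae hx ?_
    filter_upwards [Lp.coeFn_zero (EuclideanSpace ℝ (Fin 2)) 2
      (volume.restrict (Icc (0 : ℝ) L))] with y hy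
    rw [hy]
    rfl
  -- The flux of the zero state is zero, and its weak derivative is zero too. Any single point of
  -- the full-measure set then shows that the integrated trace at 0 vanishes. Differentiating in t
  -- recovers the traces themselves.
  have ha : ∀ t ∈ Icc 0 T, ∀ i, ∫ τ in (0 : ℝ)..t, (F0 τ i - F0' τ i) = 0 := by
    intro t ht i
    have h1 := (hreg.hasFlux t ht).flux_eq i
    rw [hQ t ht] at h1
    obtain ⟨x, hx1, hx2, hx3⟩ := (h1.and ((ae_mem_Icc L).and (Lp.coeFn_zero
      (EuclideanSpace ℝ (Fin 2)) 2 (volume.restrict (Icc (0 : ℝ) L))))).exists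
    rw [hprim t ht i x hx2, add_zero, flux, hx3] at hx1
    simpa using hx1.symm
  have hb : ∀ t ∈ Icc 0 T, ∀ i, ∫ τ in (0 : ℝ)..t, (FL τ i - FL' τ i) = 0 := by
    intro t ht i
    have h1 := (hreg.hasFlux t ht).trace_eq i
    rw [hprim t ht i L hs.L_mem, add_zero] at h1
    rw [h1, ha t ht i]
  refine ⟨fun t ht => sub_eq_zero.1 (hq ht), ?_, ?_⟩
  · refine ae_all_iff.2 fun i => ?_
    filter_upwards [ae_eq_zero_of_primitive_eq_zero hT.le (intervalIntegrable_of_Icc hmT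
      (((h.trace_zero i).sub (h'.trace_zero i)).integrable (by norm_num)))
      (fun t ht => ha t ht i)] with τ hτ
    exact sub_eq_zero.1 hτ
  · refine ae_all_iff.2 fun i => ?_
    filter_upwards [ae_eq_zero_of_primitive_eq_zero hT.le (intervalIntegrable_of_Icc hmT
      (((h.trace_L i).sub (h'.trace_L i)).integrable (by norm_num)))
      (fun t ht => hb t ht i)] with τ hτ
    exact sub_eq_zero.1 hτ

end

end

/-! ### Uniqueness for the adjoint evolution problem. -/

section

variable {g L T : ℝ} {U H : ℝ → ℝ} {α₁ α₂ β₁ β₂ : ℝ}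

/-- `∫ₜᵀ p`. -/
def tailIntegral {E : Type*} [NormedAddCommGroup E] [NormedSpace ℝ E] (T : ℝ) (p : ℝ → E)
    (t : ℝ) : E :=
  (∫ s in (0 : ℝ)..T, p s) - ∫ s in (0 : ℝ)..t, p s

section tail

variable {E : Type*} [NormedAddCommGroup E] [NormedSpace ℝ E] {p : ℝ → E}

theorem tailIntegral_eq (hp : IntegrableOn p (Icc 0 T)) {t : ℝ} (ht : t ∈ Icc 0 T) :
    tailIntegral T p t = ∫ s in t..T, p s := by
  have hT : T ∈ Icc 0 T := right_mem_Icc.2 (ht.1.trans ht.2)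
  exact intervalIntegral.integral_interval_sub_left (intervalIntegrable_of_Icc hT hp)
    (intervalIntegrable_of_Icc ht hp)

theorem continuousOn_tailIntegral (hT : 0 ≤ T) (hp : IntegrableOn p (Icc 0 T)) :
    ContinuousOn (tailIntegral T p) (Icc 0 T) :=
  continuousOn_const.sub (continuousOn_primitive_Icc hT hp)

theorem tailIntegral_self : tailIntegral T p T = 0 := sub_self _

theorem ae_eq_zero_of_tailIntegral_eq_zero [CompleteSpace E] (hT : 0 ≤ T)
    (hp : IntegrableOn p (Icc 0 T)) (h : ∀ t ∈ Icc 0 T, tailIntegral T p t = 0) :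
    ∀ᵐ t ∂(volume.restrict (Icc 0 T)), p t = 0 := by
  refine ae_eq_zero_of_primitive_eq_zero hT
    (intervalIntegrable_of_Icc (right_mem_Icc.2 hT) hp) fun t ht => ?_
  have h0 := h 0 (left_mem_Icc.2 hT)
  have h1 := h t ht
  simp only [tailIntegral, intervalIntegral.integral_same, sub_zero] at h0 h1
  rwa [h0, zero_sub, neg_eq_zero] at h1

/-- Fubini for an iterated tail integral. -/
theorem integral_sub_mul_eq {p : ℝ → ℝ} (hp : IntegrableOn p (Icc 0 T)) {t : ℝ}
    (ht : t ∈ Icc 0 T) :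
    ∫ s in t..T, (s - t) * p s = ∫ s in t..T, tailIntegral T p s := by
  have hpt : IntervalIntegrable p volume t T := by
    rw [intervalIntegrable_iff_integrableOn_Ioc_of_le ht.2]
    exact hp.mono_set (Ioc_subset_Icc_self.trans (Icc_subset_Icc_left ht.1))
  -- The product rule for s - t and minus the tail integral of p. The first factor vanishes at s = t
  -- and the second at s = T, so there are no boundary terms.
  have key := integral_mul_primitive_add_primitive_mul (u := fun _ => 1) 0 (-∫ s in t..T, p s)
    (intervalIntegrable_const (μ := volume) (a := t) (b := T)) hpt
  rw [neg_add_cancel, mul_zero, zero_mul, sub_zero] at key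
  have e : ∀ s ∈ uIcc t T, 1 * (-(∫ s in t..T, p s) + ∫ y in t..s, p y) +
      (0 + ∫ _ in t..s, (1 : ℝ)) * p s = (s - t) * p s - tailIntegral T p s := by
    intro s hs
    rw [uIcc_of_le ht.2] at hs
    have hs' : s ∈ Icc 0 T := ⟨ht.1.trans hs.1, hs.2⟩
    have h1 := tailIntegral_eq hp ht
    simp only [tailIntegral] at h1 ⊢
    rw [← h1, ← intervalIntegral.integral_interval_sub_left (intervalIntegrable_of_Icc hs' hp)
      (intervalIntegrable_of_Icc ht hp)]
    simp
    ring
  rw [intervalIntegral.integral_congr e, intervalIntegral.integral_sub] at key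
  · exact sub_eq_zero.1 key
  · exact hpt.continuousOn_mul (by fun_prop)
  · refine ContinuousOn.intervalIntegrable ?_
    rw [uIcc_of_le ht.2]
    exact (continuousOn_tailIntegral (ht.1.trans ht.2) hp).mono (Icc_subset_Icc_left ht.1)

end tail

/-- A weak solution of the adjoint problem with vanishing final data vanishes. -/
theorem eq_zero_of_adjoint (hs : IsSubcritical g L U H) (hα₁ : 0 ≤ α₁) (hα₂ : 0 ≤ α₂)
    (hβ₁ : 0 ≤ β₁) (hβ₂ : 0 ≤ β₂) (hα : (α₁, α₂) ≠ (0, 0)) (hβ : (β₁, β₂) ≠ (0, 0)) (hT : 0 < T)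
    {p : ℝ → State L} (hp : IntegrableOn p (Icc 0 T))
    (h : ∀ (w v : State L) (a b : Fin 2 → ℝ), HasFlux g U H w v a b →
      BoundaryCond α₁ α₂ β₁ β₂ a b → ∀ t ∈ Icc 0 T,
      (∫ s in t..T, inner ℝ (p s) w) + ∫ s in t..T, (s - t) * inner ℝ (p s) v = 0) :
    ∀ᵐ t ∂(volume.restrict (Icc 0 T)), p t = 0 := by
  -- Two integrations backward from T give enough regularity in time. By Fubini the hypothesis
  -- becomes the adjoint relation between P(t) and Q(t) at each time.
  set P := tailIntegral T p with hP
  set Q := tailIntegral T P with hQ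
  have hPc : ContinuousOn P (Icc 0 T) := continuousOn_tailIntegral hT.le hp
  have hPi : IntegrableOn P (Icc 0 T) := hPc.integrableOn_Icc
  have hQc : ContinuousOn Q (Icc 0 T) := continuousOn_tailIntegral hT.le hPi
  have sub : ∀ {u : ℝ → State L} {t : ℝ}, IntegrableOn u (Icc 0 T) → t ∈ Icc 0 T →
      IntervalIntegrable u volume t T := fun hu ht => by
    rw [intervalIntegrable_iff_integrableOn_Ioc_of_le ht.2]
    exact hu.mono_set (Ioc_subset_Icc_self.trans (Icc_subset_Icc_left ht.1))
  have inn : ∀ {u : ℝ → State L} (z : State L), IntegrableOn u (Icc 0 T) →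
      IntegrableOn (fun s => inner ℝ (u s) z) (Icc 0 T) := fun z hu => hu.inner_const z
  have comm : ∀ {u : ℝ → State L} (z : State L) {t : ℝ}, IntegrableOn u (Icc 0 T) → t ∈ Icc 0 T →
      tailIntegral T (fun s => inner ℝ (u s) z) t = inner ℝ (tailIntegral T u t) z := by
    intro u z t hu ht
    have h1 := (innerSL ℝ z).intervalIntegral_comp_comm (sub hu ht)
    simp only [innerSL_apply_apply] at h1
    rw [tailIntegral_eq hu ht, tailIntegral_eq (inn z hu) ht, real_inner_comm, ← h1]
    exact intervalIntegral.integral_congr fun s _ => real_inner_comm _ _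
  have hadj : ∀ t ∈ Icc 0 T, ∀ (w v : State L) (a b : Fin 2 → ℝ), HasFlux g U H w v a b →
      BoundaryCond α₁ α₂ β₁ β₂ a b → inner ℝ (P t) w = -inner ℝ (Q t) v := by
    intro t ht w v a b hw hbc
    have e := h w v a b hw hbc t ht
    rw [integral_sub_mul_eq (inn v hp) ht, ← tailIntegral_eq (inn w hp) ht,
      comm w hp ht] at e
    have e2 : ∫ s in t..T, tailIntegral T (fun s => inner ℝ (p s) v) s =
        ∫ s in t..T, inner ℝ (P s) v := by
      refine intervalIntegral.integral_congr fun s hs' => ?_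
      rw [uIcc_of_le ht.2] at hs'
      exact comm v hp ⟨ht.1.trans hs'.1, hs'.2⟩
    rw [e2, ← tailIntegral_eq (inn v hPi) ht, comm v hPi ht] at e
    linarith
  have hdiss : ∀ t ∈ Icc 0 T,
      matForm (invWeightMatrix g U H) hs.continuousOn_invWeightMatrix (P t) (Q t) ≤ 0 :=
    fun t ht => adjoint_dissipative hs hα₁ hα₂ hβ₁ hβ₂ hα hβ (hadj t ht)
  have hQd : ∀ t ∈ Ioo 0 T, HasDerivAt Q (-P t) t := by
    intro t ht
    have hIcc : Icc 0 T ∈ nhds t := Icc_mem_nhds ht.1 ht.2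
    exact (intervalIntegral.integral_hasDerivAt_right
      (intervalIntegrable_of_Icc (Ioo_subset_Icc_self ht) hPi)
      ⟨Icc 0 T, hIcc, hPc.aestronglyMeasurable measurableSet_Icc⟩
      (hPc.continuousAt hIcc)).const_sub _
  set A := matOp (L := L) (invWeightMatrix g U H) hs.continuousOn_invWeightMatrix with hA
  have hEd : ∀ t ∈ Ioo 0 T, HasDerivAt
      (fun t => matForm (invWeightMatrix g U H) hs.continuousOn_invWeightMatrix (Q t) (Q t))
      (-2 * matForm (invWeightMatrix g U H) hs.continuousOn_invWeightMatrix (P t) (Q t)) t := by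
    intro t ht
    have h1 := hQd t ht
    have h2 := h1.inner ℝ (A.hasFDerivAt.comp_hasDerivAt t h1)
    convert! h2 using 1
    have := matForm_comm hs.continuousOn_invWeightMatrix (fun x => rfl) (P t) (Q t)
    rw [map_neg, inner_neg_left, inner_neg_right]
    simp only [matForm, Function.comp_apply, ← hA] at this ⊢
    linarith
  -- Since Q' = -P, dissipativity makes the W⁻¹-energy of Q nondecreasing. It vanishes at T and W⁻¹
  -- is positive definite, so Q is zero on the whole interval.
  have hmono : MonotoneOn
      (fun t => matForm (invWeightMatrix g U H) hs.continuousOn_invWeightMatrix (Q t) (Q t))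
      (Icc 0 T) := by
    refine monotoneOn_of_deriv_nonneg (convex_Icc _ _)
      (hQc.inner (A.continuous.comp_continuousOn hQc)) ?_ ?_
    · intro t ht
      rw [interior_Icc] at ht
      exact (hEd t ht).differentiableAt.differentiableWithinAt
    · intro t ht
      rw [interior_Icc] at ht
      rw [(hEd t ht).deriv]
      have := hdiss t (Ioo_subset_Icc_self ht)
      linarith
  have hQ0 : ∀ t ∈ Icc 0 T, Q t = 0 := by
    intro t ht
    refine hs.invWeight_pos ((hmono ht (right_mem_Icc.2 hT.le) ht.2).trans ?_)
    have : Q T = 0 := tailIntegral_self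
    simp [this, matForm]
  have hP0 := ae_eq_zero_of_tailIntegral_eq_zero hT.le hPi hQ0
  have hP0' : EqOn P (fun _ => 0) (Icc 0 T) :=
    Measure.eqOn_Icc_of_ae_eq volume hT.ne hP0 hPc continuousOn_const
  exact ae_eq_zero_of_tailIntegral_eq_zero hT.le hp hP0'

end

/-! ### Square integrable functions of time. -/

section

section time

variable {E : Type*} {T t : ℝ}

/-- Restriction of a square integrable function of time to `[0,t]`, extended by zero. -/
def cutoff [NormedAddCommGroup E] [NormedSpace ℝ E] (T t : ℝ) :
    Lp E 2 (volume.restrict (Icc 0 T)) →L[ℝ] Lp E 2 (volume.restrict (Icc 0 T)) :=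
  (ContinuousLinearMap.lsmul ℝ ℝ : ℝ →L[ℝ] E →L[ℝ] E).holderL (volume.restrict (Icc 0 T)) ⊤ 2 2
    (indicatorConstLp ⊤ (measurableSet_Icc (a := (0 : ℝ)) (b := t)) (measure_ne_top _ _) (1 : ℝ))

theorem cutoff_apply [NormedAddCommGroup E] [NormedSpace ℝ E]
    (p : Lp E 2 (volume.restrict (Icc 0 T))) :
    ∀ᵐ τ ∂(volume.restrict (Icc 0 T)),
      cutoff T t p τ = (Icc 0 t).indicator (fun _ => (1 : ℝ)) τ • p τ := by
  have h1 := ContinuousLinearMap.coeFn_holder (p := ⊤) (q := 2) (r := 2)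
    (ContinuousLinearMap.lsmul ℝ ℝ : ℝ →L[ℝ] E →L[ℝ] E)
    (indicatorConstLp ⊤ (measurableSet_Icc (a := (0 : ℝ)) (b := t))
      (measure_ne_top (volume.restrict (Icc 0 T)) _) (1 : ℝ)) p
  have h2 := indicatorConstLp_coeFn (p := ⊤) (hs := measurableSet_Icc (a := (0 : ℝ)) (b := t))
      (hμs := measure_ne_top (volume.restrict (Icc 0 T)) _) (c := (1 : ℝ))
  filter_upwards [h1, h2] with τ h1 h2
  rw [← h2]
  exact h1

theorem inner_cutoff [NormedAddCommGroup E] [InnerProductSpace ℝ E] (ht : t ∈ Icc 0 T)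
    (p q : Lp E 2 (volume.restrict (Icc 0 T))) :
    inner ℝ (cutoff T t p) q = ∫ τ in (0 : ℝ)..t, inner ℝ (p τ) (q τ) := by
  have : (volume.restrict (Icc 0 T)).restrict (Icc 0 t) = volume.restrict (Icc 0 t) := by
    rw [Measure.restrict_restrict measurableSet_Icc,
      inter_eq_self_of_subset_left (Icc_subset_Icc_right ht.2)]
  rw [L2.inner_def, ← integral_Icc_eq ht.1, ← this,
    ← integral_indicator (s := Icc 0 t) measurableSet_Icc]
  refine integral_congr_ae ?_
  filter_upwards [cutoff_apply p] with τ h1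
  rw [h1]
  by_cases hτ : τ ∈ Icc 0 t
  · simp only [indicator_of_mem hτ, one_smul]
  · simp only [indicator_of_notMem hτ, zero_smul, inner_zero_left]

/-- Used to pass bilinear expressions to the closure of the graph: the integral over [0,t] is an
inner product with a cut-off function on [0,T]. -/
theorem continuous_integral_inner [NormedAddCommGroup E] [InnerProductSpace ℝ E]
    {X : Type*} [TopologicalSpace X] (ht : t ∈ Icc 0 T)
    {p q : X → Lp E 2 (volume.restrict (Icc 0 T))} (hp : Continuous p) (hq : Continuous q) :
    Continuous fun x => ∫ τ in (0 : ℝ)..t, inner ℝ (p x τ) (q x τ) := by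
  simp only [← inner_cutoff ht]
  exact ((cutoff T t).continuous.comp hp).inner hq

theorem intervalIntegrable_inner [NormedAddCommGroup E] [InnerProductSpace ℝ E]
    (ht : t ∈ Icc 0 T) (p q : Lp E 2 (volume.restrict (Icc 0 T))) :
    IntervalIntegrable (fun τ => inner ℝ (p τ) (q τ)) volume 0 t :=
  intervalIntegrable_of_Icc ht (L2.integrable_inner p q)

theorem intervalIntegrable_clm [NormedAddCommGroup E] [NormedSpace ℝ E] (ℓ : E →L[ℝ] ℝ)
    (ht : t ∈ Icc 0 T) (p : Lp E 2 (volume.restrict (Icc 0 T))) :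
    IntervalIntegrable (fun τ => ℓ (p τ)) volume 0 t :=
  intervalIntegrable_of_Icc ht (ℓ.integrable_comp ((Lp.memLp p).integrable (by norm_num)))

theorem continuous_integral_clm [NormedAddCommGroup E] [NormedSpace ℝ E] {X : Type*}
    [TopologicalSpace X] (ℓ : E →L[ℝ] ℝ) (ht : t ∈ Icc 0 T)
    {p : X → Lp E 2 (volume.restrict (Icc 0 T))} (hp : Continuous p) :
    Continuous fun x => ∫ τ in (0 : ℝ)..t, ℓ (p x τ) := by
  have h1 : Continuous fun x => ℓ.compLpL 2 (volume.restrict (Icc 0 T)) (p x) :=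
    (ℓ.compLpL 2 (volume.restrict (Icc 0 T))).continuous.comp hp
  -- The linear case is the bilinear one with the constant 1 as first factor.
  refine (continuous_integral_inner ht (continuous_const (y := Lp.const 2
    (volume.restrict (Icc 0 T)) (1 : ℝ))) h1).congr fun x => ?_
  refine intervalIntegral_congr_Icc ht ?_
  filter_upwards [Lp.coeFn_const 2 (volume.restrict (Icc 0 T)) (1 : ℝ),
    ℓ.coeFn_compLpL (p x)] with τ h1 h2
  rw [h1, h2]
  simp

theorem exists_integral_norm_le (E : Type*) [NormedAddCommGroup E] [NormedSpace ℝ E] (T : ℝ) :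
    ∃ C, 0 ≤ C ∧ ∀ F : Lp E 2 (volume.restrict (Icc 0 T)),
      ∫ τ in Icc 0 T, ‖F τ‖ ≤ C * ‖F‖ := by
  refine ⟨((volume.restrict (Icc 0 T)) univ ^ (1 / (1 : ENNReal).toReal -
    1 / (2 : ENNReal).toReal)).toReal, ENNReal.toReal_nonneg, fun F => ?_⟩
  have h := eLpNorm_le_eLpNorm_mul_rpow_measure_univ (μ := volume.restrict (Icc 0 T))
    (p := 1) (q := 2) (f := F) (by norm_num) (Lp.aestronglyMeasurable F)
  rw [eLpNorm_one_eq_lintegral_enorm] at h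
  rw [integral_norm_eq_lintegral_enorm (Lp.aestronglyMeasurable F), Lp.norm_def, mul_comm,
    ← ENNReal.toReal_mul]
  refine ENNReal.toReal_mono (ENNReal.mul_ne_top (Lp.eLpNorm_ne_top F) ?_) h
  refine ENNReal.rpow_ne_top_of_nonneg (by norm_num) (measure_ne_top _ _)

theorem memLp_IccExtend [NormedAddCommGroup E] (hT : 0 ≤ T) (q : C(Icc 0 T, E)) :
    MemLp (IccExtend hT q) 2 (volume.restrict (Icc 0 T)) :=
  MemLp.of_bound (C := ‖q‖)
    ((q.continuous.Icc_extend' (h := hT)).continuousOn.aestronglyMeasurable measurableSet_Icc)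
    (.of_forall fun _ => q.norm_coe_le_norm _)

/-- A continuous function of time as a square integrable one. -/
def toTimeLp [NormedAddCommGroup E] [NormedSpace ℝ E] (hT : 0 ≤ T) :
    C(Icc 0 T, E) →L[ℝ] Lp E 2 (volume.restrict (Icc 0 T)) :=
  LinearMap.mkContinuous
    { toFun := fun q => (memLp_IccExtend hT q).toLp _
      map_add' := fun _ _ => rfl
      map_smul' := fun _ _ => rfl }
    ((measureUnivNNReal (volume.restrict (Icc 0 T)) : ℝ) ^ ((2 : ENNReal).toReal)⁻¹) fun q => by
      refine Lp.norm_le_of_ae_bound (norm_nonneg _) ?_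
      filter_upwards [(memLp_IccExtend hT q).coeFn_toLp] with τ hτ
      refine (congrArg norm hτ).trans_le ?_
      exact q.norm_coe_le_norm _

theorem toTimeLp_apply [NormedAddCommGroup E] [NormedSpace ℝ E] (hT : 0 ≤ T) (q : C(Icc 0 T, E)) :
    ∀ᵐ τ ∂(volume.restrict (Icc 0 T)), toTimeLp hT q τ = IccExtend hT q τ :=
  (memLp_IccExtend hT q).coeFn_toLp

end time

end

/-! ### The graph of the solution operator and its closure. -/

section

/-- Initial data and forcing. -/
abbrev Data (L T : ℝ) : Type := State L × Lp (State L) 2 (volume.restrict (Icc (0 : ℝ) T))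

/-- A state depending continuously on time with a pair of flux traces. -/
abbrev Trajectory (L T : ℝ) : Type := C(Icc (0 : ℝ) T, State L) × State T × State T

variable {g L T : ℝ} {U H : ℝ → ℝ} {α₁ α₂ β₁ β₂ : ℝ}

/-- The functions `G`, `q`, `a`, `b` represent the given data and trajectory. -/
structure Represents (z : Data L T × Trajectory L T) (G q : ℝ → State L) (a b : ℝ → Fin 2 → ℝ) :
    Prop where
  initial : z.1.1 = q 0
  forcing : ∀ᵐ τ ∂(volume.restrict (Icc 0 T)), z.1.2 τ = G τ
  state : ∀ t : Icc 0 T, z.2.1 t = q t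
  left : ∀ᵐ τ ∂(volume.restrict (Icc 0 T)), (z.2.2.1 τ).ofLp = a τ
  right : ∀ᵐ τ ∂(volume.restrict (Icc 0 T)), (z.2.2.2 τ).ofLp = b τ

theorem Represents.add {z z' : Data L T × Trajectory L T} {G q G' q' : ℝ → State L}
    {a b a' b' : ℝ → Fin 2 → ℝ} (h : Represents z G q a b) (h' : Represents z' G' q' a' b') :
    Represents (z + z') (G + G') (q + q') (a + a') (b + b') where
  initial := by rw [Prod.fst_add, Prod.fst_add, h.initial, h'.initial, Pi.add_apply]
  forcing := by
    filter_upwards [h.forcing, h'.forcing, Lp.coeFn_add z.1.2 z'.1.2] with τ h1 h2 h3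
    rw [Prod.fst_add, Prod.snd_add, h3, Pi.add_apply, h1, h2, Pi.add_apply]
  state t := by
    rw [Prod.snd_add, Prod.fst_add, ContinuousMap.add_apply, h.state, h'.state, Pi.add_apply]
  left := by
    filter_upwards [h.left, h'.left, Lp.coeFn_add z.2.2.1 z'.2.2.1] with τ h1 h2 h3
    rw [Prod.snd_add, Prod.snd_add, Prod.fst_add, h3, Pi.add_apply, WithLp.ofLp_add, h1, h2,
      Pi.add_apply]
  right := by
    filter_upwards [h.right, h'.right, Lp.coeFn_add z.2.2.2 z'.2.2.2] with τ h1 h2 h3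
    rw [Prod.snd_add, Prod.snd_add, Prod.snd_add, h3, Pi.add_apply, WithLp.ofLp_add, h1, h2,
      Pi.add_apply]

theorem Represents.smul (c : ℝ) {z : Data L T × Trajectory L T} {G q : ℝ → State L}
    {a b : ℝ → Fin 2 → ℝ} (h : Represents z G q a b) :
    Represents (c • z) (c • G) (c • q) (c • a) (c • b) where
  initial := by rw [Prod.smul_fst, Prod.smul_fst, h.initial, Pi.smul_apply]
  forcing := by
    filter_upwards [h.forcing, Lp.coeFn_smul c z.1.2] with τ h1 h3
    rw [Prod.smul_fst, Prod.smul_snd, h3, Pi.smul_apply, h1, Pi.smul_apply]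
  state t := by
    rw [Prod.smul_snd, Prod.smul_fst, ContinuousMap.smul_apply, h.state, Pi.smul_apply]
  left := by
    filter_upwards [h.left, Lp.coeFn_smul c z.2.2.1] with τ h1 h3
    rw [Prod.smul_snd, Prod.smul_snd, Prod.smul_fst, h3, Pi.smul_apply, WithLp.ofLp_smul, h1,
      Pi.smul_apply]
  right := by
    filter_upwards [h.right, Lp.coeFn_smul c z.2.2.2] with τ h1 h3
    rw [Prod.smul_snd, Prod.smul_snd, Prod.smul_snd, h3, Pi.smul_apply, WithLp.ofLp_smul, h1,
      Pi.smul_apply]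

theorem IsRegular.exists_represents (h : IsRegular g L U H α₁ α₂ β₁ β₂ T G q r a b)
    {F : Lp (State L) 2 (volume.restrict (Icc (0 : ℝ) T))}
    (hF : ∀ᵐ τ ∂(volume.restrict (Icc 0 T)), F τ = G τ) :
    ∃ y : Trajectory L T, Represents ((q 0, F), y) G q a b := by
  have ha : ∀ i, MemLp (fun τ => a τ i) 2 (volume.restrict (Icc 0 T)) := fun i =>
    memLp_of_continuousOn (continuousOn_pi.1 h.continuousOn_left i)
  have hb : ∀ i, MemLp (fun τ => b τ i) 2 (volume.restrict (Icc 0 T)) := fun i =>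
    memLp_of_continuousOn (continuousOn_pi.1 h.continuousOn_right i)
  refine ⟨(⟨(Icc 0 T).domRestrict q, continuousOn_iff_continuous_domRestrict.1 h.continuousOn⟩,
    toState a ha, toState b hb), rfl, hF, fun t => rfl, ?_, ?_⟩
  · filter_upwards [toState_apply ha] with τ hτ
    exact funext hτ
  · filter_upwards [toState_apply hb] with τ hτ
    exact funext hτ

theorem isRegular_zero (hL : 0 ≤ L) :
    IsRegular g L U H α₁ α₂ β₁ β₂ T 0 0 0 0 0 where
  continuousOn := continuousOn_const
  hasDerivAt := ⟨∅, countable_empty, fun t _ => hasDerivAt_const t 0⟩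
  integrable_deriv := integrableOn_zero
  memLp_forcing := MemLp.zero
  continuousOn_left := continuousOn_const
  continuousOn_right := continuousOn_const
  hasFlux t _ := by
    simpa using HasFlux.zero (g := g) (U := U) (H := H) hL
  boundary t _ := by simp [BoundaryCond]

/-- The graph of the solution operator on regular solutions. -/
def regularGraph (g : ℝ) {L : ℝ} (U H : ℝ → ℝ) (α₁ α₂ β₁ β₂ T : ℝ) (hL : 0 ≤ L) :
    Submodule ℝ (Data L T × Trajectory L T) where
  carrier := {z | ∃ G q r a b, IsRegular g L U H α₁ α₂ β₁ β₂ T G q r a b ∧ Represents z G q a b}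
  add_mem' := by
    rintro z z' ⟨G, q, r, a, b, h, hz⟩ ⟨G', q', r', a', b', h', hz'⟩
    exact ⟨_, _, _, _, _, h.add hL h', hz.add hz'⟩
  zero_mem' := by
    refine ⟨0, 0, 0, 0, 0, isRegular_zero hL, rfl, Lp.coeFn_zero _ _ _, fun t => rfl, ?_, ?_⟩
    · filter_upwards [Lp.coeFn_zero (EuclideanSpace ℝ (Fin 2)) 2 (volume.restrict (Icc 0 T))]
        with τ hτ
      simp only [Prod.snd_zero, Prod.fst_zero, hτ]
      rfl
    · filter_upwards [Lp.coeFn_zero (EuclideanSpace ℝ (Fin 2)) 2 (volume.restrict (Icc 0 T))]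
        with τ hτ
      simp only [Prod.snd_zero, hτ]
      rfl
  smul_mem' := by
    rintro c z ⟨G, q, r, a, b, h, hz⟩
    exact ⟨_, _, _, _, _, h.smul hL c, hz.smul c⟩

theorem norm_sq_state_time (A : State T) :
    ‖A‖ ^ 2 = ∫ τ in Icc 0 T, (A τ 0 ^ 2 + A τ 1 ^ 2) := by
  rw [← real_inner_self_eq_norm_sq, inner_state]
  refine integral_congr_ae (.of_forall fun τ => ?_)
  simp [dotProduct, Fin.sum_univ_two, sq]

/-- The a priori estimate in terms of the graph norm. The forcing enters through its integral in
time, which the L² norm controls on a bounded interval. -/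
theorem exists_graph_bound (hs : IsSubcritical g L U H) (hα₁ : 0 ≤ α₁) (hα₂ : 0 ≤ α₂)
    (hβ₁ : 0 ≤ β₁) (hβ₂ : 0 ≤ β₂) (hα : (α₁, α₂) ≠ (0, 0)) (hβ : (β₁, β₂) ≠ (0, 0)) (hT : 0 ≤ T) :
    ∃ C, 0 ≤ C ∧ ∀ z ∈ regularGraph g U H α₁ α₂ β₁ β₂ T hs.L_pos.le, ‖z.2‖ ≤ C * ‖z.1‖ := by
  obtain ⟨C, hC0, hC⟩ := exists_regular_bound hs hα₁ hα₂ hβ₁ hβ₂ hα hβ hT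
  obtain ⟨D, hD0, hD⟩ := exists_integral_norm_le (State L) T
  refine ⟨C * (1 + D), by positivity, ?_⟩
  rintro z ⟨G, q, r, a, b, h, hz⟩
  obtain ⟨h1, h2⟩ := hC G q r a b h
  have hG : ∫ τ in Icc 0 T, ‖G τ‖ ≤ D * ‖z.1.2‖ := by
    refine le_of_eq_of_le (integral_congr_ae ?_) (hD z.1.2)
    filter_upwards [hz.forcing] with τ hτ
    rw [hτ]
  have hM : ‖q 0‖ + ∫ τ in Icc 0 T, ‖G τ‖ ≤ (1 + D) * ‖z.1‖ := by
    rw [← hz.initial]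
    have e1 : ‖z.1.1‖ ≤ ‖z.1‖ := norm_fst_le z.1
    have e2 : ‖z.1.2‖ ≤ ‖z.1‖ := norm_snd_le z.1
    have := mul_le_mul_of_nonneg_left e2 hD0
    linarith
  have hCM := mul_le_mul_of_nonneg_left hM hC0
  rw [← mul_assoc] at hCM
  have hN0 : 0 ≤ ∫ τ in Icc 0 T, ‖G τ‖ := integral_nonneg fun _ => norm_nonneg _
  have hnn : 0 ≤ C * (‖q 0‖ + ∫ τ in Icc 0 T, ‖G τ‖) := by positivity
  have ca : IntegrableOn (fun τ => a τ 0 ^ 2 + a τ 1 ^ 2) (Icc 0 T) := by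
    have h1 := continuousOn_pi.1 h.continuousOn_left 0
    have h2 := continuousOn_pi.1 h.continuousOn_left 1
    exact ContinuousOn.integrableOn_Icc (by fun_prop)
  have cb : IntegrableOn (fun τ => b τ 0 ^ 2 + b τ 1 ^ 2) (Icc 0 T) := by
    have h1 := continuousOn_pi.1 h.continuousOn_right 0
    have h2 := continuousOn_pi.1 h.continuousOn_right 1
    exact ContinuousOn.integrableOn_Icc (by fun_prop)
  have e3 : ∫ τ in Icc 0 T, (a τ 0 ^ 2 + a τ 1 ^ 2 + b τ 0 ^ 2 + b τ 1 ^ 2) =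
      ‖z.2.2.1‖ ^ 2 + ‖z.2.2.2‖ ^ 2 := by
    have ea : ‖z.2.2.1‖ ^ 2 = ∫ τ in Icc 0 T, (a τ 0 ^ 2 + a τ 1 ^ 2) := by
      rw [norm_sq_state_time]
      refine integral_congr_ae ?_
      filter_upwards [hz.left] with τ hτ
      rw [hτ]
    have eb : ‖z.2.2.2‖ ^ 2 = ∫ τ in Icc 0 T, (b τ 0 ^ 2 + b τ 1 ^ 2) := by
      rw [norm_sq_state_time]
      refine integral_congr_ae ?_
      filter_upwards [hz.right] with τ hτ
      rw [hτ]
    rw [ea, eb, ← integral_add ca cb]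
    refine integral_congr_ae (.of_forall fun τ => ?_)
    simp only
    ring
  rw [e3] at h2
  refine norm_prod_le_iff.2 ⟨?_, norm_prod_le_iff.2 ⟨?_, ?_⟩⟩
  · refine ((ContinuousMap.norm_le _ hnn).2 fun t => ?_).trans hCM
    rw [hz.state]
    exact h1 t t.2
  · refine (abs_le_of_sq_le_sq' ?_ hnn).2.trans hCM
    linarith [sq_nonneg ‖z.2.2.2‖]
  · refine (abs_le_of_sq_le_sq' ?_ hnn).2.trans hCM
    linarith [sq_nonneg ‖z.2.2.1‖]

/-- The data for which the closure of the graph of regular solutions contains a trajectory. -/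
def solvableData (g : ℝ) {L : ℝ} (U H : ℝ → ℝ) (α₁ α₂ β₁ β₂ T : ℝ) (hL : 0 ≤ L) :
    Submodule ℝ (Data L T) :=
  (regularGraph g U H α₁ α₂ β₁ β₂ T hL).topologicalClosure.map
    (LinearMap.fst ℝ (Data L T) (Trajectory L T))

/-- The a priori bound survives in the closure of the graph, so the projection of this complete
space to the data is bounded below and has closed range. -/
theorem isClosed_solvableData (hs : IsSubcritical g L U H) (hα₁ : 0 ≤ α₁) (hα₂ : 0 ≤ α₂)
    (hβ₁ : 0 ≤ β₁) (hβ₂ : 0 ≤ β₂) (hα : (α₁, α₂) ≠ (0, 0)) (hβ : (β₁, β₂) ≠ (0, 0)) (hT : 0 ≤ T) :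
    IsClosed (solvableData g U H α₁ α₂ β₁ β₂ T hs.L_pos.le : Set (Data L T)) := by
  obtain ⟨C, hC0, hC⟩ := exists_graph_bound hs hα₁ hα₂ hβ₁ hβ₂ hα hβ hT
  set Γ := (regularGraph g U H α₁ α₂ β₁ β₂ T hs.L_pos.le).topologicalClosure with hΓ
  have hbound : ∀ z ∈ Γ, ‖z.2‖ ≤ C * ‖z.1‖ := by
    have hcl : IsClosed {z : Data L T × Trajectory L T | ‖z.2‖ ≤ C * ‖z.1‖} :=
      isClosed_le (by fun_prop) (by fun_prop)
    intro z hz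
    exact closure_minimal (fun z hz => hC z hz) hcl hz
  have : CompleteSpace Γ := (Submodule.isClosed_topologicalClosure _).completeSpace_coe
  set F : Γ →L[ℝ] Data L T := (ContinuousLinearMap.fst ℝ (Data L T) (Trajectory L T)).comp Γ.subtypeL
    with hF
  have hanti : AntilipschitzWith ⟨1 + C, by positivity⟩ F := by
    refine F.antilipschitz_of_bound fun z => ?_
    have h1 := hbound z z.2
    have h2 : ‖(z : Data L T × Trajectory L T)‖ ≤ (1 + C) * ‖(z : Data L T × Trajectory L T).1‖ := by
      refine norm_prod_le_iff.2 ⟨?_, ?_⟩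
      · have := mul_nonneg hC0 (norm_nonneg (z : Data L T × Trajectory L T).1)
        linarith
      · have := norm_nonneg (z : Data L T × Trajectory L T).1
        linarith
    exact h2
  have hr := hanti.isClosed_range F.uniformContinuous
  convert! hr using 1
  ext d
  constructor
  · rintro ⟨z, hz, rfl⟩
    exact ⟨⟨z, hz⟩, rfl⟩
  · rintro ⟨z, rfl⟩
    exact ⟨z, z.2, rfl⟩

end

/-! ### All data are solvable. -/

section

variable {g L T : ℝ} {U H : ℝ → ℝ} {α₁ α₂ β₁ β₂ : ℝ}

theorem IsRegular.mem_solvableData (hL : 0 ≤ L) {G q r : ℝ → State L} {a b : ℝ → Fin 2 → ℝ}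
    (h : IsRegular g L U H α₁ α₂ β₁ β₂ T G q r a b) :
    (q 0, h.memLp_forcing.toLp G) ∈ solvableData g U H α₁ α₂ β₁ β₂ T hL := by
  obtain ⟨y, hy⟩ := h.exists_represents h.memLp_forcing.coeFn_toLp
  exact ⟨_, Submodule.le_topologicalClosure _ ⟨G, q, r, a, b, h, hy⟩, rfl⟩

/-- The solvable forcings with zero initial state form a closed subspace of a Hilbert space. Its
orthogonal complement is shown to be trivial by means of `eq_zero_of_adjoint`. -/
theorem forcing_mem_solvableData (hs : IsSubcritical g L U H) (hα₁ : 0 ≤ α₁) (hα₂ : 0 ≤ α₂)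
    (hβ₁ : 0 ≤ β₁) (hβ₂ : 0 ≤ β₂) (hα : (α₁, α₂) ≠ (0, 0)) (hβ : (β₁, β₂) ≠ (0, 0)) (hT : 0 < T)
    (F : Lp (State L) 2 (volume.restrict (Icc (0 : ℝ) T))) :
    (0, F) ∈ solvableData g U H α₁ α₂ β₁ β₂ T hs.L_pos.le := by
  have hcl := isClosed_solvableData hs hα₁ hα₂ hβ₁ hβ₂ hα hβ hT.le
  set K := (solvableData g U H α₁ α₂ β₁ β₂ T hs.L_pos.le).comap
    (LinearMap.inr ℝ (State L) (Lp (State L) 2 (volume.restrict (Icc (0 : ℝ) T)))) with hK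
  have hKcl : IsClosed (K : Set (Lp (State L) 2 (volume.restrict (Icc (0 : ℝ) T)))) :=
    hcl.preimage (continuous_const.prodMk continuous_id)
  have : CompleteSpace K := hKcl.completeSpace_coe
  suffices hK' : K = ⊤ by
    have : F ∈ K := hK' ▸ Submodule.mem_top
    exact this
  rw [← Submodule.orthogonal_eq_bot_iff, Submodule.eq_bot_iff]
  intro p hp
  have hpi : IntegrableOn p (Icc 0 T) := (Lp.memLp p).integrable (by norm_num)
  have hz := eq_zero_of_adjoint (α₁ := α₁) (α₂ := α₂) (β₁ := β₁) (β₂ := β₂) hs hα₁ hα₂ hβ₁ hβ₂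
    hα hβ hT hpi ?_
  · apply Lp.ext
    filter_upwards [hz, Lp.coeFn_zero (State L) 2 (volume.restrict (Icc (0 : ℝ) T))] with t h1 h2
    rw [h1, h2]
    rfl
  intro w v a b hw hbc t ht
  -- The solution (s - t)₊ w starts from zero, and its forcing is w + (s - t)v after time t and zero
  -- before. Orthogonality of p to this forcing is precisely the hypothesis of `eq_zero_of_adjoint`.
  -- The only kink is at s = t.
  have hreg := IsRegular.of_separated (T := T) (η := fun s => max (s - t) 0)
    (ρ := (Ioi t).indicator fun _ => 1) hs.L_pos.le hw hbc (by fun_prop)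
    ((memLp_const 1).indicator measurableSet_Ioi)
    ⟨{t}, countable_singleton t, fun s hs' => by
      rcases lt_or_gt_of_ne (show s ≠ t from hs'.2) with h | h
      · rw [indicator_of_notMem (by simpa using h.le)]
        refine (hasDerivAt_const s (0 : ℝ)).congr_of_eventuallyEq ?_
        filter_upwards [Iio_mem_nhds h] with x hx
        exact max_eq_right (sub_nonpos.2 (le_of_lt hx))
      · rw [indicator_of_mem (by simpa using h)]
        refine ((hasDerivAt_id s).sub_const t).congr_of_eventuallyEq ?_
        filter_upwards [Ioi_mem_nhds h] with x hx
        exact max_eq_left (sub_nonneg.2 (le_of_lt hx))⟩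
  have hmem := hreg.mem_solvableData hs.L_pos.le
  rw [show max (0 - t) 0 • w = 0 by rw [max_eq_right (by linarith [ht.1]), zero_smul]] at hmem
  have h0 := (Submodule.mem_orthogonal _ _).1 hp (hreg.memLp_forcing.toLp _) hmem
  rw [L2.inner_def] at h0
  have e1 : ∫ s in Icc 0 T, inner ℝ ((hreg.memLp_forcing.toLp _ :
        Lp (State L) 2 (volume.restrict (Icc (0 : ℝ) T))) s) (p s) =
      ∫ s in Icc 0 T, (Ioc t T).indicator
        (fun s => inner ℝ (p s) w + (s - t) * inner ℝ (p s) v) s := by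
    refine integral_congr_ae ?_
    filter_upwards [hreg.memLp_forcing.coeFn_toLp, ae_mem_Icc T] with s h1 h2
    rw [h1, inner_add_left, inner_smul_left, inner_smul_left, real_inner_comm,
      real_inner_comm (p s) v]
    by_cases hst : t < s
    · have hm : s ∈ Ioc t T := ⟨hst, h2.2⟩
      rw [indicator_of_mem (mem_Ioi.2 hst), indicator_of_mem hm,
        max_eq_left (sub_nonneg.2 hst.le)]
      simp
    · have hm : s ∉ Ioc t T := fun h => hst h.1
      have hm' : s ∉ Ioi t := hst
      rw [indicator_of_notMem hm', indicator_of_notMem hm,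
        max_eq_right (sub_nonpos.2 (not_lt.1 hst))]
      simp
  rw [e1, setIntegral_indicator measurableSet_Ioc, inter_eq_self_of_subset_right
    (Ioc_subset_Icc_self.trans (Icc_subset_Icc_left ht.1)),
    ← intervalIntegral.integral_of_le ht.2] at h0
  have hii : ∀ z : State L, IntervalIntegrable (fun s => inner ℝ (p s) z) volume t T := fun z => by
    rw [intervalIntegrable_iff_integrableOn_Ioc_of_le ht.2]
    have h1 : IntegrableOn (fun s => inner ℝ (p s) z) (Icc 0 T) := hpi.inner_const z
    exact h1.mono_set (Ioc_subset_Icc_self.trans (Icc_subset_Icc_left ht.1))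
  rwa [intervalIntegral.integral_add (hii w) ((hii v).continuousOn_mul (by fun_prop))] at h0

/-- Each w in the domain is a stationary solution with forcing v. Subtracting this forcing, which is
already solvable, leaves the initial datum w alone. Density of the domain and closedness give all
initial data. -/
theorem solvableData_eq_top (hs : IsSubcritical g L U H) (hα₁ : 0 ≤ α₁) (hα₂ : 0 ≤ α₂)
    (hβ₁ : 0 ≤ β₁) (hβ₂ : 0 ≤ β₂) (hα : (α₁, α₂) ≠ (0, 0)) (hβ : (β₁, β₂) ≠ (0, 0)) (hT : 0 < T) :
    solvableData g U H α₁ α₂ β₁ β₂ T hs.L_pos.le = ⊤ := by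
  have hcl := isClosed_solvableData hs hα₁ hα₂ hβ₁ hβ₂ hα hβ hT.le
  have hF := forcing_mem_solvableData hs hα₁ hα₂ hβ₁ hβ₂ hα hβ hT
  set K := (solvableData g U H α₁ α₂ β₁ β₂ T hs.L_pos.le).comap
    (LinearMap.inl ℝ (State L) (Lp (State L) 2 (volume.restrict (Icc (0 : ℝ) T)))) with hK
  have hKcl : IsClosed (K : Set (State L)) := hcl.preimage (continuous_id.prodMk continuous_const)
  have : CompleteSpace K := hKcl.completeSpace_coe
  have hK' : K = ⊤ := by
    rw [← Submodule.orthogonal_eq_bot_iff, Submodule.eq_bot_iff]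
    intro P hP
    refine eq_zero_of_orthogonal_domain (α₁ := α₁) (α₂ := α₂) (β₁ := β₁) (β₂ := β₂) hs ?_
    intro w v a b hw hbc
    have hreg := IsRegular.of_separated (T := T) (η := fun _ => 1) (ρ := fun _ => 0)
      hs.L_pos.le hw hbc continuous_const (memLp_const 0)
      ⟨∅, countable_empty, fun s _ => hasDerivAt_const s 1⟩
    have hmem := hreg.mem_solvableData hs.L_pos.le
    have hw0 : (w, 0) ∈ solvableData g U H α₁ α₂ β₁ β₂ T hs.L_pos.le := by
      have := Submodule.sub_mem _ hmem (hF (hreg.memLp_forcing.toLp _))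
      simpa using this
    rw [real_inner_comm]
    exact (Submodule.mem_orthogonal _ _).1 hP w hw0
  rw [Submodule.eq_top_iff']
  rintro ⟨f, F⟩
  have h1 : f ∈ K := hK' ▸ Submodule.mem_top
  have := Submodule.add_mem _ (show (f, 0) ∈ solvableData g U H α₁ α₂ β₁ β₂ T hs.L_pos.le from h1)
    (hF F)
  simpa using this

end

/-! ### Passage from regular solutions to their limits. -/

section

variable {g L T : ℝ} {U H : ℝ → ℝ} {α₁ α₂ β₁ β₂ : ℝ}

/-- The functional `α x₀ + β x₁`. -/
def traceFunctional (α β : ℝ) : EuclideanSpace ℝ (Fin 2) →L[ℝ] ℝ :=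
  α • EuclideanSpace.proj 0 + β • EuclideanSpace.proj 1

theorem traceFunctional_apply (α β : ℝ) (x : EuclideanSpace ℝ (Fin 2)) :
    traceFunctional α β x = α * x 0 + β * x 1 := by
  simp [traceFunctional]

/-- An equation between continuous functions passes from regular solutions to their limits. -/
theorem eq_of_mem_closure {hL : 0 ≤ L} {Y : Type*} [TopologicalSpace Y] [T2Space Y]
    {φ ψ : Data L T × Trajectory L T → Y} (hφ : Continuous φ) (hψ : Continuous ψ)
    (h : ∀ z G q r a b, IsRegular g L U H α₁ α₂ β₁ β₂ T G q r a b → Represents z G q a b →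
      φ z = ψ z)
    {z : Data L T × Trajectory L T}
    (hz : z ∈ (regularGraph g U H α₁ α₂ β₁ β₂ T hL).topologicalClosure) : φ z = ψ z := by
  refine closure_minimal (t := {z | φ z = ψ z}) ?_ (isClosed_eq hφ hψ) hz
  rintro z ⟨G, q, r, a, b, hr, hz⟩
  exact h z G q r a b hr hz

theorem Represents.state_eq (hT : 0 ≤ T) {z : Data L T × Trajectory L T} {G q : ℝ → State L}
    {a b : ℝ → Fin 2 → ℝ} (h : Represents z G q a b) {t : ℝ} (ht : t ∈ Icc 0 T) :
    IccExtend hT z.2.1 t = q t := by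
  rw [IccExtend_of_mem hT _ ht, h.state]

section closure

variable {z : Data L T × Trajectory L T}

theorem continuous_eval_trajectory (t : Icc (0 : ℝ) T) :
    Continuous fun z : Data L T × Trajectory L T => z.2.1 t :=
  (continuous_eval_const t).comp (continuous_fst.comp continuous_snd)

theorem initial_of_mem_closure (hL : 0 ≤ L) (hT : 0 ≤ T)
    (hz : z ∈ (regularGraph g U H α₁ α₂ β₁ β₂ T hL).topologicalClosure) :
    IccExtend hT z.2.1 0 = z.1.1 := by
  rw [IccExtend_of_mem hT _ (left_mem_Icc.2 hT)]
  refine eq_of_mem_closure (ψ := fun z : Data L T × Trajectory L T => z.1.1)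
    (continuous_eval_trajectory _) (by fun_prop) ?_ hz
  intro z G q r a b _ hz
  rw [hz.state, hz.initial]

/-- Each of the terms in the weak form, taken separately, is a continuous linear functional of the
data and the trajectory, so the identity of `IsRegular.weak_eq` is preserved. -/
theorem weak_of_mem_closure (hs : IsSubcritical g L U H) (hT : 0 ≤ T)
    (hz : z ∈ (regularGraph g U H α₁ α₂ β₁ β₂ T hs.L_pos.le).topologicalClosure)
    {φ : ℝ → ℝ} (hφ : ContDiff ℝ ∞ φ) (i : Fin 2) {t : ℝ} (ht : t ∈ Icc 0 T) :
    inner ℝ (testState L i hφ.continuous) (IccExtend hT z.2.1 t) =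
      inner ℝ (testState L i hφ.continuous) z.1.1 + ∫ τ in (0 : ℝ)..t,
        (inner ℝ (testState L i (hφ.continuous_deriv (by simp)))
          (matOp (fluxMatrix g U H) hs.continuousOn_fluxMatrix (IccExtend hT z.2.1 τ)) +
          inner ℝ (testState L i hφ.continuous) (z.1.2 τ) + z.2.2.1 τ i * φ 0 -
          z.2.2.2 τ i * φ L) := by
  set e := testState L i hφ.continuous
  set e' := testState L i (hφ.continuous_deriv (n := ∞) (by simp))
  set M := matOp (fluxMatrix g U H) hs.continuousOn_fluxMatrix
  have hφ0 : ∀ (c : ℝ) (x : EuclideanSpace ℝ (Fin 2)),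
      x i * c = (c • EuclideanSpace.proj i : EuclideanSpace ℝ (Fin 2) →L[ℝ] ℝ) x := fun c x => by
    simp [mul_comm]
  have split : ∀ z : Data L T × Trajectory L T, ∫ τ in (0 : ℝ)..t,
      (inner ℝ e' (M (IccExtend hT z.2.1 τ)) + inner ℝ e (z.1.2 τ) + z.2.2.1 τ i * φ 0 -
        z.2.2.2 τ i * φ L) =
      (∫ τ in (0 : ℝ)..t, ((innerSL ℝ e').comp M) (toTimeLp hT z.2.1 τ)) +
      (∫ τ in (0 : ℝ)..t, innerSL ℝ e (z.1.2 τ)) +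
      (∫ τ in (0 : ℝ)..t, (φ 0 • EuclideanSpace.proj i : EuclideanSpace ℝ (Fin 2) →L[ℝ] ℝ)
        (z.2.2.1 τ)) -
      ∫ τ in (0 : ℝ)..t, (φ L • EuclideanSpace.proj i : EuclideanSpace ℝ (Fin 2) →L[ℝ] ℝ)
        (z.2.2.2 τ) := by
    intro z
    have i1 := intervalIntegrable_clm ((innerSL ℝ e').comp M) ht (toTimeLp hT z.2.1)
    have i2 := intervalIntegrable_clm (innerSL ℝ e) ht z.1.2
    have i3 := intervalIntegrable_clm
      (φ 0 • EuclideanSpace.proj i : EuclideanSpace ℝ (Fin 2) →L[ℝ] ℝ) ht z.2.2.1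
    have i4 := intervalIntegrable_clm
      (φ L • EuclideanSpace.proj i : EuclideanSpace ℝ (Fin 2) →L[ℝ] ℝ) ht z.2.2.2
    rw [← intervalIntegral.integral_add i1 i2, ← intervalIntegral.integral_add (i1.add i2) i3,
      ← intervalIntegral.integral_sub ((i1.add i2).add i3) i4]
    refine intervalIntegral_congr_Icc ht ?_
    filter_upwards [toTimeLp_apply hT z.2.1] with τ hτ
    rw [hτ, ← hφ0, ← hφ0]
    rfl
  have hcont : Continuous fun z : Data L T × Trajectory L T => ∫ τ in (0 : ℝ)..t,
      (inner ℝ e' (M (IccExtend hT z.2.1 τ)) + inner ℝ e (z.1.2 τ) + z.2.2.1 τ i * φ 0 -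
        z.2.2.2 τ i * φ L) := by
    simp only [split]
    have c1 : Continuous fun z : Data L T × Trajectory L T => toTimeLp hT z.2.1 :=
      (toTimeLp hT).continuous.comp (continuous_fst.comp continuous_snd)
    exact (((continuous_integral_clm _ ht c1).add (continuous_integral_clm _ ht (by fun_prop))).add
      (continuous_integral_clm _ ht (by fun_prop))).sub (continuous_integral_clm _ ht (by fun_prop))
  rw [IccExtend_of_mem hT _ ht]
  refine eq_of_mem_closure (φ := fun z => inner ℝ e (z.2.1 ⟨t, ht⟩))
    (ψ := fun z => inner ℝ e z.1.1 + _) (continuous_const.inner (continuous_eval_trajectory _))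
    ((continuous_const.inner (by fun_prop)).add hcont) ?_ hz
  intro z G q r a b h hz
  simp only
  rw [hz.state, h.weak_eq hs hφ i ht, hz.initial]
  congr 1
  refine intervalIntegral_congr_Icc ht ?_
  filter_upwards [hz.forcing, hz.left, hz.right, ae_mem_Icc T] with τ h1 h2 h3 hτ
  rw [h1, h2, h3, hz.state_eq hT hτ]

/-- Pointwise values in time are not continuous on L². The integrals of the conditions over [0,t]
are, and their vanishing for every t is differentiated afterwards. -/
theorem boundary_of_mem_closure (hs : IsSubcritical g L U H) (hT : 0 ≤ T)
    (hz : z ∈ (regularGraph g U H α₁ α₂ β₁ β₂ T hs.L_pos.le).topologicalClosure) :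
    (∀ᵐ τ ∂(volume.restrict (Icc 0 T)), α₁ * z.2.2.1 τ 0 + α₂ * z.2.2.1 τ 1 = 0) ∧
      ∀ᵐ τ ∂(volume.restrict (Icc 0 T)), β₁ * z.2.2.2 τ 0 - β₂ * z.2.2.2 τ 1 = 0 := by
  have hm := right_mem_Icc.2 hT
  constructor
  · have key := ae_eq_zero_of_primitive_eq_zero hT
      (intervalIntegrable_clm (traceFunctional α₁ α₂) hm z.2.2.1) fun t ht => by
        refine eq_of_mem_closure (φ := fun z : Data L T × Trajectory L T =>
          ∫ τ in (0 : ℝ)..t, traceFunctional α₁ α₂ (z.2.2.1 τ)) (ψ := fun _ => 0)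
          (continuous_integral_clm _ ht (by fun_prop)) continuous_const ?_ hz
        intro z G q r a b h hz
        refine intervalIntegral_eq_zero_of_ae ht ?_
        filter_upwards [hz.left, ae_mem_Icc T] with τ h1 hτ
        rw [traceFunctional_apply, h1]
        exact (h.boundary τ hτ).1
    filter_upwards [key] with τ hτ
    rwa [traceFunctional_apply] at hτ
  · have key := ae_eq_zero_of_primitive_eq_zero hT
      (intervalIntegrable_clm (traceFunctional β₁ (-β₂)) hm z.2.2.2) fun t ht => by
        refine eq_of_mem_closure (φ := fun z : Data L T × Trajectory L T =>
          ∫ τ in (0 : ℝ)..t, traceFunctional β₁ (-β₂) (z.2.2.2 τ)) (ψ := fun _ => 0)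
          (continuous_integral_clm _ ht (by fun_prop)) continuous_const ?_ hz
        intro z G q r a b h hz
        refine intervalIntegral_eq_zero_of_ae ht ?_
        filter_upwards [hz.right, ae_mem_Icc T] with τ h1 hτ
        rw [traceFunctional_apply, h1]
        linarith [(h.boundary τ hτ).2]
    filter_upwards [key] with τ hτ
    rw [traceFunctional_apply] at hτ
    linarith

/-- The boundary term is quadratic in the traces, so weak convergence of them would not suffice.
Both traces belong to the graph with their L²(0,T) norms, which makes the integral of their product
continuous. -/
theorem energy_of_mem_closure (hs : IsSubcritical g L U H) (hT : 0 ≤ T)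
    (hz : z ∈ (regularGraph g U H α₁ α₂ β₁ β₂ T hs.L_pos.le).topologicalClosure)
    {t : ℝ} (ht : t ∈ Icc 0 T) :
    wInner g U H (IccExtend hT z.2.1 t) (IccExtend hT z.2.1 t) - wInner g U H z.1.1 z.1.1 =
      ∫ τ in (0 : ℝ)..t, 2 * (boundaryTerm (fun τ => (z.2.2.1 τ).ofLp) (fun τ => (z.2.2.2 τ).ofLp) τ +
        wInner g U H (z.1.2 τ) (IccExtend hT z.2.1 τ)) := by
  set W := matOp (L := L) (weightMatrix g U H) hs.continuousOn_weightMatrix with hW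
  have hwin : ∀ p q : State L, wInner g U H p q = inner ℝ p (W q) := hs.wInner_eq
  set ρ : Fin 2 → State T →L[ℝ] Lp ℝ 2 (volume.restrict (Icc 0 T)) := fun i =>
    (EuclideanSpace.proj i : EuclideanSpace ℝ (Fin 2) →L[ℝ] ℝ).compLpL 2 (volume.restrict (Icc 0 T))
    with hρ
  have hρa : ∀ (i : Fin 2) (A : State T),
      ∀ᵐ τ ∂(volume.restrict (Icc 0 T)), ρ i A τ = A τ i := fun i A =>
    (EuclideanSpace.proj i : EuclideanSpace ℝ (Fin 2) →L[ℝ] ℝ).coeFn_compLpL A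
  set Wt := W.compLpL 2 (volume.restrict (Icc 0 T)) with hWt
  have split : ∀ z : Data L T × Trajectory L T, ∫ τ in (0 : ℝ)..t,
      2 * (boundaryTerm (fun τ => (z.2.2.1 τ).ofLp) (fun τ => (z.2.2.2 τ).ofLp) τ +
        wInner g U H (z.1.2 τ) (IccExtend hT z.2.1 τ)) =
      2 * ((∫ τ in (0 : ℝ)..t, inner ℝ (ρ 0 z.2.2.1 τ) (ρ 1 z.2.2.1 τ)) -
        (∫ τ in (0 : ℝ)..t, inner ℝ (ρ 0 z.2.2.2 τ) (ρ 1 z.2.2.2 τ)) +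
        ∫ τ in (0 : ℝ)..t, inner ℝ (z.1.2 τ) (Wt (toTimeLp hT z.2.1) τ)) := by
    intro z
    have i1 := intervalIntegrable_inner ht (ρ 0 z.2.2.1) (ρ 1 z.2.2.1)
    have i2 := intervalIntegrable_inner ht (ρ 0 z.2.2.2) (ρ 1 z.2.2.2)
    have i3 := intervalIntegrable_inner ht z.1.2 (Wt (toTimeLp hT z.2.1))
    rw [← intervalIntegral.integral_sub i1 i2, ← intervalIntegral.integral_add (i1.sub i2) i3,
      ← intervalIntegral.integral_const_mul]
    refine intervalIntegral_congr_Icc ht ?_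
    filter_upwards [hρa 0 z.2.2.1, hρa 1 z.2.2.1, hρa 0 z.2.2.2, hρa 1 z.2.2.2,
      toTimeLp_apply hT z.2.1, W.coeFn_compLpL (toTimeLp hT z.2.1)] with τ h1 h2 h3 h4 h5 h6
    rw [h1, h2, h3, h4, hWt, h6, h5, hwin, boundaryTerm]
    simp only [RCLike.inner_apply, conj_trivial]
    ring
  have hcont : Continuous fun z : Data L T × Trajectory L T => ∫ τ in (0 : ℝ)..t,
      2 * (boundaryTerm (fun τ => (z.2.2.1 τ).ofLp) (fun τ => (z.2.2.2 τ).ofLp) τ +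
        wInner g U H (z.1.2 τ) (IccExtend hT z.2.1 τ)) := by
    simp only [split]
    have c1 : Continuous fun z : Data L T × Trajectory L T => Wt (toTimeLp hT z.2.1) :=
      Wt.continuous.comp ((toTimeLp hT).continuous.comp (continuous_fst.comp continuous_snd))
    have c2 : ∀ i, Continuous fun z : Data L T × Trajectory L T => ρ i z.2.2.1 := fun i =>
      (ρ i).continuous.comp (by fun_prop)
    have c3 : ∀ i, Continuous fun z : Data L T × Trajectory L T => ρ i z.2.2.2 := fun i =>
      (ρ i).continuous.comp (by fun_prop)
    exact continuous_const.mul (((continuous_integral_inner ht (c2 0) (c2 1)).sub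
      (continuous_integral_inner ht (c3 0) (c3 1))).add
      (continuous_integral_inner ht (by fun_prop) c1))
  rw [IccExtend_of_mem hT _ ht]
  have c4 := continuous_eval_trajectory (L := L) (T := T) ⟨t, ht⟩
  refine eq_of_mem_closure
    (φ := fun z => wInner g U H (z.2.1 ⟨t, ht⟩) (z.2.1 ⟨t, ht⟩) - wInner g U H z.1.1 z.1.1)
    ?_ hcont ?_ hz
  · simp only [hwin]
    exact (c4.inner (W.continuous.comp c4)).sub (Continuous.inner (by fun_prop)
      (W.continuous.comp (by fun_prop)))
  · intro z G q r a b h hz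
    simp only
    rw [hz.state, hz.initial, h.energy_eq hs ht]
    refine intervalIntegral_congr_Icc ht ?_
    filter_upwards [hz.forcing, hz.left, hz.right, ae_mem_Icc T] with τ h1 h2 h3 hτ
    rw [boundaryTerm, boundaryTerm, h1, h2, h3, hz.state_eq hT hτ]

end closure

/-- Existence of a weak solution that satisfies the energy identity. -/
theorem exists_weakSolution (hs : IsSubcritical g L U H) (hα₁ : 0 ≤ α₁) (hα₂ : 0 ≤ α₂)
    (hβ₁ : 0 ≤ β₁) (hβ₂ : 0 ≤ β₂) (hα : (α₁, α₂) ≠ (0, 0)) (hβ : (β₁, β₂) ≠ (0, 0)) (hT : 0 < T)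
    (f : State L) {G : ℝ → State L} (hG : MemLp G 2 (volume.restrict (Icc 0 T))) :
    ∃ (q : ℝ → State L) (F0 FL : ℝ → Fin 2 → ℝ),
      IsWeakSolution g L U H α₁ α₂ β₁ β₂ T f G q F0 FL ∧ ∀ t ∈ Icc 0 T,
        wInner g U H (q t) (q t) - wInner g U H f f =
          ∫ τ in (0 : ℝ)..t, 2 * (boundaryTerm F0 FL τ + wInner g U H (G τ) (q τ)) := by
  have hmem : (f, hG.toLp G) ∈ solvableData g U H α₁ α₂ β₁ β₂ T hs.L_pos.le := by
    rw [solvableData_eq_top hs hα₁ hα₂ hβ₁ hβ₂ hα hβ hT]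
    trivial
  obtain ⟨z, hz, hzd⟩ := hmem
  have hz1 : z.1.1 = f := congrArg Prod.fst hzd
  have hz2 : z.1.2 = hG.toLp G := congrArg Prod.snd hzd
  have hF : ∀ᵐ τ ∂(volume.restrict (Icc 0 T)), z.1.2 τ = G τ := by
    rw [hz2]
    exact hG.coeFn_toLp
  refine ⟨IccExtend hT.le z.2.1, fun τ => (z.2.2.1 τ).ofLp, fun τ => (z.2.2.2 τ).ofLp, ?_, ?_⟩
  · refine ⟨(z.2.1.continuous.Icc_extend' (h := hT.le)).continuousOn, ?_, memLp_apply z.2.2.1,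
      memLp_apply z.2.2.2, ?_, (boundary_of_mem_closure hs hT.le hz).1,
      (boundary_of_mem_closure hs hT.le hz).2⟩
    · rw [initial_of_mem_closure hs.L_pos.le hT.le hz, hz1]
    · intro φ hφ i t ht
      have := weak_of_mem_closure hs hT.le hz hφ i ht
      simp only [integral_flux_mul hs i (hφ.continuous_deriv (by simp)),
        ← inner_testState i hφ.continuous]
      rw [this, hz1]
      congr 1
      refine intervalIntegral_congr_Icc ht ?_
      filter_upwards [hF] with τ hτ
      rw [hτ]
  · intro t ht
    rw [← hz1, energy_of_mem_closure hs hT.le hz ht]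
    refine intervalIntegral_congr_Icc ht ?_
    filter_upwards [hF] with τ hτ
    rw [hτ]

end

/-! ### The energy estimate and strong well-posedness. -/

section

variable {g L T : ℝ} {U H : ℝ → ℝ} {α₁ α₂ β₁ β₂ : ℝ}

theorem isSubcritical_of_froude_lt_one (hg : 0 < g) (hL : 0 < L)
    (hU : ContDiffOn ℝ 1 U (Icc 0 L)) (hH : ContDiffOn ℝ 1 H (Icc 0 L))
    (hHpos : ∀ x ∈ Icc 0 L, 0 < H x) (hFr : ∀ x ∈ Icc 0 L, |U x| / √(g * H x) < 1) :
    IsSubcritical g L U H where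
  g_pos := hg
  L_pos := hL
  continuousOn_U := hU.continuousOn
  contDiffOn_H := hH
  H_pos := hHpos
  det_pos x hx := by
    have hgH : 0 < g * H x := mul_pos hg (hHpos x hx)
    have h := hFr x hx
    rw [div_lt_one (Real.sqrt_pos.2 hgH), Real.lt_sqrt (abs_nonneg _), sq_abs] at h
    linarith

theorem IsForcing.memLp (hs : IsSubcritical g L U H) {G : ℝ → State L}
    (hG : IsForcing g U H T G) : MemLp G 2 (volume.restrict (Icc 0 T)) := by
  obtain ⟨c, hc, hcoer⟩ := hs.exists_coercive
  obtain ⟨B, hB⟩ := hG.bddAbove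
  refine MemLp.of_bound hG.aestronglyMeasurable (√(B ^ 2 / c)) ?_
  filter_upwards [ae_mem_Icc T] with τ hτ
  refine Real.le_sqrt_of_sq_le ?_
  rw [le_div_iff₀ hc, mul_comm]
  refine (hcoer (G τ)).trans ?_
  rw [← hs.wNorm_sq]
  exact pow_le_pow_left₀ (Real.sqrt_nonneg _) (hB (mem_image_of_mem _ hτ)) 2

theorem forcingSup_nonneg (G : ℝ → State L) (t : ℝ) : 0 ≤ forcingSup g U H G t := by
  refine Real.sSup_nonneg ?_
  rintro _ ⟨τ, -, rfl⟩
  exact Real.sqrt_nonneg _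

theorem IsForcing.wNorm_le_forcingSup {G : ℝ → State L} (hG : IsForcing g U H T G) {t τ : ℝ}
    (ht : t ≤ T) (hτ : τ ∈ Icc 0 t) : wNorm g U H (G τ) ≤ forcingSup g U H G t :=
  le_csSup (hG.bddAbove.mono (image_mono (Icc_subset_Icc_right ht))) (mem_image_of_mem _ hτ)

/-- The Cauchy-Schwarz inequality for the weighted inner product. -/
theorem IsSubcritical.wInner_le (hs : IsSubcritical g L U H) (p q : State L) :
    wInner g U H p q ≤ wNorm g U H p * wNorm g U H q := by
  have hsymm : wInner g U H q p = wInner g U H p q := by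
    unfold wInner
    congr 1
    ext x
    simp [weightMatrix, Matrix.mulVec, dotProduct, Fin.sum_univ_two]
    ring
  have hexp : ∀ s : ℝ, 0 ≤ wInner g U H q q * (s * s) + (2 * wInner g U H p q) * s +
      wInner g U H p p := by
    intro s
    have h := hs.wInner_nonneg (p + s • q)
    rw [hs.wInner_eq] at h hsymm ⊢
    rw [hs.wInner_eq] at hsymm ⊢
    rw [hs.wInner_eq]
    simp only [matForm, map_add, map_smul, inner_add_left, inner_add_right, real_inner_smul_left,
      real_inner_smul_right] at h hsymm ⊢
    rw [hsymm] at h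
    linarith
  have hd := discrim_le_zero hexp
  rw [discrim, ← hs.wNorm_sq p, ← hs.wNorm_sq q] at hd
  refine le_of_abs_le (abs_le_of_sq_le_sq ?_ (mul_nonneg (Real.sqrt_nonneg _) (Real.sqrt_nonneg _)))
  nlinarith

variable {f : State L} {G q : ℝ → State L} {F0 FL : ℝ → Fin 2 → ℝ}

theorem IsWeakSolution.integrableOn_boundaryTerm
    (h : IsWeakSolution g L U H α₁ α₂ β₁ β₂ T f G q F0 FL) :
    IntegrableOn (boundaryTerm F0 FL) (Icc 0 T) :=
  ((h.trace_zero 0).integrable_mul (h.trace_zero 1)).sub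
    ((h.trace_L 0).integrable_mul (h.trace_L 1))

theorem IsWeakSolution.boundaryTerm_nonpos (hα₁ : 0 ≤ α₁) (hα₂ : 0 ≤ α₂) (hβ₁ : 0 ≤ β₁)
    (hβ₂ : 0 ≤ β₂) (hα : (α₁, α₂) ≠ (0, 0)) (hβ : (β₁, β₂) ≠ (0, 0))
    (h : IsWeakSolution g L U H α₁ α₂ β₁ β₂ T f G q F0 FL) :
    ∀ᵐ τ ∂(volume.restrict (Icc 0 T)), boundaryTerm F0 FL τ ≤ 0 := by
  filter_upwards [h.bc_zero, h.bc_L] with τ h0 hL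
  exact BoundaryCond.product_nonpos hα₁ hα₂ hβ₁ hβ₂ hα hβ ⟨h0, hL⟩

/-- The energy identity for weak solutions. -/
theorem IsWeakSolution.energy_eq (hs : IsSubcritical g L U H) (hα₁ : 0 ≤ α₁) (hα₂ : 0 ≤ α₂)
    (hβ₁ : 0 ≤ β₁) (hβ₂ : 0 ≤ β₂) (hα : (α₁, α₂) ≠ (0, 0)) (hβ : (β₁, β₂) ≠ (0, 0)) (hT : 0 < T)
    (hG : MemLp G 2 (volume.restrict (Icc 0 T)))
    (h : IsWeakSolution g L U H α₁ α₂ β₁ β₂ T f G q F0 FL) {t : ℝ} (ht : t ∈ Icc 0 T) :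
    wInner g U H (q t) (q t) - wInner g U H f f =
      ∫ τ in (0 : ℝ)..t, 2 * (boundaryTerm F0 FL τ + wInner g U H (G τ) (q τ)) := by
  -- A general weak solution is too irregular for the identity to be derived directly. It is
  -- transferred from the constructed solution, with which the given one agrees in state and traces.
  obtain ⟨q', F0', FL', h', henergy⟩ :=
    exists_weakSolution hs hα₁ hα₂ hβ₁ hβ₂ hα hβ hT f hG
  obtain ⟨hq, h0, h1⟩ := h.unique hs hα₁ hα₂ hβ₁ hβ₂ hα hβ hT (hG.integrable one_le_two) h'
  rw [hq ht, henergy t ht]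
  refine intervalIntegral_congr_Icc ht ?_
  filter_upwards [h0, h1, ae_mem_Icc T] with τ h0 h1 hτ
  simp only [boundaryTerm, h0, h1, hq hτ]

/-- The energy estimate. -/
theorem IsWeakSolution.wNorm_le (hs : IsSubcritical g L U H) (hα₁ : 0 ≤ α₁) (hα₂ : 0 ≤ α₂)
    (hβ₁ : 0 ≤ β₁) (hβ₂ : 0 ≤ β₂) (hα : (α₁, α₂) ≠ (0, 0)) (hβ : (β₁, β₂) ≠ (0, 0)) (hT : 0 < T)
    (hG : IsForcing g U H T G)
    (h : IsWeakSolution g L U H α₁ α₂ β₁ β₂ T f G q F0 FL) {t μ : ℝ} (ht : t ∈ Icc 0 T)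
    (hμ : ∀ᵐ τ ∂(volume.restrict (Icc 0 t)), q τ ≠ 0 →
      boundaryTerm F0 FL τ / wNorm g U H (q τ) ^ 2 ≤ μ) :
    wNorm g U H (q t) ≤ growthFactor μ t * Real.exp (μ * t) *
      (wNorm g U H f + forcingSup g U H G t) := by
  have hmem := hG.memLp hs
  have hsub : Icc 0 t ⊆ Icc 0 T := Icc_subset_Icc_right ht.2
  have hcont : ContinuousOn (fun τ => wInner g U H (q τ) (q τ)) (Icc 0 t) := by
    have hq := h.continuousOn.mono hsub
    simp only [hs.wInner_eq, matForm]
    exact hq.inner ((matOp _ hs.continuousOn_weightMatrix).continuous.comp_continuousOn hq)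
  have hint : IntegrableOn (fun τ => 2 * (boundaryTerm F0 FL τ + wInner g U H (G τ) (q τ)))
      (Icc 0 T) := by
    refine (h.integrableOn_boundaryTerm.add ?_).const_mul 2
    simp only [hs.wInner_eq]
    exact integrableOn_matForm _ (hmem.integrable one_le_two) h.continuousOn
  -- Where q = 0 the hypothesis on the quotient says nothing, but there the right side is zero and
  -- the boundary conditions already give BT ≤ 0.
  have hBT : ∀ᵐ τ ∂(volume.restrict (Icc 0 t)),
      boundaryTerm F0 FL τ ≤ μ * wInner g U H (q τ) (q τ) := by
    filter_upwards [hμ, ae_restrict_of_ae_restrict_of_subset hsub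
      (h.boundaryTerm_nonpos hα₁ hα₂ hβ₁ hβ₂ hα hβ)] with τ hτ hneg
    rw [← hs.wNorm_sq]
    by_cases hq : q τ = 0
    · rw [hq, hs.wNorm_sq, hs.wInner_eq]
      simpa [matForm] using hneg
    · obtain ⟨c, hc, hcoer⟩ := hs.exists_coercive
      refine (div_le_iff₀ ?_).1 (hτ hq)
      rw [hs.wNorm_sq]
      exact (by positivity : 0 < c * ‖q τ‖ ^ 2).trans_le (hcoer _)
  have hS : 0 ≤ forcingSup g U H G t := forcingSup_nonneg G t
  have key := sqrt_le_gronwallBound (y := fun τ => wInner g U H (q τ) (q τ)) (t := t) (μ := μ)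
    (S := forcingSup g U H G t) ht.1 hS hcont (fun s _ => hs.wInner_nonneg _) ?_
  · refine key.trans ?_
    rw [h.initial]
    exact gronwallBound_le_growthFactor (Real.sqrt_nonneg _) hS
  intro s hst s' hs'
  have hs's : s' ∈ Icc 0 t := ⟨hst.1.trans hs'.1, hs'.2⟩
  have hi : ∀ r ∈ Icc 0 t, IntervalIntegrable
      (fun τ => 2 * (boundaryTerm F0 FL τ + wInner g U H (G τ) (q τ))) volume 0 r := fun r hr =>
    intervalIntegrable_of_Icc (hsub hr) hint
  have hdiff : wInner g U H (q s') (q s') - wInner g U H (q s) (q s) =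
      ∫ τ in s..s', 2 * (boundaryTerm F0 FL τ + wInner g U H (G τ) (q τ)) := by
    rw [← intervalIntegral.integral_interval_sub_left (hi s' hs's) (hi s hst),
      ← h.energy_eq hs hα₁ hα₂ hβ₁ hβ₂ hα hβ hT hmem (hsub hs's),
      ← h.energy_eq hs hα₁ hα₂ hβ₁ hβ₂ hα hβ hT hmem (hsub hst)]
    ring
  change wInner g U H (q s') (q s') - wInner g U H (q s) (q s) ≤ _
  rw [hdiff]
  have hss : Icc s s' ⊆ Icc 0 t := Icc_subset_Icc hst.1 hs'.2
  refine intervalIntegral.integral_mono_ae_restrict hs'.1 ((hi s hst).symm.trans (hi s' hs's))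
    (ContinuousOn.intervalIntegrable ?_) ?_
  · rw [uIcc_of_le hs'.1]
    have := hcont.mono hss
    fun_prop
  · filter_upwards [ae_restrict_of_ae_restrict_of_subset hss hBT,
      ae_restrict_mem measurableSet_Icc] with τ hτ hmτ
    have h1 := hs.wInner_le (G τ) (q τ)
    have h2 := mul_le_mul_of_nonneg_right (hG.wNorm_le_forcingSup ht.2 (hss hmτ))
      (Real.sqrt_nonneg (wInner g U H (q τ) (q τ)))
    change _ ≤ _ * wNorm g U H (q τ) at h1
    rw [wNorm] at h1
    rw [wNorm] at h1 h2
    linarith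

theorem stronglyWellPosed (hs : IsSubcritical g L U H) (hα₁ : 0 ≤ α₁) (hα₂ : 0 ≤ α₂)
    (hβ₁ : 0 ≤ β₁) (hβ₂ : 0 ≤ β₂) (hα : (α₁, α₂) ≠ (0, 0)) (hβ : (β₁, β₂) ≠ (0, 0)) :
    StronglyWellPosed g L U H α₁ α₂ β₁ β₂ := by
  -- With rate 0 the factor is max(1, t), which depends on time. It is at most eᵗ, so K = 1 and μ =
  -- 1 serve for all final times.
  refine ⟨1, one_pos, 1, fun T hT f G hG => ?_⟩
  have hmem := hG.memLp hs
  obtain ⟨q, F0, FL, h, -⟩ := exists_weakSolution hs hα₁ hα₂ hβ₁ hβ₂ hα hβ hT f hmem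
  refine ⟨q, ⟨F0, FL, h⟩, ?_, fun t ht => ?_⟩
  · rintro p ⟨P0, PL, hp⟩
    exact (hp.unique hs hα₁ hα₂ hβ₁ hβ₂ hα hβ hT (hmem.integrable one_le_two) h).1
  · refine (h.wNorm_le (μ := 0) hs hα₁ hα₂ hβ₁ hβ₂ hα hβ hT hG ht ?_).trans ?_
    · filter_upwards [ae_restrict_of_ae_restrict_of_subset (Icc_subset_Icc_right ht.2)
        (h.boundaryTerm_nonpos hα₁ hα₂ hβ₁ hβ₂ hα hβ)] with τ hτ _
      exact div_nonpos_of_nonpos_of_nonneg hτ (sq_nonneg _)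
    · refine mul_le_mul_of_nonneg_right ?_
        (add_nonneg (Real.sqrt_nonneg _) (forcingSup_nonneg G t))
      have h1 := Real.add_one_le_exp t
      have h2 := ht.1
      simp only [growthFactor, if_true, zero_mul, Real.exp_zero, mul_one, one_mul]
      exact max_le (by linarith) (by linarith)

end

end LinearSWE

end

theorem theorem2 (g L : ℝ) (hg : 0 < g) (hL : 0 < L) (U H : ℝ → ℝ)
    (hU : ContDiffOn ℝ 1 U (Icc 0 L)) (hH : ContDiffOn ℝ 1 H (Icc 0 L))
    (hHpos : ∀ x ∈ Icc 0 L, 0 < H x)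
    (hFr : ∀ x ∈ Icc 0 L, |U x| / √(g * H x) < 1)
    (α₁ α₂ β₁ β₂ : ℝ) (hα₁ : 0 ≤ α₁) (hα₂ : 0 ≤ α₂) (hβ₁ : 0 ≤ β₁) (hβ₂ : 0 ≤ β₂)
    (hα : (α₁, α₂) ≠ (0, 0)) (hβ : (β₁, β₂) ≠ (0, 0)) :
    LinearSWE.StronglyWellPosed g L U H α₁ α₂ β₁ β₂ ∧
    ∀ T > (0 : ℝ), ∀ (f : LinearSWE.State L) (G q : ℝ → LinearSWE.State L)
      (F0 FL : ℝ → Fin 2 → ℝ), LinearSWE.IsForcing g U H T G →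
      LinearSWE.IsWeakSolution g L U H α₁ α₂ β₁ β₂ T f G q F0 FL →
      (∀ᵐ τ ∂(volume.restrict (Icc 0 T)), LinearSWE.boundaryTerm F0 FL τ ≤ 0) ∧
      ∀ t ∈ Icc 0 T, ∀ μ : ℝ,
        (∀ᵐ τ ∂(volume.restrict (Icc 0 t)), q τ ≠ 0 →
          LinearSWE.boundaryTerm F0 FL τ / LinearSWE.wNorm g U H (q τ) ^ 2 ≤ μ) →
        LinearSWE.wNorm g U H (q t) ≤
          LinearSWE.growthFactor μ t * Real.exp (μ * t) *
            (LinearSWE.wNorm g U H f + LinearSWE.forcingSup g U H G t) := by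
  have hs := LinearSWE.isSubcritical_of_froude_lt_one hg hL hU hH hHpos hFr
  exact ⟨LinearSWE.stronglyWellPosed hs hα₁ hα₂ hβ₁ hβ₂ hα hβ,
    fun T hT f G q F0 FL hG h => ⟨h.boundaryTerm_nonpos hα₁ hα₂ hβ₁ hβ₂ hα hβ,
      fun t ht μ hμ => h.wNorm_le hs hα₁ hα₂ hβ₁ hβ₂ hα hβ hT hG ht hμ⟩⟩
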